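/- Let $\omega=(Z_k,E_k)_{k\in\mathbb Z}$ be a random sequence in $\mathbb R\times\mathbb R$ with law $\mathbb P$. It encodes the marked points $(x_k,E_k)$, $k\in\mathbb Z$, with $x_0=0$ and $x_{k+1}-x_k=Z_k$. Assume: (A1) the sequence $(Z_k,E_k)_{k\in\mathbb Z}$ is stationary and ergodic with respect to shifts; (A2) $\mathbb E[Z_0]<\infty$; (A3) for every integer $\ell\neq 0$, with probability one the sequence $\omega$ is not equal to its shift by $\ell$; (A4) there is $d>0$ with $\mathbb P(Z_0\ge d)=1$. Let $\lambda\in(0,1)$ and let $u:\mathbb R\times\mathbb R\to\mathbb R$ be bounded, symmetric and continuous. For $i\ne k$ put $$r^\lambda_{x_i,x_k}(\omega)=\exp\{-|x_i-x_k|+\lambda(x_k-x_i)-u(E_i,E_k)\},\qquad r^\lambda_{x_i,x_i}(\omega)=0,\qquad p^\lambda_{x_i,x_k}(\omega)=\frac{r^\lambda_{x_i,x_k}(\omega)}{\sum_j r^\lambda_{x_i,x_j}(\omega)}.$$ Let $X^{\omega,\lambda}_t$ be the continuous-time random walk on $\{x_k\}$ started at $0$ with jump rates $r^\lambda$, let $Y^{\omega,\lambda}_n$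 be the discrete-time random walk on $\{x_k\}$ started at $0$ with jump probabilities $p^\lambda$, and let $\varphi_\lambda(\omega)=\sum_i x_i\,p^\lambda_{0,x_i}(\omega)$ be the local drift. Write $\tau_{x_k}\omega$ for the environment translated by $x_k$, i.e. the sequence $(Z_{j+k},E_{j+k})_{j\in\mathbb Z}$. The environment viewed from the walker is the Markov chain $(\tau_{Y^{\omega,\lambda}_n}\omega)_{n\ge 0}$, which jumps from $\omega$ to $\tau_{x_k}\omega$ with probability $p^\lambda_{0,x_k}(\omega)$. Suppose that $\mathbb E[e^{(1-\lambda)Z_0}]<\infty$. Then the environment viewed from the walker $Y^{\omega,\lambda}_n$ admits an invariant and ergodic probability distribution $\mathbb Q_\lambda$ that is mutually absolutely continuous with respect to $\mathbb P$. Moreover, for $\mathbb P$-almost every $\omega$ the limits $$v_Y(\lambda)=\lim_{n\to\infty}\frac{Y^{\omega,\lambda}_n}{n},\qquad v_X(\lambda)=\lim_{t\to\infty}\frac{X^{\omega,\lambda}_t}{t}$$ exist almost surely, and are finite and deterministic; $\varphi_\lambda$ and $1/\sum_k r^\lambda_{0,x_k}$ are $\mathbb Q_\lambda$-integrable; and $$v_Y(\lambda)=\mathbb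 Q_\lambda[\varphi_\lambda],\qquad v_X(\lambda)=\frac{v_Y(\lambda)}{\mathbb Q_\lambda\Big[1/\sum_k r^\lambda_{0,x_k}\Big]}.$$ -/

import Mathlib

open MeasureTheory ProbabilityTheory Filter Topology

namespace Mott

/-- An environment: the two-sided sequence `(Z_k, E_k)`, `k ∈ ℤ`, of interpoint distances and
energy marks.  It encodes the marked point configuration `{(x_k, E_k)}` labelled in increasing
order with `x_0 = 0`. -/
abbrev Env : Type := ℤ → ℝ × ℝ

/-- The interpoint distance `Z_k = x_{k+1} - x_k`. -/
def gap (ω : Env) (k : ℤ) : ℝ := (ω k).1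

/-- The energy mark `E_k`. -/
def mark (ω : Env) (k : ℤ) : ℝ := (ω k).2

/-- The position `x_k` of the `k`-th point: `x_0 = 0` and `x_{k+1} - x_k = Z_k`. -/
noncomputable def pos (ω : Env) (k : ℤ) : ℝ :=
  ∑ j ∈ Finset.Ico 0 k, gap ω j - ∑ j ∈ Finset.Ico k 0, gap ω j

/-- The environment seen from the `k`-th point, that is, the translate `τ_{x_k} ω`. -/
def shift (k : ℤ) (ω : Env) : Env := fun j => ω (j + k)

lemma pos_zero (ω : Env) : pos ω 0 = 0 := by simp [pos]

lemma pos_succ (ω : Env) (k : ℤ) : pos ω (k + 1) = pos ω k + gap ω k := by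
  unfold pos
  rcases le_or_gt 0 k with h | h
  · rw [Finset.Ico_eq_empty (a := k + 1) (by omega), Finset.Ico_eq_empty (a := k) (by omega)]
    have : Finset.Ico 0 (k + 1) = insert k (Finset.Ico 0 k) := by
      ext j; simp only [Finset.mem_Ico, Finset.mem_insert]; omega
    rw [this, Finset.sum_insert (by simp)]
    simp; ring
  · rw [Finset.Ico_eq_empty (b := k + 1) (by omega), Finset.Ico_eq_empty (b := k) (by omega)]
    have : Finset.Ico k 0 = insert k (Finset.Ico (k + 1) 0) := by
      ext j; simp only [Finset.mem_Ico, Finset.mem_insert]; omega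
    rw [this, Finset.sum_insert (by simp)]
    simp

/-- The points of the shifted environment are the translated points `x_{j+k} - x_k`. -/
lemma pos_shift (ω : Env) (k j : ℤ) : pos (shift k ω) j = pos ω (j + k) - pos ω k := by
  have hs : ∀ i, pos (shift k ω) (i + 1) = pos (shift k ω) i + gap ω (i + k) :=
    fun i => pos_succ _ i
  induction j using Int.induction_on with
  | zero => simp [pos_zero]
  | succ i ih =>
    have := pos_succ ω (i + k)
    rw [hs, ih, show ((i : ℤ) + 1 + k) = i + k + 1 by ring, this]; ring
  | pred i ih =>
    have h1 := hs (-(i : ℤ) - 1)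
    have h2 := pos_succ ω (-(i : ℤ) - 1 + k)
    rw [show (-(i : ℤ) - 1 + 1) = -i by ring] at h1
    rw [show (-(i : ℤ) - 1 + k + 1) = -i + k by ring] at h2
    linarith

/-- The jump rate `r^λ_{x_i, x_j}(ω)`, with the convention `r^λ_{x, x} = 0`. -/
noncomputable def rate (lam : ℝ) (u : ℝ → ℝ → ℝ) (ω : Env) (i j : ℤ) : ℝ :=
  if i = j then 0
  else Real.exp (-|pos ω i - pos ω j| + lam * (pos ω j - pos ω i) - u (mark ω i) (mark ω j))

/-- The total jump rate `∑_k r^λ_{x_i, x_k}(ω)` out of `x_i`. -/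
noncomputable def totalRate (lam : ℝ) (u : ℝ → ℝ → ℝ) (ω : Env) (i : ℤ) : ℝ :=
  ∑' k, rate lam u ω i k

/-- The jump probability `p^λ_{x_i, x_j}(ω) = r^λ_{x_i, x_j}(ω) / ∑_k r^λ_{x_i, x_k}(ω)`. -/
noncomputable def jumpProb (lam : ℝ) (u : ℝ → ℝ → ℝ) (ω : Env) (i j : ℤ) : ℝ :=
  rate lam u ω i j / totalRate lam u ω i

/-- The local drift `φ_λ(ω) = ∑_i x_i p^λ_{0, x_i}(ω)`. -/
noncomputable def drift (lam : ℝ) (u : ℝ → ℝ → ℝ) (ω : Env) : ℝ :=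
  ∑' i, pos ω i * jumpProb lam u ω 0 i

lemma rate_nonneg (lam : ℝ) (u : ℝ → ℝ → ℝ) (ω : Env) (i j : ℤ) : 0 ≤ rate lam u ω i j := by
  unfold rate; split_ifs <;> positivity

lemma rate_shift (lam : ℝ) (u : ℝ → ℝ → ℝ) (ω : Env) (k i j : ℤ) :
    rate lam u (shift k ω) i j = rate lam u ω (i + k) (j + k) := by
  unfold rate
  simp only [pos_shift, add_left_inj, mark, shift, sub_sub_sub_cancel_right]

/-- Spatial homogeneity `p^λ_{x_i, x_j}(τ_{x_k} ω) = p^λ_{x_{i+k}, x_{j+k}}(ω)`: this is why the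
environment viewed from the walker is a Markov chain with transition kernel `envKernel` below. -/
lemma jumpProb_shift (lam : ℝ) (u : ℝ → ℝ → ℝ) (ω : Env) (k i j : ℤ) :
    jumpProb lam u (shift k ω) i j = jumpProb lam u ω (i + k) (j + k) := by
  unfold jumpProb totalRate
  simp only [rate_shift]
  rw [← (Equiv.addRight k).tsum_eq (fun m => rate lam u ω (i + k) m)]
  rfl

lemma tsum_jumpProb {lam : ℝ} {u : ℝ → ℝ → ℝ} {ω : Env} {i : ℤ}
    (h : Summable (rate lam u ω i)) : ∑' j, ENNReal.ofReal (jumpProb lam u ω i j) = 1 := by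
  have hpos : 0 < totalRate lam u ω i := by
    refine h.tsum_pos (rate_nonneg lam u ω i) (i + 1) ?_
    simp only [rate, left_eq_add, one_ne_zero, if_false]
    positivity
  simp only [jumpProb]
  rw [← ENNReal.ofReal_tsum_of_nonneg
    (fun j => div_nonneg (rate_nonneg lam u ω i j) hpos.le) (h.div_const _), tsum_div_const]
  rw [← totalRate, div_self hpos.ne', ENNReal.ofReal_one]

@[fun_prop]
lemma measurable_pos (k : ℤ) : Measurable (fun ω : Env => pos ω k) := by
  unfold pos gap; fun_prop

@[fun_prop]
lemma measurable_shift (k : ℤ) : Measurable (shift k) := by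
  unfold shift; fun_prop

lemma measurable_rate (lam : ℝ) {u : ℝ → ℝ → ℝ} (hu : Measurable (Function.uncurry u))
    (i j : ℤ) : Measurable (fun ω : Env => rate lam u ω i j) := by
  unfold rate
  split_ifs
  · fun_prop
  · have h : Measurable (fun ω : Env => u (mark ω i) (mark ω j)) :=
      hu.comp (f := fun ω : Env => (mark ω i, mark ω j)) (by unfold mark; fun_prop)
    exact Measurable.exp (Measurable.sub (by fun_prop) h)

lemma measurable_totalRate (lam : ℝ) {u : ℝ → ℝ → ℝ} (hu : Measurable (Function.uncurry u))
    (i : ℤ) : Measurable (fun ω : Env => totalRate lam u ω i) := by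
  have h : (fun ω : Env => totalRate lam u ω i) =
      fun ω => (∑' k, ENNReal.ofReal (rate lam u ω i k)).toReal := by
    funext ω
    rw [ENNReal.tsum_toReal_eq (fun _ => ENNReal.ofReal_ne_top)]
    exact tsum_congr fun k => (ENNReal.toReal_ofReal (rate_nonneg lam u ω i k)).symm
  rw [h]
  exact (Measurable.tsum fun k => (measurable_rate lam hu i k).ennreal_ofReal).ennreal_toReal

lemma measurableSet_summable (lam : ℝ) {u : ℝ → ℝ → ℝ} (hu : Measurable (Function.uncurry u))
    (i : ℤ) : MeasurableSet {ω : Env | Summable (rate lam u ω i)} := by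
  have h : {ω : Env | Summable (rate lam u ω i)} =
      {ω | ∑' k, ENNReal.ofReal (rate lam u ω i k) ≠ ⊤} := by
    ext ω
    refine ⟨fun hs => hs.tsum_ofReal_ne_top, fun hs => ?_⟩
    refine (ENNReal.summable_toReal hs).congr fun k => ?_
    exact ENNReal.toReal_ofReal (rate_nonneg lam u ω i k)
  rw [h]
  exact (Measurable.tsum fun k => (measurable_rate lam hu i k).ennreal_ofReal)
    (measurableSet_singleton _).compl

open Classical in
/-- The law of the label of the site reached from `x_i` in one jump.  For environments in which
the rates out of `x_i` are not summable (which do not occur when the interpoint distances are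
bounded below by a positive constant and `|λ| < 1`) the walker stays put, by convention. -/
noncomputable def stepLaw (lam : ℝ) (u : ℝ → ℝ → ℝ) (ω : Env) (i : ℤ) : Measure ℤ :=
  if Summable (rate lam u ω i) then
    Measure.sum fun j => ENNReal.ofReal (jumpProb lam u ω i j) • Measure.dirac j
  else Measure.dirac i

lemma isProbabilityMeasure_stepLaw (lam : ℝ) (u : ℝ → ℝ → ℝ) (ω : Env) (i : ℤ) :
    IsProbabilityMeasure (stepLaw lam u ω i) := by
  unfold stepLaw
  split_ifs with h
  · exact ⟨by simp [Measure.sum_apply, tsum_jumpProb h]⟩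
  · infer_instance

/-- The transition kernel, on labels of sites, of the walk `Y^{ω,λ}` in the fixed
environment `ω`. -/
noncomputable def walkKernel (lam : ℝ) (u : ℝ → ℝ → ℝ) (ω : Env) : Kernel ℤ ℤ where
  toFun := stepLaw lam u ω
  measurable' := measurable_from_top

instance (lam : ℝ) (u : ℝ → ℝ → ℝ) (ω : Env) : IsMarkovKernel (walkKernel lam u ω) :=
  ⟨fun i => isProbabilityMeasure_stepLaw lam u ω i⟩

/-- The transition kernel of the environment viewed from the walker `Y^{ω,λ}`: from `ω` the chain
jumps to `τ_{x_k} ω`, where `k` is the label of the site reached from the origin in one jump, so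
to `τ_{x_k} ω` with probability `p^λ_{0, x_k}(ω)`. -/
noncomputable def envKernel (lam : ℝ) (u : ℝ → ℝ → ℝ) (hu : Continuous (Function.uncurry u)) :
    Kernel Env Env where
  toFun ω := (stepLaw lam u ω 0).map fun k => shift k ω
  measurable' := by
    classical
    refine Measure.measurable_of_measurable_coe _ fun s hs => ?_
    have h : ∀ ω : Env, ((stepLaw lam u ω 0).map fun k => shift k ω) s =
        if Summable (rate lam u ω 0) then
          ∑' k, ENNReal.ofReal (jumpProb lam u ω 0 k) * (shift k ⁻¹' s).indicator 1 ω
        else (shift 0 ⁻¹' s).indicator 1 ω := by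
      intro ω
      rw [Measure.map_apply measurable_from_top hs]
      unfold stepLaw
      split_ifs
      · rw [Measure.sum_apply _ (MeasurableSet.of_discrete)]
        simp [Set.indicator_apply]
      · simp [Set.indicator_apply]
    simp only [h]
    refine Measurable.ite (measurableSet_summable lam hu.measurable 0) ?_ ?_
    · refine Measurable.tsum fun k => Measurable.mul ?_ ?_
      · exact ((measurable_rate lam hu.measurable 0 k).div
          (measurable_totalRate lam hu.measurable 0)).ennreal_ofReal
      · exact measurable_one.indicator (measurable_shift k hs)
    · exact measurable_one.indicator (measurable_shift 0 hs)

instance (lam : ℝ) (u : ℝ → ℝ → ℝ) (hu : Continuous (Function.uncurry u)) :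
    IsMarkovKernel (envKernel lam u hu) :=
  ⟨fun ω => by
    have := isProbabilityMeasure_stepLaw lam u ω 0
    exact Measure.isProbabilityMeasure_map measurable_from_top.aemeasurable⟩

/-- The law on path space of the time-homogeneous Markov chain with initial law `μ` and transition
kernel `κ`. -/
noncomputable def chainLaw {S : Type*} [MeasurableSpace S] (μ : Measure S) (κ : Kernel S S)
    [IsMarkovKernel κ] : Measure (ℕ → S) :=
  Kernel.trajMeasure (X := fun _ => S) μ fun n =>
    κ.comap (fun h : (i : Finset.Iic n) → S => h ⟨n, Finset.mem_Iic.2 le_rfl⟩)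
      (measurable_pi_apply _)

/-- The time shift on path space. -/
def timeShift {S : Type*} (w : ℕ → S) : ℕ → S := fun n => w (n + 1)

/-- `Q` is an invariant and ergodic distribution of the Markov kernel `κ`: it is a probability
measure with `Q κ = Q`, and the stationary chain started from `Q` is ergodic under the time
shift. -/
def IsInvariantErgodic {S : Type*} [MeasurableSpace S] (κ : Kernel S S) [IsMarkovKernel κ]
    (Q : Measure S) : Prop :=
  IsProbabilityMeasure Q ∧ Kernel.Invariant κ Q ∧ Ergodic timeShift (chainLaw Q κ)

/-- The quenched law of the sequence of labels of the sites visited by the walk `Y^{ω,λ}` started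
at the origin: the walk is `Y_n = x_{y n}` with `y` distributed as `walkLaw lam u ω`. -/
noncomputable def walkLaw (lam : ℝ) (u : ℝ → ℝ → ℝ) (ω : Env) : Measure (ℕ → ℤ) :=
  chainLaw (Measure.dirac 0) (walkKernel lam u ω)

/-- The quenched law of the labels of the visited sites together with independent i.i.d. mean-one
exponential variables, from which the continuous-time walk is built. -/
noncomputable def ctLaw (lam : ℝ) (u : ℝ → ℝ → ℝ) (ω : Env) : Measure ((ℕ → ℤ) × (ℕ → ℝ)) :=
  (walkLaw lam u ω).prod (Measure.infinitePi fun _ : ℕ => expMeasure 1)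

/-- The time of the `n`-th jump of `X^{ω,λ}`: the holding time at the `k`-th visited site
`x_{y k}` is exponential with parameter the total rate out of `x_{y k}`. -/
noncomputable def jumpTime (lam : ℝ) (u : ℝ → ℝ → ℝ) (ω : Env) (w : (ℕ → ℤ) × (ℕ → ℝ)) (n : ℕ) :
    ℝ :=
  ∑ k ∈ Finset.range n, w.2 k / totalRate lam u ω (w.1 k)

/-- The number of jumps of `X^{ω,λ}` up to time `t`. -/
noncomputable def jumpCount (lam : ℝ) (u : ℝ → ℝ → ℝ) (ω : Env) (w : (ℕ → ℤ) × (ℕ → ℝ)) (t : ℝ) :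
    ℕ :=
  sSup {n : ℕ | jumpTime lam u ω w n ≤ t}

/-- The position `X_t^{ω,λ}` of the continuous-time walk, as a function on the probability space
with measure `ctLaw lam u ω`. -/
noncomputable def ctWalk (lam : ℝ) (u : ℝ → ℝ → ℝ) (ω : Env) (w : (ℕ → ℤ) × (ℕ → ℝ)) (t : ℝ) :
    ℝ :=
  pos ω (w.1 (jumpCount lam u ω w t))

/-- `v = v_Y(λ)`: for `P`-almost every environment, `Y_n / n → v` almost surely. -/
def IsVelocityY (P : Measure Env) (lam : ℝ) (u : ℝ → ℝ → ℝ) (v : ℝ) : Prop :=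
  ∀ᵐ ω ∂P, ∀ᵐ y ∂(walkLaw lam u ω), Tendsto (fun n : ℕ => pos ω (y n) / n) atTop (𝓝 v)

/-- `v = v_X(λ)`: for `P`-almost every environment, `X_t / t → v` almost surely. -/
def IsVelocityX (P : Measure Env) (lam : ℝ) (u : ℝ → ℝ → ℝ) (v : ℝ) : Prop :=
  ∀ᵐ ω ∂P, ∀ᵐ w ∂(ctLaw lam u ω),
    Tendsto (fun t : ℝ => ctWalk lam u ω w t / t) atTop (𝓝 v)

end Mott

/-! The position after `n` jumps is a sum of displacements, and since the environment is almost
surely aperiodic, each displacement is a function of two successive environments seen from the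
walker (`jumpSize_shift`). Once the environment chain has an invariant law `Q` that is equivalent to
`P` and ergodic, Birkhoff's theorem gives the velocity of the discrete walk, and the same theorem
for the holding times, with `tendsto_clock_inversion`, gives that of the continuous-time walk. The
work lies in building `Q` and controlling its density.

In a fixed environment the walk is reversible with weights `w i = e^{2λ x_i} ∑_k r_{x_i,x_k}`. Let
`G` be its Green function. Comparison with the nearest neighbour path to the right gives `G(0,0) ≤ 2
w 0 R` (`green_diag_le`), where the `k`-th edge of the path has resistance at most `e^{C - 2λdk}
e^{(1-λ) Z_k}`. By stationarity and the exponential moment, `R` has finite expectation. The maximum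
principle extends the bound to `G(i,0)`, uniformly in `i`. Conversely, a walk started at `i < 0`
spends a finite time on the negative half-line, because `w` decays geometrically there, and whenever
it leaves, it hits `0` with a probability bounded below; so `G(i,0)` is bounded below by a constant
(`one_le_mul_green_zero`).

By translation, `G(-n,0)` is the `P`-density of the environment seen at the visits to site `n` by
the walk started at `0`. Averages over `1 ≤ n ≤ N + 1` are invariant up to boundary terms of order
`1/N`, since the jumps have exponential tails. A setwise limit is subinvariant, hence invariant
because a Markov kernel preserves mass. The two bounds on `G` make it equivalent to `P`, with
density at most a constant times the total rate times the resistance (`exists_invariant`). The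
factor given by the total rate cancels the denominators in the drift and in the mean holding time,
which are therefore `Q`-integrable.

Ergodicity comes from that of `P`: the jump to the right neighbour has positive probability, so a
function preserved by one step is invariant under `shift 1`, hence constant.
`ergodic_timeShift_chainLaw` transfers this to path space, and independent exponential clocks do no
harm (`ae_const_of_parallelComp_const`). -/

namespace Mott

/-! ### The pointwise ergodic theorem -/

section Birkhoff

variable {α : Type*}

/-- The running maximum `max (0, S_1, …, S_n)` of the ergodic sums of `g`. -/
noncomputable def maxSum (T : α → α) (g : α → ℝ) : ℕ → α → ℝ
  | 0 => fun _ => 0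
  | n + 1 => fun x => max 0 (g x + maxSum T g n (T x))

lemma maxSum_nonneg (T : α → α) (g : α → ℝ) (n : ℕ) (x : α) : 0 ≤ maxSum T g n x := by
  cases n <;> simp [maxSum]

lemma maxSum_le_succ (T : α → α) (g : α → ℝ) (n : ℕ) (x : α) :
    maxSum T g n x ≤ maxSum T g (n + 1) x := by
  induction n generalizing x with
  | zero => simp [maxSum]
  | succ n ih =>
    rw [maxSum, maxSum]
    exact max_le_max le_rfl (by linarith [ih (T x)])

lemma maxSum_mono (T : α → α) (g : α → ℝ) (x : α) : Monotone fun n => maxSum T g n x :=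
  monotone_nat_of_le_succ fun n => maxSum_le_succ T g n x

lemma sum_le_maxSum (T : α → α) (g : α → ℝ) (n : ℕ) (x : α) :
    ∑ k ∈ Finset.range n, g (T^[k] x) ≤ maxSum T g n x := by
  induction n generalizing x with
  | zero => simp [maxSum]
  | succ n ih =>
    rw [Finset.sum_range_succ', maxSum]
    refine le_max_of_le_right ?_
    have := ih (T x)
    simp only [Function.iterate_succ, Function.comp, Function.iterate_zero, id] at this ⊢
    linarith

/-- This difference lies between `-|g x|` and `|g x|`, and equals `g x` as soon as the maximum at `T
x` exceeds `-g x`. Both facts drive the maximal argument below. -/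
lemma maxSum_succ_sub (T : α → α) (g : α → ℝ) (n : ℕ) (x : α) :
    maxSum T g (n + 1) x - maxSum T g n (T x) = max (-maxSum T g n (T x)) (g x) := by
  rw [maxSum, ← max_sub_sub_right]; simp

lemma bddAbove_maxSum_iff (T : α → α) (g : α → ℝ) (x : α) :
    BddAbove (Set.range fun n => maxSum T g n (T x)) ↔
      BddAbove (Set.range fun n => maxSum T g n x) := by
  constructor
  · rintro ⟨b, hb⟩
    refine ⟨max 0 (g x + b), ?_⟩
    rintro _ ⟨n, rfl⟩
    refine (maxSum_le_succ T g n x).trans ?_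
    exact max_le_max le_rfl (by linarith [hb ⟨n, rfl⟩])
  · rintro ⟨b, hb⟩
    refine ⟨b - g x, ?_⟩
    rintro _ ⟨n, rfl⟩
    have h1 := hb ⟨n + 1, rfl⟩
    have h2 : g x + maxSum T g n (T x) ≤ maxSum T g (n + 1) x := le_max_right _ _
    simp only at h1 ⊢
    linarith

variable [MeasurableSpace α]

lemma measurable_maxSum {T : α → α} {g : α → ℝ} (hT : Measurable T) (hg : Measurable g) (n : ℕ) :
    Measurable (maxSum T g n) := by
  induction n with
  | zero => exact measurable_const
  | succ n ih => exact measurable_const.max (hg.add (ih.comp hT))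

variable {μ : Measure α}

lemma integrable_maxSum {T : α → α} {g : α → ℝ} (hT : MeasurePreserving T μ μ)
    (hg : Integrable g μ) (n : ℕ) : Integrable (maxSum T g n) μ := by
  induction n with
  | zero => exact integrable_zero _ _ _
  | succ n ih =>
    exact (integrable_zero _ _ _).sup (hg.add ((hT.integrable_comp ih.1).2 ih))

/-- Garsia's argument. Boundedness is a `T`-invariant event, so it suffices to exclude that the
maxima diverge almost everywhere. In that case the differences `maxSum (n + 1) x - maxSum n (T x)`
converge to `g`, dominated by `|g|`; their integrals are nonnegative since `T` preserves `μ` and the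
maxima increase, which contradicts the negative mean of `g`. -/
lemma ae_bddAbove_maxSum [IsProbabilityMeasure μ] {T : α → α} (hT : Ergodic T μ) {g : α → ℝ}
    (hgm : Measurable g) (hg : Integrable g μ) (hneg : ∫ x, g x ∂μ < 0) :
    ∀ᵐ x ∂μ, BddAbove (Set.range fun n => maxSum T g n x) := by
  set A : Set α := {x | BddAbove (Set.range fun n => maxSum T g n x)} with hA
  have hAm : MeasurableSet A :=
    measurableSet_bddAbove_range fun n => measurable_maxSum hT.measurable hgm n
  have hinv : T ⁻¹' A = A := by
    ext x; exact bddAbove_maxSum_iff T g x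
  rcases hT.toPreErgodic.ae_empty_or_univ hAm hinv with h | h
  swap
  · exact eventuallyEq_univ.1 h
  exfalso
  have hun : ∀ᵐ x ∂μ, Tendsto (fun n => maxSum T g n (T x)) atTop atTop := by
    filter_upwards [eventuallyEq_empty.1 h] with x hx
    refine tendsto_atTop_atTop_of_monotone (maxSum_mono T g (T x)) fun b => ?_
    by_contra hcon
    push Not at hcon
    refine hx ((bddAbove_maxSum_iff T g x).1 ⟨b, ?_⟩)
    rintro _ ⟨n, rfl⟩
    exact (hcon n).le
  have hlim : Tendsto (fun n => ∫ x, (maxSum T g (n + 1) x - maxSum T g n (T x)) ∂μ) atTop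
      (𝓝 (∫ x, g x ∂μ)) := by
    refine tendsto_integral_of_dominated_convergence (fun x => |g x|) (fun n => ?_) hg.abs
      (fun n => ?_) ?_
    · exact ((measurable_maxSum hT.measurable hgm _).sub
        ((measurable_maxSum hT.measurable hgm _).comp hT.measurable)).aestronglyMeasurable
    · refine Eventually.of_forall fun x => ?_
      rw [maxSum_succ_sub, Real.norm_eq_abs, abs_le]
      exact ⟨(neg_abs_le _).trans (le_max_right _ _),
        max_le (by linarith [maxSum_nonneg T g n (T x), abs_nonneg (g x)]) (le_abs_self _)⟩
    · filter_upwards [hun] with x hx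
      refine tendsto_const_nhds.congr' ?_
      filter_upwards [hx.eventually_ge_atTop (-g x)] with n hn
      rw [maxSum_succ_sub, max_eq_right (by linarith)]
  have hnn : ∀ n, 0 ≤ ∫ x, (maxSum T g (n + 1) x - maxSum T g n (T x)) ∂μ := by
    intro n
    have hi := integrable_maxSum hT.toMeasurePreserving hg n
    have hi' := integrable_maxSum hT.toMeasurePreserving hg (n + 1)
    have hc : ∫ x, maxSum T g n (T x) ∂μ = ∫ x, maxSum T g n x ∂μ := by
      rw [← integral_map hT.measurable.aemeasurable (by rw [hT.map_eq]; exact hi.1), hT.map_eq]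
    have hi'' : Integrable (fun x => maxSum T g n (T x)) μ :=
      (hT.toMeasurePreserving.integrable_comp hi.1).2 hi
    rw [integral_sub hi' hi'', hc, sub_nonneg]
    exact integral_mono hi hi' fun x => maxSum_le_succ T g n x
  exact absurd (ge_of_tendsto' hlim hnn) (not_le.2 hneg)

lemma ae_eventually_average_lt [IsProbabilityMeasure μ] {T : α → α} (hT : Ergodic T μ) {f : α → ℝ}
    (hfm : Measurable f) (hf : Integrable f μ) :
    ∀ᵐ x ∂μ, ∀ a, ∫ x, f x ∂μ < a →
      ∀ᶠ n : ℕ in atTop, (∑ k ∈ Finset.range n, f (T^[k] x)) / n < a := by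
  -- Countably many thresholds above the mean keep the exceptional set null. Subtracting such a
  -- threshold makes the mean negative, so the recentred sums are bounded above and vanish after
  -- division by `n`.
  have key : ∀ j : ℕ, ∀ᵐ x ∂μ, BddAbove (Set.range fun n =>
      maxSum T (fun x => f x - (∫ x, f x ∂μ + 1 / ((j : ℝ) + 1))) n x) := by
    intro j
    refine ae_bddAbove_maxSum hT (hfm.sub measurable_const) (hf.sub (integrable_const _)) ?_
    rw [integral_sub hf (integrable_const _)]
    simp only [integral_const, probReal_univ, one_smul]
    have : (0 : ℝ) < 1 / ((j : ℝ) + 1) := by positivity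
    linarith
  filter_upwards [ae_all_iff.2 key] with x hx a ha
  obtain ⟨j, hj⟩ := exists_nat_one_div_lt (sub_pos.2 ha)
  obtain ⟨b, hb⟩ := hx j
  set c := ∫ x, f x ∂μ + 1 / ((j : ℝ) + 1)
  have hca : 0 < a - c := by simp only [c]; linarith
  have hlim : Tendsto (fun n : ℕ => b / n) atTop (𝓝 0) := tendsto_const_div_atTop_nhds_zero_nat b
  filter_upwards [hlim.eventually_lt_const hca, eventually_gt_atTop 0] with n hn hn0
  have h1 := (sum_le_maxSum T (fun x => f x - c) n x).trans (hb ⟨n, rfl⟩)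
  rw [Finset.sum_sub_distrib, Finset.sum_const, Finset.card_range, nsmul_eq_mul] at h1
  have hn0' : (0 : ℝ) < n := by exact_mod_cast hn0
  rw [div_lt_iff₀ hn0'] at hn ⊢
  nlinarith

/-- Birkhoff's pointwise ergodic theorem for ergodic transformations. -/
theorem ae_tendsto_average [IsProbabilityMeasure μ] {T : α → α} (hT : Ergodic T μ) {f : α → ℝ}
    (hfm : Measurable f) (hf : Integrable f μ) :
    ∀ᵐ x ∂μ, Tendsto (fun n : ℕ => (∑ k ∈ Finset.range n, f (T^[k] x)) / n) atTop
      (𝓝 (∫ x, f x ∂μ)) := by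
  filter_upwards [ae_eventually_average_lt hT hfm hf,
    ae_eventually_average_lt hT hfm.neg hf.neg] with x h1 h2
  refine tendsto_order.2 ⟨fun a ha => ?_, h1⟩
  have := h2 (-a) (by simp only [Pi.neg_apply, integral_neg]; linarith)
  filter_upwards [this] with n hn
  simp only [Pi.neg_apply, Finset.sum_neg_distrib, neg_div] at hn
  linarith

end Birkhoff

end Mott

namespace Mott

/-! ### Markov chains on path space -/

section Chain

open scoped ENNReal

variable {S : Type*} [MeasurableSpace S]

/-- The coordinate process under `ρ` is a Markov chain with initial law `μ` and kernel `κ`. -/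
structure IsChain (ρ : Measure (ℕ → S)) (μ : Measure S) (κ : Kernel S S) : Prop where
  initial : ρ.map (fun x => x 0) = μ
  step : ∀ (n : ℕ) (f : ℕ → S → ℝ≥0∞), (∀ i, Measurable (f i)) →
    ∫⁻ x, ∏ i ∈ Finset.range (n + 2), f i (x i) ∂ρ =
      ∫⁻ x, (∏ i ∈ Finset.range (n + 1), f i (x i)) * ∫⁻ y, f (n + 1) y ∂κ (x n) ∂ρ

lemma measurable_prod_eval {n : ℕ} {f : ℕ → S → ℝ≥0∞} (hf : ∀ i, Measurable (f i)) :
    Measurable fun x : ℕ → S => ∏ i ∈ Finset.range n, f i (x i) :=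
  Finset.measurable_fun_prod _ fun i _ => (hf i).comp (measurable_pi_apply i)

/-- Finite measures on path space with the same finite-dimensional integrals agree. -/
lemma ext_of_lintegral_prod {ρ ρ' : Measure (ℕ → S)} [IsFiniteMeasure ρ]
    (h : ∀ (n : ℕ) (f : ℕ → S → ℝ≥0∞), (∀ i, Measurable (f i)) →
      (∀ i s, f i s ≤ 1) → ∫⁻ x, ∏ i ∈ Finset.range (n + 1), f i (x i) ∂ρ =
        ∫⁻ x, ∏ i ∈ Finset.range (n + 1), f i (x i) ∂ρ') : ρ = ρ' := by
  classical
  refine ext_of_generate_finite _ (generateFrom_squareCylinders (α := fun _ : ℕ => S)).symm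
    (isPiSystem_squareCylinders (fun _ => MeasurableSpace.isPiSystem_measurableSet)
      fun _ => MeasurableSet.univ) ?_ ?_
  · rintro _ ⟨s, t, ht, rfl⟩
    simp only [Set.mem_pi, Set.mem_univ, forall_true_left] at ht
    -- The indicator of a cylinder, written as a product over an initial segment with trivial
    -- factors off `s`.
    have hind : ∀ x : ℕ → S, (∏ i ∈ Finset.range (s.sup id + 1),
        (if i ∈ s then (t i).indicator (1 : S → ℝ≥0∞) else 1) (x i)) =
        ((s : Set ℕ).pi t).indicator 1 x := by
      intro x
      by_cases hx : x ∈ (s : Set ℕ).pi t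
      · rw [Set.indicator_of_mem hx]
        refine Finset.prod_eq_one fun i _ => ?_
        split_ifs with hi
        · rw [Set.indicator_of_mem (hx i hi)]; rfl
        · rfl
      · rw [Set.indicator_of_notMem hx]
        simp only [Set.mem_pi, not_forall] at hx
        obtain ⟨i, hi, hxi⟩ := hx
        refine Finset.prod_eq_zero (i := i) ?_ ?_
        · exact Finset.mem_range.2 (Nat.lt_succ_of_le (Finset.le_sup (f := id) hi))
        · rw [if_pos (by simpa using hi), Set.indicator_of_notMem hxi]
    have hm : MeasurableSet ((s : Set ℕ).pi t) :=
      MeasurableSet.pi s.countable_toSet fun i _ => ht i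
    have := h (s.sup id) (fun i => if i ∈ s then (t i).indicator (1 : S → ℝ≥0∞) else 1)
      (fun i => by split_ifs; exacts [measurable_one.indicator (ht i), measurable_one])
      (fun i s => by split_ifs; exacts [Set.indicator_le_self' (by simp) s, le_rfl])
    simpa only [hind, lintegral_indicator_one hm] using this
  · simpa using h 0 (fun _ => 1) (fun _ => measurable_one) fun _ _ => le_rfl

/-- Integrating the last factor against `κ` and absorbing it into the preceding one shortens the
product by one. -/
lemma IsChain.ext {ρ ρ' : Measure (ℕ → S)} [IsFiniteMeasure ρ] {μ : Measure S} {κ : Kernel S S}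
    (h : IsChain ρ μ κ) (h' : IsChain ρ' μ κ) : ρ = ρ' := by
  classical
  refine ext_of_lintegral_prod fun n f hf hf1 => ?_
  -- The absorbed factor may exceed `1`, as `κ` need not be Markov here, so the bound cannot be
  -- carried through the induction.
  clear hf1
  induction n generalizing f with
  | zero =>
    simp only [zero_add, Finset.range_one, Finset.prod_singleton]
    have e : ∀ σ : Measure (ℕ → S), ∫⁻ x, f 0 (x 0) ∂σ = ∫⁻ s, f 0 s ∂σ.map (fun x => x 0) :=
      fun σ => (lintegral_map (hf 0) (measurable_pi_apply 0)).symm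
    rw [e, e, h.initial, h'.initial]
  | succ n ih =>
    rw [h.step n f hf, h'.step n f hf]
    have := ih (Function.update f n (fun s => f n s * ∫⁻ y, f (n + 1) y ∂κ s)) (fun i => by
      rcases eq_or_ne i n with rfl | hi
      · rw [Function.update_self]; exact (hf i).mul (hf (i + 1)).lintegral_kernel
      · rw [Function.update_of_ne hi]; exact hf i)
    simp only [Finset.prod_range_succ, Function.update_self] at this ⊢
    have hne : ∀ x : ℕ → S, ∏ i ∈ Finset.range n,
        Function.update f n (fun s => f n s * ∫⁻ y, f (n + 1) y ∂κ s) i (x i) =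
        ∏ i ∈ Finset.range n, f i (x i) := fun x =>
      Finset.prod_congr rfl fun i hi => by
        rw [Function.update_of_ne (Finset.mem_range.1 hi).ne]
    simpa only [hne, mul_assoc] using this

/-- The law of the Markov chain with kernel `κ`, as a kernel of the starting point. -/
noncomputable def pathKernel (κ : Kernel S S) [IsMarkovKernel κ] : Kernel S (ℕ → S) :=
  (Kernel.traj (X := fun _ => S) (fun n =>
    κ.comap (fun h : (i : Finset.Iic n) → S => h ⟨n, Finset.mem_Iic.2 le_rfl⟩)
      (measurable_pi_apply _)) 0).comap (fun x _ => x) (by fun_prop)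

variable (κ : Kernel S S) [IsMarkovKernel κ]

instance : IsMarkovKernel (pathKernel κ) := by unfold pathKernel; infer_instance

lemma chainLaw_eq_bind (μ : Measure S) : chainLaw μ κ = μ.bind (pathKernel κ) := by
  unfold chainLaw Kernel.trajMeasure pathKernel
  ext A hA
  rw [Measure.bind_apply hA (Kernel.aemeasurable _), Measure.bind_apply hA (Kernel.aemeasurable _),
    lintegral_map (Kernel.measurable_coe _ hA) (by fun_prop)]
  rfl

lemma pathKernel_apply (x : S) : pathKernel κ x = chainLaw (Measure.dirac x) κ := by
  rw [chainLaw_eq_bind, Measure.dirac_bind (Kernel.measurable _)]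

instance (μ : Measure S) [IsProbabilityMeasure μ] : IsProbabilityMeasure (chainLaw μ κ) := by
  unfold chainLaw; infer_instance

instance (μ : Measure S) [IsFiniteMeasure μ] : IsFiniteMeasure (chainLaw μ κ) := by
  rw [chainLaw_eq_bind]; infer_instance

lemma lintegral_chainLaw (μ : Measure S) {f : (ℕ → S) → ℝ≥0∞} (hf : Measurable f) :
    ∫⁻ w, f w ∂chainLaw μ κ = ∫⁻ x, ∫⁻ w, f w ∂chainLaw (Measure.dirac x) κ ∂μ := by
  rw [chainLaw_eq_bind, Measure.lintegral_bind (Kernel.aemeasurable _) hf.aemeasurable]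
  simp only [pathKernel_apply]

lemma isChain_chainLaw_of_isProbabilityMeasure (μ : Measure S) [IsProbabilityMeasure μ] :
    IsChain (chainLaw μ κ) μ κ where
  initial := by
    unfold chainLaw Kernel.trajMeasure
    have h0 : (fun x : ℕ → S => x 0) = (fun h : (Finset.Iic 0 → S) => h ⟨0, by simp⟩) ∘
      Preorder.frestrictLe (π := fun _ => S) 0 := rfl
    rw [h0, ← Measure.map_map (by fun_prop) (by fun_prop), Measure.map_comp _ _ (by fun_prop),
      Kernel.traj_map_frestrictLe, Kernel.partialTraj_self, Measure.id_comp,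
      Measure.map_map (by fun_prop) (by fun_prop)]
    exact Measure.map_id
  step := by
    intro n f hf
    have hJ := Kernel.map_frestrictLe_trajMeasure_compProd_eq_map_trajMeasure
      (X := fun _ => S) (μ₀ := μ) (κ := fun n =>
        κ.comap (fun h : (i : Finset.Iic n) → S => h ⟨n, Finset.mem_Iic.2 le_rfl⟩)
        (measurable_pi_apply _)) (a := n)
    change Measure.compProd ((chainLaw μ κ).map _) _ = (chainLaw μ κ).map _ at hJ
    have hprod : ∀ x : ℕ → S, ∏ i ∈ Finset.range (n + 1), f i (x i) =
        ∏ i : Finset.Iic n, f i (Preorder.frestrictLe (π := fun _ => S) n x i) := by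
      intro x
      rw [Nat.range_succ_eq_Iic,
        ← Finset.prod_coe_sort (Finset.Iic n) (fun i => f i (x i))]
      rfl
    have hm1 : Measurable fun h : Finset.Iic n → S => ∏ i : Finset.Iic n, f i (h i) :=
      Finset.measurable_fun_prod _ fun i _ => (hf i).comp (measurable_pi_apply i)
    have hm : Measurable fun z : (Finset.Iic n → S) × S =>
        (∏ i : Finset.Iic n, f i (z.1 i)) * f (n + 1) z.2 :=
      (hm1.comp measurable_fst).mul ((hf (n + 1)).comp measurable_snd)
    have h1 := congrArg (fun m => ∫⁻ z, (∏ i : Finset.Iic n, f i (z.1 i)) * f (n + 1) z.2 ∂m) hJ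
    rw [Measure.lintegral_compProd hm, lintegral_map hm (by fun_prop), lintegral_map _ (by fun_prop)]
      at h1
    · simp only [Finset.prod_range_succ _ (n + 1), hprod]
      refine h1.symm.trans (lintegral_congr fun x => ?_)
      rw [Kernel.comap_apply]
      exact lintegral_const_mul (μ := κ (x n)) (∏ i : Finset.Iic n, f i (x i)) (hf (n + 1))
    · exact hm.lintegral_kernel_prod_right'

/-- Mixing over the starting point removes any restriction on the initial mass. This is needed for
the Markov property, where the initial laws are reweighted. -/
lemma isChain_chainLaw (μ : Measure S) : IsChain (chainLaw μ κ) μ κ where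
  initial := by
    ext A hA
    rw [Measure.map_apply (measurable_pi_apply 0) hA, chainLaw_eq_bind,
      Measure.bind_apply (measurable_pi_apply 0 hA) (Kernel.aemeasurable _)]
    simp only [pathKernel_apply]
    have h : ∀ x, chainLaw (Measure.dirac x) κ ((fun w : ℕ → S => w 0) ⁻¹' A) =
        A.indicator 1 x := fun x => by
      rw [← Measure.map_apply (measurable_pi_apply 0) hA,
        (isChain_chainLaw_of_isProbabilityMeasure κ (Measure.dirac x)).initial,
        Measure.dirac_apply' _ hA]
    simp only [h, lintegral_indicator_one hA]
  step := by
    intro n f hf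
    rw [lintegral_chainLaw κ μ (measurable_prod_eval hf), lintegral_chainLaw]
    · exact lintegral_congr fun x =>
        (isChain_chainLaw_of_isProbabilityMeasure κ (Measure.dirac x)).step n f hf
    · exact (measurable_prod_eval hf).mul
        ((hf (n + 1)).lintegral_kernel.comp (measurable_pi_apply n))

variable {κ}

lemma IsChain.eq_chainLaw {ρ : Measure (ℕ → S)} [IsFiniteMeasure ρ] {μ : Measure S}
    (h : IsChain ρ μ κ) : ρ = chainLaw μ κ := h.ext (isChain_chainLaw κ μ)

/-- Images of Markov chains under maps intertwining the kernels. -/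
lemma IsChain.map {T : Type*} [MeasurableSpace T] {η : Kernel T T} {ρ : Measure (ℕ → S)}
    {μ : Measure S} {κ : Kernel S S} (h : IsChain ρ μ κ) {φ : S → T} (hφ : Measurable φ)
    (hη : ∀ x, η (φ x) = (κ x).map φ) :
    IsChain (ρ.map fun w n => φ (w n)) (μ.map φ) η := by
  have hm : Measurable fun (w : ℕ → S) n => φ (w n) := by fun_prop
  refine ⟨?_, fun n f hf => ?_⟩
  · rw [Measure.map_map (measurable_pi_apply 0) hm, ← h.initial,
      Measure.map_map hφ (measurable_pi_apply 0)]
    rfl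
  · rw [lintegral_map (measurable_prod_eval hf) hm, lintegral_map _ hm]
    · rw [h.step n (fun i x => f i (φ x)) fun i => (hf i).comp hφ]
      simp only [hη, lintegral_map (hf (n + 1)) hφ]
    · exact (measurable_prod_eval hf).mul
        ((hf (n + 1)).lintegral_kernel.comp (measurable_pi_apply n))

/-- Two independent Markov chains form a Markov chain. -/
lemma IsChain.prod {T : Type*} [MeasurableSpace T] {η : Kernel T T} [IsMarkovKernel η]
    {ρ : Measure (ℕ → S)} {σ : Measure (ℕ → T)} [IsFiniteMeasure ρ] [IsFiniteMeasure σ]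
    {μ : Measure S} {ν : Measure T} (h : IsChain ρ μ κ) (h' : IsChain σ ν η) :
    IsChain ((ρ.prod σ).map fun z n => (z.1 n, z.2 n)) (μ.prod ν) (κ.parallelComp η) := by
  have hm : Measurable fun (z : (ℕ → S) × (ℕ → T)) (n : ℕ) => (z.1 n, z.2 n) := by fun_prop
  refine ⟨?_, fun n f hf => ?_⟩
  · rw [Measure.map_map (measurable_pi_apply 0) hm, ← h.initial, ← h'.initial,
      Measure.map_prod_map _ _ (measurable_pi_apply 0) (measurable_pi_apply 0)]
    rfl
  · have hk : Measurable fun z : (S × T) => ∫⁻ y, f (n + 1) y ∂(κ.parallelComp η) z :=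
      (hf (n + 1)).lintegral_kernel
    have hm1 : ∀ N, Measurable fun z : (ℕ → S) × (ℕ → T) =>
        ∏ i ∈ Finset.range N, f i (z.1 i, z.2 i) := fun N =>
      (measurable_prod_eval hf).comp hm
    have hκ : Measurable fun p : S × T => ∫⁻ s, f (n + 1) (s, p.2) ∂κ p.1 := by
      have : Measurable fun q : (S × T) × S => f (n + 1) (q.2, q.1.2) :=
        (hf (n + 1)).comp (by fun_prop)
      exact (this.lintegral_kernel_prod_right' (κ := κ.comap Prod.fst measurable_fst))
    have hR : Measurable fun x : ℕ → S × T => (∏ i ∈ Finset.range (n + 1), f i (x i)) *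
        ∫⁻ y, f (n + 1) y ∂(κ.parallelComp η) (x n) :=
      (measurable_prod_eval hf).mul (hk.comp (measurable_pi_apply n))
    rw [lintegral_map (measurable_prod_eval hf) hm, lintegral_map hR hm]
    -- The two chains are advanced one at a time: the first with the path of the second frozen,
    -- then, after Fubini, the second with the path of the first frozen.
    rw [lintegral_prod_symm _ (hm1 _).aemeasurable]
    have e1 : ∀ y : ℕ → T, ∫⁻ x, ∏ i ∈ Finset.range (n + 2), f i (x i, y i) ∂ρ =
        ∫⁻ x, (∏ i ∈ Finset.range (n + 1), f i (x i, y i)) *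
          ∫⁻ s, f (n + 1) (s, y (n + 1)) ∂κ (x n) ∂ρ := fun y =>
      h.step n (fun i s => f i (s, y i)) fun i => (hf i).comp (by fun_prop)
    simp only [e1]
    have hm2 : Measurable fun z : (ℕ → S) × (ℕ → T) =>
        (∏ i ∈ Finset.range (n + 1), f i (z.1 i, z.2 i)) *
          ∫⁻ s, f (n + 1) (s, z.2 (n + 1)) ∂κ (z.1 n) :=
      (hm1 _).mul (hκ.comp (by fun_prop : Measurable
        fun z : (ℕ → S) × (ℕ → T) => (z.1 n, z.2 (n + 1))))
    have hm3 : Measurable fun z : (ℕ → S) × (ℕ → T) =>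
        (∏ i ∈ Finset.range (n + 1), f i (z.1 i, z.2 i)) *
          ∫⁻ y, f (n + 1) y ∂(κ.parallelComp η) (z.1 n, z.2 n) :=
      (hm1 _).mul (hk.comp (by fun_prop : Measurable
        fun z : (ℕ → S) × (ℕ → T) => (z.1 n, z.2 n)))
    rw [← lintegral_prod_symm (fun z : (ℕ → S) × (ℕ → T) => _) hm2.aemeasurable,
      lintegral_prod _ hm2.aemeasurable, lintegral_prod _ hm3.aemeasurable]
    refine lintegral_congr fun x => ?_
    classical
    -- The last test function already contains the integral over the step of the first chain.
    have e2 := h'.step n (fun i t => if i ≤ n then f i (x i, t) else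
      ∫⁻ s, f (n + 1) (s, t) ∂κ (x n)) fun i => by
        split_ifs
        · exact (hf i).comp (by fun_prop)
        · exact hκ.comp (by fun_prop : Measurable fun t : T => (x n, t))
    have e3 : ∀ y : ℕ → T, (∏ i ∈ Finset.range (n + 1), if i ≤ n then f i (x i, y i) else
        ∫⁻ s, f (n + 1) (s, y i) ∂κ (x n)) = ∏ i ∈ Finset.range (n + 1), f i (x i, y i) := by
      intro y
      refine Finset.prod_congr rfl fun i hi => if_pos (Nat.lt_succ_iff.1 (Finset.mem_range.1 hi))
    simp only [Finset.prod_range_succ _ (n + 1), e3, Nat.not_succ_le_self, if_false] at e2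
    rw [e2]
    refine lintegral_congr fun y => ?_
    rw [Kernel.lintegral_parallelComp_symm]
    exact hf (n + 1)

/-- An i.i.d. sequence is a Markov chain. -/
lemma isChain_infinitePi (ν : Measure S) [IsProbabilityMeasure ν] :
    IsChain (Measure.infinitePi fun _ : ℕ => ν) ν (Kernel.const S ν) := by
  refine ⟨Measure.infinitePi_map_eval (fun _ : ℕ => ν) 0, fun n f hf => ?_⟩
  have key : ∀ (N : ℕ) (g : ℕ → S → ℝ≥0∞), (∀ i, Measurable (g i)) →
      ∫⁻ x, ∏ i ∈ Finset.range N, g i (x i) ∂(Measure.infinitePi fun _ : ℕ => ν) =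
        ∏ i ∈ Finset.range N, ∫⁻ y, g i y ∂ν := by
    intro N g hg
    have hind : iIndepFun (fun i (x : ℕ → S) => g i (x i)) (Measure.infinitePi fun _ : ℕ => ν) :=
      iIndepFun_infinitePi (fun i => (hg i))
    rw [lintegral_prod_eq_prod_lintegral_of_indepFun _ _ hind
      fun i => (hg i).comp (measurable_pi_apply i)]
    refine Finset.prod_congr rfl fun i _ => ?_
    have e := lintegral_map (μ := Measure.infinitePi fun _ : ℕ => ν) (hg i)
      (measurable_pi_apply i)
    rwa [Measure.infinitePi_map_eval, eq_comm] at e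
  simp only [Kernel.const_apply]
  rw [lintegral_mul_const _ (measurable_prod_eval hf), key _ _ hf, key _ _ hf,
    Finset.prod_range_succ _ (n + 1)]

lemma IsChain.map_pair {κ : Kernel S S} [IsMarkovKernel κ] {ρ : Measure (ℕ → S)}
    [IsFiniteMeasure ρ] {μ : Measure S} [IsFiniteMeasure μ] (h : IsChain ρ μ κ) :
    ρ.map (fun w => (w 0, w 1)) = μ.compProd κ := by
  have hm : Measurable fun w : ℕ → S => (w 0, w 1) := by fun_prop
  have := Measure.isFiniteMeasure_map ρ fun w : ℕ → S => (w 0, w 1)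
  refine Measure.ext_prod fun {A B} hA hB => ?_
  have := h.step 0 (fun i => if i = 0 then A.indicator 1 else B.indicator 1)
    fun i => by split_ifs; exacts [measurable_one.indicator hA, measurable_one.indicator hB]
  simp only [zero_add, Finset.prod_range_succ, Finset.prod_range_zero, one_mul, if_true,
    one_ne_zero, if_false, lintegral_indicator_one hB] at this
  rw [Measure.map_apply hm (hA.prod hB), Measure.compProd_apply_prod hA hB]
  have e1 : ∫⁻ x, A.indicator 1 (x 0) * B.indicator 1 (x 1) ∂ρ =
      ρ ((fun w => (w 0, w 1)) ⁻¹' A ×ˢ B) := by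
    rw [← lintegral_indicator_one (hm (hA.prod hB))]
    refine lintegral_congr fun x => ?_
    by_cases h0 : x 0 ∈ A <;> by_cases h1 : x 1 ∈ B <;> simp [h0, h1, Set.indicator]
  rw [← e1, this]
  have e2 : ∫⁻ x, A.indicator 1 (x 0) * κ (x 0) B ∂ρ = ∫⁻ s, A.indicator 1 s * κ s B ∂μ := by
    rw [← h.initial]
    exact (lintegral_map ((measurable_one.indicator hA).mul (κ.measurable_coe hB))
      (measurable_pi_apply 0)).symm
  rw [e2, ← lintegral_indicator hA]
  refine lintegral_congr fun s => ?_
  by_cases hs : s ∈ A <;> simp [hs]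

lemma measurable_timeShift : Measurable (timeShift : (ℕ → S) → ℕ → S) := by
  unfold timeShift; fun_prop

lemma IsChain.map_timeShift {κ : Kernel S S} {ρ : Measure (ℕ → S)}
    {μ : Measure S} (h : IsChain ρ μ κ) :
    IsChain (ρ.map timeShift) (μ.bind κ) κ := by
  have hs : ∀ f : S → ℝ≥0∞, Measurable f →
      ∫⁻ x, f (x 1) ∂ρ = ∫⁻ x, ∫⁻ y, f y ∂κ (x 0) ∂ρ := by
    intro f hf
    have := h.step 0 (fun i => if i = 0 then 1 else f) fun i => by
      split_ifs; exacts [measurable_one, hf]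
    simpa [Finset.prod_range_succ] using this
  refine ⟨?_, fun n f hf => ?_⟩
  · rw [Measure.map_map (measurable_pi_apply 0) measurable_timeShift]
    ext A hA
    rw [Measure.bind_apply hA κ.aemeasurable, ← h.initial,
      lintegral_map (κ.measurable_coe hA) (measurable_pi_apply 0)]
    have h1 : Measurable fun x : ℕ → S => x 1 := measurable_pi_apply 1
    have := hs (A.indicator 1) (measurable_one.indicator hA)
    simp only [lintegral_indicator_one hA] at this
    rw [← this]
    change ρ.map (fun x => x 1) A = _
    rw [← lintegral_indicator_one hA, lintegral_map (measurable_one.indicator hA) h1]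
  · rw [lintegral_map (measurable_prod_eval hf) measurable_timeShift,
      lintegral_map _ measurable_timeShift]
    · have := h.step (n + 1) (fun i => if i = 0 then 1 else f (i - 1)) fun i => by
        split_ifs; exacts [measurable_one, hf _]
      rw [show n + 1 + 2 = (n + 2) + 1 from rfl] at this
      simp only [Finset.prod_range_succ' _ (n + 2), Finset.prod_range_succ' _ (n + 1)] at this
      simpa [timeShift, Finset.prod_range_succ' _ (n + 1)] using this
    · exact (measurable_prod_eval hf).mul
        ((hf (n + 1)).lintegral_kernel.comp (measurable_pi_apply n))

/-- The Markov property: reweighting a chain by a function of the first coordinate at each of the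
times `0, …, n` and forgetting the past gives a chain. -/
lemma IsChain.map_iterate_timeShift_withDensity {κ : Kernel S S} {ρ : Measure (ℕ → S)}
    {μ : Measure S} (h : IsChain ρ μ κ) (n : ℕ) {f : ℕ → S → ℝ≥0∞} (hf : ∀ i, Measurable (f i)) :
    IsChain ((ρ.withDensity fun x => ∏ i ∈ Finset.range (n + 1), f i (x i)).map
        fun x k => x (k + n))
      ((ρ.withDensity fun x => ∏ i ∈ Finset.range (n + 1), f i (x i)).map fun x => x n) κ := by
  have hm : Measurable fun (x : ℕ → S) (k : ℕ) => x (k + n) := by fun_prop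
  refine ⟨?_, fun m g hg => ?_⟩
  · rw [Measure.map_map (measurable_pi_apply 0) hm]
    simp [Function.comp_def]
  · have hR : Measurable fun x : ℕ → S => (∏ i ∈ Finset.range (m + 1), g i (x i)) *
        ∫⁻ y, g (m + 1) y ∂κ (x m) :=
      (measurable_prod_eval hg).mul
        ((hg (m + 1)).lintegral_kernel.comp (measurable_pi_apply m))
    have hL : Measurable fun x : ℕ → S => ∏ i ∈ Finset.range (m + 2), g i (x (i + n)) :=
      (measurable_prod_eval hg).comp hm
    have hR' : Measurable fun x : ℕ → S => (∏ i ∈ Finset.range (m + 1), g i (x (i + n))) *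
        ∫⁻ y, g (m + 1) y ∂κ (x (m + n)) := hR.comp hm
    rw [lintegral_map (measurable_prod_eval hg) hm, lintegral_map hR hm,
      lintegral_withDensity_eq_lintegral_mul _ (measurable_prod_eval hf) hL,
      lintegral_withDensity_eq_lintegral_mul _ (measurable_prod_eval hf) hR']
    -- The weights at times `0, …, n` and the test functions at times `n, n + 1, …` are merged into
    -- one family; both act at time `n`.
    have := h.step (m + n) (fun i s => (if i < n + 1 then f i s else 1) *
      (if n ≤ i then g (i - n) s else 1)) fun i => by
        refine Measurable.mul ?_ ?_ <;> split_ifs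
        exacts [hf i, measurable_const, hg _, measurable_const]
    have e : ∀ (M : ℕ) (x : ℕ → S), n < M + n + 1 →
        ∏ i ∈ Finset.range (M + n + 1), ((if i < n + 1 then f i (x i) else 1) *
          (if n ≤ i then g (i - n) (x i) else 1)) =
        (∏ i ∈ Finset.range (n + 1), f i (x i)) *
          ∏ i ∈ Finset.range (M + 1), g i (x (i + n)) := by
      intro M x hM
      rw [Finset.prod_mul_distrib]
      congr 1
      · rw [Finset.prod_ite, Finset.prod_const_one, mul_one]
        refine Finset.prod_congr ?_ fun _ _ => rfl
        ext i; simp only [Finset.mem_filter, Finset.mem_range]; omega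
      · rw [show M + n + 1 = n + (M + 1) by ring, Finset.prod_range_add]
        rw [Finset.prod_eq_one, one_mul]
        · refine Finset.prod_congr rfl fun i _ => ?_
          simp [add_comm n i]
        · intro i hi
          rw [if_neg (by simpa using hi)]
    have e1 : ∀ x : ℕ → S, ∏ i ∈ Finset.range (m + n + 2),
        ((if i < n + 1 then f i (x i) else 1) * (if n ≤ i then g (i - n) (x i) else 1)) =
        (∏ i ∈ Finset.range (n + 1), f i (x i)) *
          ∏ i ∈ Finset.range (m + 2), g i (x (i + n)) := fun x => by
      rw [show m + n + 2 = (m + 1) + n + 1 by ring]; exact e (m + 1) x (by omega)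
    have e2 : ∀ y, (if m + n + 1 < n + 1 then f (m + n + 1) y else 1) *
        (if n ≤ m + n + 1 then g (m + n + 1 - n) y else 1) = g (m + 1) y := fun y => by
      rw [if_neg (by omega), if_pos (by omega), one_mul, show m + n + 1 - n = m + 1 by omega]
    simp only [e1, fun x => e m x (by omega), e2] at this
    simpa [Pi.mul_apply, mul_assoc] using this

/-- Subtraction is truncated, so one of the two squares vanishes and their sum plays the part of `(a
- b) ^ 2`. It serves the `L²` argument for ergodicity and the Dirichlet energy. -/
lemma sq_sub_add_sq_sub {a b : ℝ≥0∞} (ha : a ≠ ⊤) (hb : b ≠ ⊤) :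
    ((a - b) ^ 2 + (b - a) ^ 2) + 2 * (a * b) = a ^ 2 + b ^ 2 := by
  wlog hab : a ≤ b generalizing a b
  · rw [add_comm ((a - b) ^ 2), mul_comm a b, add_comm (a ^ 2)]
    exact this hb ha (le_of_not_ge hab)
  obtain ⟨c, rfl⟩ := exists_add_of_le hab
  rw [tsub_eq_zero_of_le hab, ENNReal.add_sub_cancel_left ha]
  ring

/-- A stationary Markov chain is ergodic if the functions that are almost surely preserved by one
step of the chain are almost everywhere constant. -/
theorem ergodic_timeShift_chainLaw (κ : Kernel S S) [IsMarkovKernel κ] {Q : Measure S}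
    [IsProbabilityMeasure Q] (hinv : Q.bind κ = Q)
    (hconst : ∀ h : S → ℝ≥0∞, Measurable h → (∀ᵐ z ∂(Q.compProd κ), h z.2 = h z.1) →
      ∃ c, h =ᵐ[Q] fun _ => c) :
    Ergodic timeShift (chainLaw Q κ) := by
  set ρ := chainLaw Q κ with hρ
  have hchain : IsChain ρ Q κ := isChain_chainLaw κ Q
  have hpres : MeasurePreserving timeShift ρ ρ := by
    refine ⟨measurable_timeShift, ?_⟩
    have := hchain.map_timeShift
    rw [hinv] at this
    exact this.eq_chainLaw
  refine ⟨hpres, ⟨fun B hB hBinv => ?_⟩⟩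
  -- The probability of the invariant event `B` as a function of the starting point.
  set h : S → ℝ≥0∞ := fun x => pathKernel κ x B with hh
  have hm : Measurable h := (pathKernel κ).measurable_coe hB
  have hle : ∀ x, h x ≤ 1 := fun x => prob_le_one
  have hiter : ∀ (n : ℕ), (fun (x : ℕ → S) k => x (k + n)) ⁻¹' B = B := by
    intro n
    induction n with
    | zero => rfl
    | succ n ih =>
      conv_rhs => rw [← ih, ← hBinv]
      ext x
      have : (fun k => x (k + (n + 1))) = fun k => x (k + 1 + n) := by
        funext k; congr 1; ring
      simp only [Set.mem_preimage, this]
      rfl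
  -- Since `B` is unchanged by forgetting the past, the Markov property says that its conditional
  -- probability given the first `n + 1` coordinates is `h (x n)`.
  have hcond : ∀ (n : ℕ) (f : ℕ → S → ℝ≥0∞), (∀ i, Measurable (f i)) → (∀ i s, f i s ≤ 1) →
      ∫⁻ x in B, ∏ i ∈ Finset.range (n + 1), f i (x i) ∂ρ =
        ∫⁻ x, (∏ i ∈ Finset.range (n + 1), f i (x i)) * h (x n) ∂ρ := by
    intro n f hf hf1
    have hfin : IsFiniteMeasure
        (ρ.withDensity fun x => ∏ i ∈ Finset.range (n + 1), f i (x i)) := by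
      refine isFiniteMeasure_withDensity (ne_top_of_le_ne_top ENNReal.one_ne_top ?_)
      calc _ ≤ ∫⁻ _, 1 ∂ρ := lintegral_mono fun x => Finset.prod_le_one' fun i _ => hf1 i _
        _ = 1 := by simp
    have hC := (hchain.map_iterate_timeShift_withDensity n hf).eq_chainLaw
    have hBeq := congrArg (fun m => m B) hC
    rw [Measure.map_apply (by fun_prop) hB, hiter, withDensity_apply _ hB] at hBeq
    rw [hBeq, chainLaw_eq_bind, Measure.bind_apply hB (Kernel.aemeasurable _),
      lintegral_map hm (measurable_pi_apply n)]
    exact lintegral_withDensity_eq_lintegral_mul _ (measurable_prod_eval hf)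
      (hm.comp (measurable_pi_apply n))
  have hX : ∀ n, ρ.map (fun x => x n) = Q := by
    intro n
    induction n with
    | zero => exact hchain.initial
    | succ n ih =>
      rw [← ih]
      conv_rhs => rw [← hpres.map_eq, Measure.map_map (measurable_pi_apply n) measurable_timeShift]
      rfl
  -- Both sides equal the integral of `h (x 0)` over `B`, conditioned at time `1` and at time `0`.
  -- With stationarity this makes `h (x 0) - h (x 1)` vanish in `L²`.
  have hcorr : ∫⁻ x, h (x 0) * h (x 1) ∂ρ = ∫⁻ x, h (x 0) ^ 2 ∂ρ := by
    have h1 := hcond 0 (fun i => h) (fun _ => hm) (fun _ => hle)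
    have h2 := hcond 1 (fun i => if i = 0 then h else 1)
      (fun i => by split_ifs; exacts [hm, measurable_one])
      (fun i s => by split_ifs; exacts [hle s, le_rfl])
    simp only [zero_add, Finset.prod_range_succ, Finset.prod_range_zero, one_mul, if_true,
      one_ne_zero, if_false, Pi.one_apply, mul_one] at h1 h2
    simp only [← h2, h1, sq]
  have h01 : ∫⁻ x, h (x 1) ^ 2 ∂ρ = ∫⁻ x, h (x 0) ^ 2 ∂ρ := by
    have e : ∀ n, ∫⁻ x, h (x n) ^ 2 ∂ρ = ∫⁻ s, h s ^ 2 ∂Q := fun n => by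
      rw [← hX n]; exact (lintegral_map (hm.pow_const 2) (measurable_pi_apply n)).symm
    rw [e, e]
  have hne : ∀ x, h x ≠ ⊤ := fun x => ne_top_of_le_ne_top ENNReal.one_ne_top (hle x)
  have hm0 : Measurable fun x : ℕ → S => h (x 0) := hm.comp (measurable_pi_apply 0)
  have hm1 : Measurable fun x : ℕ → S => h (x 1) := hm.comp (measurable_pi_apply 1)
  have hdist : ∫⁻ x, ((h (x 0) - h (x 1)) ^ 2 + (h (x 1) - h (x 0)) ^ 2) ∂ρ = 0 := by
    have e := lintegral_congr (μ := ρ) fun x => sq_sub_add_sq_sub (hne (x 0)) (hne (x 1))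
    have hm01 : Measurable fun x : ℕ → S => h (x 0) * h (x 1) := hm0.mul hm1
    rw [lintegral_add_right _ (hm01.const_mul 2), lintegral_add_left (hm0.pow_const 2),
      lintegral_const_mul _ hm01, hcorr, h01, ← two_mul] at e
    refine (ENNReal.add_left_inj ?_).1 (e.trans (zero_add _).symm)
    refine ENNReal.mul_ne_top (by simp) (ne_top_of_le_ne_top ENNReal.one_ne_top ?_)
    calc _ ≤ ∫⁻ _, 1 ∂ρ := lintegral_mono fun x => pow_le_one₀ zero_le (hle _)
      _ = 1 := by simp
  have hinvar : ∀ᵐ z ∂(Q.compProd κ), h z.2 = h z.1 := by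
    have hset : MeasurableSet {z : S × S | h z.2 = h z.1} :=
      measurableSet_eq_fun (hm.comp measurable_snd) (hm.comp measurable_fst)
    rw [← hchain.map_pair, ae_map_iff (by fun_prop) hset]
    have hD : Measurable fun x : ℕ → S =>
        (h (x 0) - h (x 1)) ^ 2 + (h (x 1) - h (x 0)) ^ 2 :=
      ((hm0.sub hm1).pow_const 2).add ((hm1.sub hm0).pow_const 2)
    rw [lintegral_eq_zero_iff hD] at hdist
    filter_upwards [hdist] with x hx
    simp only [Pi.zero_apply, add_eq_zero, ne_eq, OfNat.ofNat_ne_zero, not_false_eq_true,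
      pow_eq_zero_iff, tsub_eq_zero_iff_le] at hx
    exact le_antisymm hx.2 hx.1
  obtain ⟨c, hc⟩ := hconst h hm hinvar
  -- As `h` is constant, `B` is independent of every finite set of coordinates, hence of itself, and
  -- `ρ B = ρ B ^ 2`.
  have hrest : ρ.restrict B = c • ρ := by
    refine ext_of_lintegral_prod fun n f hf hf1 => ?_
    rw [hcond n f hf hf1, lintegral_smul_measure, smul_eq_mul,
      ← lintegral_const_mul _ (measurable_prod_eval hf)]
    have : ∀ᵐ x ∂ρ, h (x n) = c := by
      have := hc
      rw [← hX n] at this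
      exact ae_of_ae_map (measurable_pi_apply n).aemeasurable this
    refine lintegral_congr_ae ?_
    filter_upwards [this] with x hx
    rw [hx, mul_comm]
  have e1 : ρ B = c := by
    have := congrArg (fun m => m Set.univ) hrest
    simpa using this
  have e2 : ρ B = c * ρ B := by
    have := congrArg (fun m => m B) hrest
    simpa using this
  rw [e1] at e2
  have hc1 : c ≠ ⊤ := by rw [← e1]; exact measure_ne_top _ _
  rw [eventuallyConst_set']
  rcases eq_or_ne c 0 with h0 | h0
  · exact Or.inl (ae_eq_empty.2 (e1.trans h0))
  · right
    have : c = 1 := ((ENNReal.mul_eq_left h0 hc1).1 e2.symm)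
    exact (ae_eq_univ_iff_measure_eq hB.nullMeasurableSet).2 (by rw [e1, this, measure_univ])

/-! ### Chains with independent noise -/

section IndependentNoise

variable {T : Type*} [MeasurableSpace T] (κ : Kernel S S) [IsMarkovKernel κ] {Q : Measure S}
  [IsProbabilityMeasure Q] (ν : Measure T) [IsProbabilityMeasure ν]

lemma bind_parallelComp_const (hinv : Q.bind κ = Q) :
    (Q.prod ν).bind (κ.parallelComp (Kernel.const T ν)) = Q.prod ν := by
  refine (Measure.prod_eq fun A B hA hB => ?_).symm
  rw [Measure.bind_apply (hA.prod hB) (Kernel.aemeasurable _)]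
  simp only [Kernel.parallelComp_apply, Kernel.const_apply, Measure.prod_prod]
  have hm : Measurable fun z : S × T => κ z.1 A := (κ.measurable_coe hA).comp measurable_fst
  rw [lintegral_mul_const _ hm, lintegral_prod _ hm.aemeasurable]
  simp only [lintegral_const, measure_univ, mul_one]
  rw [← Measure.bind_apply hA κ.aemeasurable, hinv]

/-- Adding independent noise to a chain does not create invariant functions. -/
lemma ae_const_of_parallelComp_const (hinv : Q.bind κ = Q)
    (hconst : ∀ h : S → ℝ≥0∞, Measurable h → (∀ᵐ z ∂(Q.compProd κ), h z.2 = h z.1) →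
      ∃ c, h =ᵐ[Q] fun _ => c) (h : S × T → ℝ≥0∞) (hm : Measurable h)
    (hh : ∀ᵐ z ∂((Q.prod ν).compProd (κ.parallelComp (Kernel.const T ν))), h z.2 = h z.1) :
    ∃ c, h =ᵐ[Q.prod ν] fun _ => c := by
  set K := κ.parallelComp (Kernel.const T ν) with hK
  have hKapp : ∀ x, K x = (κ x.1).prod ν := fun x => by
    rw [hK, Kernel.parallelComp_apply, Kernel.const_apply]
  -- The mean of `h` after one step. It does not see the current noise, which is refreshed at each
  -- step, so an invariant `h` is a function of the first coordinate alone.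
  set g : S → ℝ≥0∞ := fun s => ∫⁻ z, h z ∂((κ s).prod ν) with hg
  have hgm : Measurable g := by
    have : Measurable fun x : S × T => ∫⁻ z, h z ∂K x := hm.lintegral_kernel
    obtain ⟨t⟩ : Nonempty T := nonempty_of_isProbabilityMeasure ν
    have h2 := this.comp (measurable_prodMk_right (y := t))
    simpa only [Function.comp_def, hKapp] using h2
  have h1 := Measure.ae_ae_of_ae_compProd hh
  have h2 : ∀ᵐ x ∂(Q.prod ν), h x = g x.1 := by
    filter_upwards [h1] with x hx
    rw [hKapp] at hx
    simp only [hg, lintegral_congr_ae hx, lintegral_const, measure_univ, mul_one]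
  -- By stationarity, what holds almost surely now also holds almost surely after one step.
  have h3 : ∀ᵐ x ∂(Q.prod ν), ∀ᵐ z ∂K x, h z = g z.1 := by
    refine Measure.ae_ae_of_ae_comp ?_
    rwa [bind_parallelComp_const κ ν hinv]
  have h4 : ∀ᵐ x ∂(Q.prod ν), ∀ᵐ s ∂κ x.1, g s = g x.1 := by
    filter_upwards [h1, h2, h3] with x hx1 hx2 hx3
    have : ∀ᵐ z ∂(κ x.1).prod ν, g z.1 = g x.1 := by
      rw [← hKapp]
      filter_upwards [hx1, hx3] with z hz1 hz3
      rw [← hz3, hz1, hx2]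
    have h5 : ∀ᵐ s ∂((κ x.1).prod ν).map Prod.fst, g s = g x.1 := by
      rw [ae_map_iff measurable_fst.aemeasurable (measurableSet_eq_fun hgm measurable_const)]
      exact this
    rwa [← Measure.fst, Measure.fst_prod] at h5
  have h5 : ∀ᵐ s ∂Q, ∀ᵐ s' ∂κ s, g s' = g s := by
    have := Measure.ae_ae_of_ae_prod h4
    filter_upwards [this] with s hs
    exact hs.exists.choose_spec
  obtain ⟨c, hc⟩ := hconst g hgm (Measure.ae_compProd_of_ae_ae
    (measurableSet_eq_fun (hgm.comp measurable_snd) (hgm.comp measurable_fst)) h5)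
  refine ⟨c, ?_⟩
  have h6 : ∀ᵐ x ∂(Q.prod ν), g x.1 = c := by
    have : ∀ᵐ s ∂(Q.prod ν).map Prod.fst, g s = c := by
      rw [← Measure.fst, Measure.fst_prod]; exact hc
    exact ae_of_ae_map measurable_fst.aemeasurable this
  filter_upwards [h2, h6] with x hx1 hx2
  rw [hx1, hx2]

end IndependentNoise

end Chain

end Mott

namespace Mott

/-! ### Green functions of reversible random walks on the integers -/

section Network

open scoped ENNReal

/-- The `n`-step transition probabilities of the transition matrix `p`. -/
noncomputable def stepPow (p : ℤ → ℤ → ℝ≥0∞) : ℕ → ℤ → ℤ → ℝ≥0∞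
  | 0 => fun i j => if i = j then 1 else 0
  | n + 1 => fun i j => ∑' k, p i k * stepPow p n k j

/-- The Green function: the expected number of visits to `j` of the walk started at `i`. -/
noncomputable def green (p : ℤ → ℤ → ℝ≥0∞) (i j : ℤ) : ℝ≥0∞ := ∑' n, stepPow p n i j

/-- The Green function discounted at rate `s` per step. -/
noncomputable def resolvent (p : ℤ → ℤ → ℝ≥0∞) (s : ℝ≥0∞) (i j : ℤ) : ℝ≥0∞ :=
  ∑' n, s ^ n * stepPow p n i j

variable {p : ℤ → ℤ → ℝ≥0∞}

lemma tsum_ite_mul (i : ℤ) (f : ℤ → ℝ≥0∞) : ∑' k, (if i = k then 1 else 0) * f k = f i := by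
  rw [tsum_eq_single i fun k hk => by simp [hk.symm]]; simp

lemma tsum_mul_ite (j : ℤ) (f : ℤ → ℝ≥0∞) : ∑' k, f k * (if k = j then 1 else 0) = f j := by
  rw [tsum_eq_single j fun k hk => by simp [hk]]; simp

lemma stepPow_succ' (n : ℕ) (i j : ℤ) :
    stepPow p (n + 1) i j = ∑' k, stepPow p n i k * p k j := by
  induction n generalizing i with
  | zero => simp only [stepPow, tsum_ite_mul, tsum_mul_ite]
  | succ n ih =>
    rw [stepPow]
    simp only [ih, ← ENNReal.tsum_mul_left]
    rw [ENNReal.tsum_comm]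
    refine tsum_congr fun k => ?_
    rw [stepPow, ← ENNReal.tsum_mul_right]
    exact tsum_congr fun l => (mul_assoc _ _ _).symm

lemma tsum_stepPow (hp : ∀ i, ∑' j, p i j = 1) (n : ℕ) (i : ℤ) :
    ∑' j, stepPow p n i j = 1 := by
  induction n generalizing i with
  | zero => simp [stepPow]
  | succ n ih =>
    simp only [stepPow]
    rw [ENNReal.tsum_comm]
    simp only [ENNReal.tsum_mul_left, ih, mul_one, hp]

lemma stepPow_le_one (hp : ∀ i, ∑' j, p i j = 1) (n : ℕ) (i j : ℤ) : stepPow p n i j ≤ 1 := by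
  rw [← tsum_stepPow hp n i]; exact ENNReal.le_tsum j

lemma stepPow_reversible {w : ℤ → ℝ≥0∞} (hw : ∀ i j, w i * p i j = w j * p j i) (n : ℕ)
    (i j : ℤ) : w i * stepPow p n i j = w j * stepPow p n j i := by
  induction n generalizing i j with
  | zero =>
    rcases eq_or_ne i j with rfl | h
    · rfl
    · simp [stepPow, h, h.symm]
  | succ n ih =>
    rw [stepPow_succ' n j i, stepPow, ← ENNReal.tsum_mul_left, ← ENNReal.tsum_mul_left]
    refine tsum_congr fun k => ?_
    rw [← mul_assoc, hw, mul_right_comm, ih, mul_assoc]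

lemma stepPow_translate {p' : ℤ → ℤ → ℝ≥0∞} {a : ℤ} (h : ∀ i j, p' i j = p (i + a) (j + a))
    (n : ℕ) (i j : ℤ) : stepPow p' n i j = stepPow p n (i + a) (j + a) := by
  induction n generalizing i with
  | zero => simp [stepPow]
  | succ n ih =>
    simp only [stepPow, h, ih]
    exact (Equiv.addRight a).tsum_eq fun k => p (i + a) k * stepPow p n k (j + a)

lemma green_translate {p' : ℤ → ℤ → ℝ≥0∞} {a : ℤ} (h : ∀ i j, p' i j = p (i + a) (j + a))
    (i j : ℤ) : green p' i j = green p (i + a) (j + a) :=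
  tsum_congr fun n => stepPow_translate h n i j

lemma green_reversible {w : ℤ → ℝ≥0∞} (hw : ∀ i j, w i * p i j = w j * p j i) (i j : ℤ) :
    w i * green p i j = w j * green p j i := by
  simp only [green, ← ENNReal.tsum_mul_left, stepPow_reversible hw]

/-- The left side counts the visits from time `1` on; only the visit at time `0` is lost. -/
lemma tsum_green_mul_le (i j : ℤ) : ∑' k, green p i k * p k j ≤ green p i j := by
  simp only [green, ← ENNReal.tsum_mul_right]
  rw [ENNReal.tsum_comm]
  simp only [← stepPow_succ']
  exact ENNReal.tsum_comp_le_tsum_of_injective (Nat.succ_injective) fun n => stepPow p n i j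

/-- The maximum principle for the Green function. -/
lemma green_le_diag (hp : ∀ i, ∑' j, p i j = 1) (i j : ℤ) : green p i j ≤ green p j j := by
  -- Truncation in time allows an induction even when the Green function is infinite: away from `j`
  -- the time-`0` term is zero, and the remaining sum is an average over the first jump.
  have key : ∀ (T : ℕ) (i : ℤ), ∑ n ∈ Finset.range T, stepPow p n i j ≤ green p j j := by
    intro T
    induction T with
    | zero => intro i; simp
    | succ T ih =>
      intro i
      rcases eq_or_ne i j with rfl | hij
      · exact ENNReal.sum_le_tsum _
      · rw [Finset.sum_range_succ']
        simp only [stepPow, hij, if_false, add_zero]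
        calc ∑ n ∈ Finset.range T, ∑' k, p i k * stepPow p n k j
            = ∑' k, p i k * ∑ n ∈ Finset.range T, stepPow p n k j := by
              simp only [Finset.mul_sum]
              rw [Summable.tsum_finsetSum fun _ _ => ENNReal.summable]
          _ ≤ ∑' k, p i k * green p j j :=
              ENNReal.tsum_le_tsum fun k => mul_le_mul_right (ih k) _
          _ = green p j j := by rw [ENNReal.tsum_mul_right, hp, one_mul]
  rw [green, ENNReal.tsum_eq_iSup_nat]
  exact iSup_le fun T => key T i

/-! #### The resolvent and its Dirichlet energy -/

lemma resolvent_eq (s : ℝ≥0∞) (i j : ℤ) :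
    resolvent p s i j = (if i = j then 1 else 0) + s * ∑' k, p i k * resolvent p s k j := by
  rw [resolvent, tsum_eq_zero_add' ENNReal.summable]
  simp only [pow_zero, one_mul]
  congr 1
  simp only [resolvent, ← ENNReal.tsum_mul_left, stepPow]
  rw [ENNReal.tsum_comm]
  refine tsum_congr fun k => tsum_congr fun n => ?_
  rw [pow_succ]; ring

lemma tsum_resolvent (hp : ∀ i, ∑' j, p i j = 1) (s : ℝ≥0∞) (i : ℤ) :
    ∑' j, resolvent p s i j = (1 - s)⁻¹ := by
  simp only [resolvent]
  rw [ENNReal.tsum_comm]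
  simp only [ENNReal.tsum_mul_left, tsum_stepPow hp, mul_one, ENNReal.tsum_geometric]

lemma resolvent_reversible {w : ℤ → ℝ≥0∞} (hw : ∀ i j, w i * p i j = w j * p j i) (s : ℝ≥0∞)
    (i j : ℤ) : w i * resolvent p s i j = w j * resolvent p s j i := by
  simp only [resolvent, ← ENNReal.tsum_mul_left]
  refine tsum_congr fun n => ?_
  rw [mul_left_comm, stepPow_reversible hw, mul_left_comm]

variable {w : ℤ → ℝ≥0∞}

lemma tsum_weight_mul_resolvent (hp : ∀ i, ∑' j, p i j = 1)
    (hw : ∀ i j, w i * p i j = w j * p j i) (s : ℝ≥0∞) (o : ℤ) :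
    ∑' k, w k * resolvent p s k o = w o * (1 - s)⁻¹ := by
  simp only [resolvent_reversible hw s _ o, ENNReal.tsum_mul_left, tsum_resolvent hp]

/-- The Dirichlet energy of the resolvent is controlled by its value at the pole. -/
lemma energy_resolvent_le (hp : ∀ i, ∑' j, p i j = 1)
    (hw : ∀ i j, w i * p i j = w j * p j i) (hwf : ∀ i, w i ≠ ⊤) {s : ℝ≥0∞} (hs : s < 1) (o : ℤ) :
    s * ∑' k, ∑' j, w k * p k j * ((resolvent p s k o - resolvent p s j o) ^ 2 +
      (resolvent p s j o - resolvent p s k o) ^ 2) ≤ 2 * (w o * resolvent p s o o) := by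
  set v : ℤ → ℝ≥0∞ := fun k => resolvent p s k o with hv
  have hs' : (1 - s)⁻¹ ≠ ⊤ := ENNReal.inv_ne_top.2 (tsub_pos_of_lt hs).ne'
  have hvle : ∀ k, v k ≤ (1 - s)⁻¹ := fun k => by
    rw [← tsum_resolvent hp s k]; exact ENNReal.le_tsum o
  have hvf : ∀ k, v k ≠ ⊤ := fun k => ne_top_of_le_ne_top hs' (hvle k)
  set E := ∑' k, w k * v k ^ 2 with hE
  set X := ∑' k, ∑' j, w k * p k j * (v k * v j) with hX
  -- Here `s < 1` matters: `v` is bounded by `(1 - s)⁻¹` and is summable against `w`.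
  have hEfin : E ≠ ⊤ := by
    refine ne_top_of_le_ne_top (b := w o * (1 - s)⁻¹ * (1 - s)⁻¹)
      (ENNReal.mul_ne_top (ENNReal.mul_ne_top (hwf o) hs') hs') ?_
    rw [← tsum_weight_mul_resolvent hp hw, ← ENNReal.tsum_mul_right]
    refine ENNReal.tsum_le_tsum fun k => ?_
    rw [sq, ← mul_assoc]
    exact mul_le_mul_right (hvle k) _
  -- The resolvent equation tested against `w * v`.
  have hEX : E = w o * v o + s * X := by
    have h1 : ∀ k, w k * v k ^ 2 = (w k * v k) * (if k = o then 1 else 0) +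
        s * ∑' j, w k * p k j * (v k * v j) := by
      intro k
      have e : ∀ j, w k * p k j * (v k * v j) = (w k * v k) * (p k j * v j) := fun j => by ring
      simp only [e, ENNReal.tsum_mul_left]
      rw [mul_left_comm s, ← mul_add, ← resolvent_eq, sq, mul_assoc]
    rw [hE, hX]
    simp only [h1]
    rw [ENNReal.tsum_add, tsum_mul_ite, ENNReal.tsum_mul_left]
  have hE1 : ∑' k, ∑' j, w k * p k j * v k ^ 2 = E := by
    refine tsum_congr fun k => ?_
    rw [ENNReal.tsum_mul_right, ENNReal.tsum_mul_left, hp, mul_one]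
  have hE2 : ∑' k, ∑' j, w k * p k j * v j ^ 2 = E := by
    rw [ENNReal.tsum_comm, ← hE1]
    exact tsum_congr fun k => tsum_congr fun j => by rw [hw]
  set D := ∑' k, ∑' j, w k * p k j * ((v k - v j) ^ 2 + (v j - v k) ^ 2) with hD
  have hDX : D + 2 * X = 2 * E := by
    rw [two_mul E]
    nth_rewrite 1 [← hE1]
    rw [← hE2, hD, hX, ← ENNReal.tsum_mul_left, ← ENNReal.tsum_add, ← ENNReal.tsum_add]
    refine tsum_congr fun k => ?_
    rw [← ENNReal.tsum_mul_left, ← ENNReal.tsum_add, ← ENNReal.tsum_add]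
    refine tsum_congr fun j => ?_
    rw [← mul_add, ← sq_sub_add_sq_sub (hvf k) (hvf j)]
    ring
  have hXfin : X ≠ ⊤ := by
    refine ne_top_of_le_ne_top (b := 2 * E) (ENNReal.mul_ne_top (by simp) hEfin) ?_
    rw [← hDX, two_mul, ← add_assoc]
    exact le_add_self
  have hfin : 2 * (s * X) ≠ ⊤ :=
    ENNReal.mul_ne_top (by simp) (ENNReal.mul_ne_top hs.ne_top hXfin)
  -- In terms of differences, `s D = 2 s (E - X) ≤ 2 (E - s X) = 2 w(o) v(o)`. Adding the finite
  -- quantity `2 s X` avoids truncated subtraction.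
  refine (ENNReal.add_le_add_iff_right hfin).1 ?_
  calc s * D + 2 * (s * X) = s * (D + 2 * X) := by ring
    _ = s * (2 * E) := by rw [hDX]
    _ ≤ 1 * (2 * E) := mul_le_mul_left hs.le _
    _ = 2 * (w o * v o) + 2 * (s * X) := by rw [one_mul, hEX, mul_add]

lemma ofReal_sq_toReal_sub {a b : ℝ≥0∞} (ha : a ≠ ⊤) (hb : b ≠ ⊤) :
    (a - b) ^ 2 + (b - a) ^ 2 = ENNReal.ofReal ((a.toReal - b.toReal) ^ 2) := by
  wlog hab : a ≤ b generalizing a b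
  · rw [add_comm, this hb ha (le_of_not_ge hab), ← neg_sub b.toReal, neg_sq]
  obtain ⟨c, rfl⟩ := exists_add_of_le hab
  have hc : c ≠ ⊤ := fun h => hb (by simp [h])
  rw [tsub_eq_zero_of_le hab, ENNReal.add_sub_cancel_left ha, ENNReal.toReal_add ha hc]
  rw [show a.toReal - (a.toReal + c.toReal) = -c.toReal by ring, neg_sq,
    ENNReal.ofReal_pow ENNReal.toReal_nonneg, ENNReal.ofReal_toReal hc]
  simp

/-- The resolvent at the pole is at most a multiple of the resistance of the nearest neighbour
path to the right. -/
lemma resolvent_diag_le (hp : ∀ i, ∑' j, p i j = 1)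
    (hw : ∀ i j, w i * p i j = w j * p j i) (hwf : ∀ i, w i ≠ ⊤) (hw0 : ∀ i, w i ≠ 0)
    {s : ℝ≥0∞} (hs0 : s ≠ 0) (hs : s < 1) (o : ℤ) :
    s * resolvent p s o o ≤ 2 * w o * ∑' k : ℕ, (w (o + k) * p (o + k) (o + k + 1))⁻¹ := by
  set R := ∑' k : ℕ, (w (o + k) * p (o + k) (o + k + 1))⁻¹ with hR
  rcases eq_or_ne R ⊤ with hRtop | hRfin
  · rw [hRtop, ENNReal.mul_top (mul_ne_zero (by simp) (hw0 o))]; exact le_top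
  have hs' : (1 - s)⁻¹ ≠ ⊤ := ENNReal.inv_ne_top.2 (tsub_pos_of_lt hs).ne'
  set v : ℤ → ℝ≥0∞ := fun k => resolvent p s k o with hv
  have hvf : ∀ k, v k ≠ ⊤ := fun k => by
    refine ne_top_of_le_ne_top hs' ?_
    rw [← tsum_resolvent hp s k]; exact ENNReal.le_tsum o
  set c : ℕ → ℝ≥0∞ := fun k => w (o + k) * p (o + k) (o + k + 1) with hc
  have hple : ∀ i j, p i j ≤ 1 := fun i j => by rw [← hp i]; exact ENNReal.le_tsum j
  have hcw : ∀ k, c k ≤ w (o + k) := fun k => mul_le_of_le_one_right' (hple _ _)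
  have hcf : ∀ k, c k ≠ ⊤ := fun k => ne_top_of_le_ne_top (hwf _) (hcw k)
  have hc0 : ∀ k, c k ≠ 0 := fun k h => by
    have : (c k)⁻¹ ≤ R := ENNReal.le_tsum (f := fun k => (c k)⁻¹) k
    rw [h, ENNReal.inv_zero] at this
    exact hRfin (top_le_iff.1 this)
  have hcpos : ∀ k, 0 < (c k).toReal := fun k => ENNReal.toReal_pos (hc0 k) (hcf k)
  set V : ℕ → ℝ := fun k => (v (o + k)).toReal with hV
  -- the energy along the path
  have henergy : ∀ n : ℕ, s.toReal * ∑ k ∈ Finset.range n, (c k).toReal * (V k - V (k + 1)) ^ 2 ≤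
      2 * ((w o).toReal * V 0) := by
    intro n
    have h1 := energy_resolvent_le hp hw hwf hs o
    -- Only the edges of the path to the right are kept, each in one orientation. This loses a
    -- factor `2`, which is harmless.
    have h2 : ∑ k ∈ Finset.range n, c k * ENNReal.ofReal ((V k - V (k + 1)) ^ 2) ≤
        ∑' k, ∑' j, w k * p k j * ((v k - v j) ^ 2 + (v j - v k) ^ 2) := by
      calc _ ≤ ∑' k : ℕ, c k * ENNReal.ofReal ((V k - V (k + 1)) ^ 2) := ENNReal.sum_le_tsum _
        _ ≤ ∑' k : ℕ, ∑' j, w (o + k) * p (o + k) j *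
            ((v (o + k) - v j) ^ 2 + (v j - v (o + k)) ^ 2) := by
          refine ENNReal.tsum_le_tsum fun k => ?_
          refine le_trans (le_of_eq ?_) (ENNReal.le_tsum (o + k + 1))
          rw [ofReal_sq_toReal_sub (hvf _) (hvf _)]
          simp only [hc, hV, Nat.cast_add, Nat.cast_one, add_assoc]
        _ ≤ _ := ENNReal.tsum_comp_le_tsum_of_injective
            (f := fun k : ℕ => o + (k : ℤ)) (fun a b h => by simpa using h)
            fun k => ∑' j, w k * p k j * ((v k - v j) ^ 2 + (v j - v k) ^ 2)
    have h3 := (mul_le_mul_right h2 s).trans h1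
    have h4 := ENNReal.toReal_mono
      (ENNReal.mul_ne_top (by simp) (ENNReal.mul_ne_top (hwf o) (hvf o))) h3
    rw [ENNReal.toReal_mul, ENNReal.toReal_sum fun k _ =>
      ENNReal.mul_ne_top (hcf k) ENNReal.ofReal_ne_top] at h4
    simp only [ENNReal.toReal_mul, ENNReal.toReal_ofReal (sq_nonneg _), ENNReal.toReal_ofNat] at h4
    simpa [hV] using h4
  have hres : ∀ n : ℕ, ∑ k ∈ Finset.range n, ((c k).toReal)⁻¹ ≤ R.toReal := by
    intro n
    have := ENNReal.toReal_mono hRfin (ENNReal.sum_le_tsum (f := fun k => (c k)⁻¹)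
      (Finset.range n))
    rw [ENNReal.toReal_sum fun k _ => ENNReal.inv_ne_top.2 (hc0 k)] at this
    simpa only [ENNReal.toReal_inv] using this
  have hspos : 0 < s.toReal := ENNReal.toReal_pos hs0 hs.ne_top
  -- Cauchy–Schwarz along the path: the squared drop of potential is at most the energy times the
  -- resistance.
  have hCS : ∀ n : ℕ, s.toReal * (V 0 - V n) ^ 2 ≤ 2 * ((w o).toReal * V 0) * R.toReal := by
    intro n
    have h1 : V 0 - V n = ∑ k ∈ Finset.range n, (V k - V (k + 1)) :=
      (Finset.sum_range_sub' V n).symm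
    have h2 := Finset.sum_sq_le_sum_mul_sum_of_sq_le_mul (Finset.range n)
      (r := fun k => V k - V (k + 1)) (f := fun k => (c k).toReal * (V k - V (k + 1)) ^ 2)
      (g := fun k => ((c k).toReal)⁻¹) (fun k _ => by positivity) (fun k _ => by positivity)
      (fun k _ => by have := (hcpos k).ne'; exact le_of_eq (by field_simp))
    rw [h1]
    calc _ ≤ s.toReal * (_ * _) := mul_le_mul_of_nonneg_left h2 hspos.le
      _ = (s.toReal * _) * _ := by rw [mul_assoc]
      _ ≤ _ := mul_le_mul (henergy n) (hres n)
        (Finset.sum_nonneg fun k _ => by positivity) (by positivity)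
  -- The sum of `w * v` is finite and `c k ≤ w (o + k)`, so `v (o + k)` is at most a constant over
  -- `c k`; summability of the resistances sends this to `0`. The potential drop thus becomes `V 0`
  -- itself.
  have hVlim : Tendsto V atTop (𝓝 0) := by
    have h1 : Tendsto (fun k => (c k)⁻¹) atTop (𝓝 0) :=
      ENNReal.tendsto_atTop_zero_of_tsum_ne_top hRfin
    have hM : w o * (1 - s)⁻¹ ≠ ⊤ := ENNReal.mul_ne_top (hwf o) hs'
    have h2 : Tendsto (fun k => (w o * (1 - s)⁻¹) * (c k)⁻¹) atTop (𝓝 0) := by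
      simpa using ENNReal.Tendsto.const_mul h1 (Or.inr hM)
    have h3 : ∀ k : ℕ, v (o + k) ≤ (w o * (1 - s)⁻¹) * (c k)⁻¹ := by
      intro k
      rw [← div_eq_mul_inv, ENNReal.le_div_iff_mul_le (Or.inl (hc0 k)) (Or.inl (hcf k)), mul_comm,
        ← tsum_weight_mul_resolvent hp hw]
      exact (mul_le_mul_left (hcw k) _).trans
        (ENNReal.le_tsum (f := fun k => w k * resolvent p s k o) (o + k))
    have h4 : Tendsto (fun k : ℕ => v (o + k)) atTop (𝓝 0) :=
      tendsto_of_tendsto_of_tendsto_of_le_of_le tendsto_const_nhds h2 (fun _ => zero_le) h3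
    simpa [hV, Function.comp_def] using (ENNReal.tendsto_toReal ENNReal.zero_ne_top).comp h4
  have hlim : s.toReal * (V 0 - 0) ^ 2 ≤ 2 * ((w o).toReal * V 0) * R.toReal :=
    le_of_tendsto' (((tendsto_const_nhds.sub hVlim).pow 2).const_mul _) hCS
  have hVle : s.toReal * V 0 ≤ 2 * (w o).toReal * R.toReal := by
    have hV0 : 0 ≤ V 0 := ENNReal.toReal_nonneg
    rcases hV0.eq_or_lt with h | h
    · rw [← h, mul_zero]; positivity
    · refine le_of_mul_le_mul_right ?_ h
      nlinarith
  have hfin : 2 * w o * R ≠ ⊤ := ENNReal.mul_ne_top (ENNReal.mul_ne_top (by simp) (hwf o)) hRfin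
  rw [← ENNReal.toReal_le_toReal (ENNReal.mul_ne_top hs.ne_top (hvf o)) hfin]
  simpa [hV, ENNReal.toReal_mul] using hVle

/-- The Green function on the diagonal is at most a multiple of the resistance of the nearest
neighbour path to the right. -/
theorem green_diag_le (hp : ∀ i, ∑' j, p i j = 1)
    (hw : ∀ i j, w i * p i j = w j * p j i) (hwf : ∀ i, w i ≠ ⊤) (hw0 : ∀ i, w i ≠ 0) (o : ℤ) :
    green p o o ≤ 2 * w o * ∑' k : ℕ, (w (o + k) * p (o + k) (o + k + 1))⁻¹ := by
  rw [green, ENNReal.tsum_eq_iSup_nat]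
  refine iSup_le fun T => ?_
  obtain ⟨s, -, hs, hlim⟩ := exists_seq_strictMono_tendsto' (zero_lt_one : (0 : ℝ≥0∞) < 1)
  have hfin : ∑ n ∈ Finset.range T, stepPow p n o o ≠ ⊤ :=
    (ENNReal.sum_lt_top.2 fun n _ => (stepPow_le_one hp n o o).trans_lt ENNReal.one_lt_top).ne
  -- Of the `T + 1` powers of `s`, one matches the prefactor in the resolvent bound and the other
  -- `T` lie below each discount `s ^ n` with `n < T`. All of them disappear as `s` tends to `1`.
  have h1 : Tendsto (fun m => s m ^ (T + 1) * ∑ n ∈ Finset.range T, stepPow p n o o) atTop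
      (𝓝 (∑ n ∈ Finset.range T, stepPow p n o o)) := by
    have := ENNReal.Tendsto.mul_const (ENNReal.Tendsto.pow (n := T + 1) hlim) (Or.inr hfin)
    simpa using this
  refine le_of_tendsto' h1 fun m => ?_
  refine le_trans ?_ (resolvent_diag_le hp hw hwf hw0 (hs m).1.ne' (hs m).2 o)
  rw [pow_succ', mul_assoc, Finset.mul_sum]
  refine mul_le_mul_right (le_trans (Finset.sum_le_sum fun n hn => ?_) (ENNReal.sum_le_tsum
    (Finset.range T))) _
  exact mul_le_mul_left (pow_le_pow_right_of_le_one' (hs m).2.le (Finset.mem_range.1 hn).le) _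

/-- If the walk spends a finite time on the negative half-line, and if each time it leaves this
half-line it has a probability at least `C⁻¹` of landing at `0`, then it visits `0`. -/
lemma one_le_mul_green (hp : ∀ i, ∑' j, p i j = 1) {i : ℤ} (hi : i < 0)
    (hfin : ∑' j, (if j < 0 then green p i j else 0) ≠ ⊤) {C : ℝ≥0∞}
    (hC : ∀ j < 0, ∑' k, (if k < 0 then 0 else p j k) ≤ C * p j 0) :
    1 ≤ C * green p i 0 := by
  -- The probability of being on the negative half-line at time `T`.
  set a : ℕ → ℝ≥0∞ := fun T => ∑' j, if j < 0 then stepPow p T i j else 0 with ha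
  have hstep : ∀ T, a T ≤ C * stepPow p (T + 1) i 0 + a (T + 1) := by
    intro T
    -- The mass at a negative site either leaves the half-line, which costs at most `C` times the
    -- probability of jumping to `0`, or stays in it.
    have h1 : ∀ j, (if j < 0 then stepPow p T i j else 0) ≤ C * (stepPow p T i j * p j 0) +
        ∑' k, stepPow p T i j * (p j k * if k < 0 then 1 else 0) := by
      intro j
      split_ifs with hj
      · calc stepPow p T i j = stepPow p T i j * ∑' k, p j k := by rw [hp, mul_one]
          _ = stepPow p T i j * (∑' k, (if k < 0 then 0 else p j k) +
              ∑' k, p j k * if k < 0 then 1 else 0) := by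
            rw [← ENNReal.tsum_add]
            congr 2
            funext k
            split_ifs <;> simp
          _ ≤ stepPow p T i j * (C * p j 0 + ∑' k, p j k * if k < 0 then 1 else 0) := by
            gcongr; exact hC j hj
          _ = _ := by rw [mul_add, ENNReal.tsum_mul_left]; ring
      · exact zero_le
    calc a T ≤ ∑' j, (C * (stepPow p T i j * p j 0) +
        ∑' k, stepPow p T i j * (p j k * if k < 0 then 1 else 0)) := ENNReal.tsum_le_tsum h1
      _ = _ := by
        rw [ENNReal.tsum_add, ENNReal.tsum_mul_left, ← stepPow_succ', ENNReal.tsum_comm]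
        congr 1
        refine tsum_congr fun k => ?_
        simp only [← mul_assoc]
        rw [ENNReal.tsum_mul_right, ← stepPow_succ']
        split_ifs <;> simp
  have hsum : ∀ T, 1 ≤ C * ∑ t ∈ Finset.range T, stepPow p (t + 1) i 0 + a T := by
    intro T
    induction T with
    | zero =>
      simp only [Finset.range_zero, Finset.sum_empty, mul_zero, zero_add, ha, stepPow]
      rw [tsum_eq_single i fun j hj => by simp [hj.symm]]
      simp [hi]
    | succ T ih =>
      refine ih.trans ?_
      rw [Finset.sum_range_succ, mul_add, add_assoc]
      gcongr
      exact hstep T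
  have hle : ∀ T, 1 ≤ C * green p i 0 + a T := fun T => by
    refine (hsum T).trans ?_
    gcongr
    exact (ENNReal.sum_le_tsum _).trans (ENNReal.tsum_comp_le_tsum_of_injective
      Nat.succ_injective fun n => stepPow p n i 0)
  -- The sum of `a` over all times is the expected time spent on the half-line, assumed finite.
  have ha0 : Tendsto a atTop (𝓝 0) := by
    refine ENNReal.tendsto_atTop_zero_of_tsum_ne_top ?_
    rw [ENNReal.tsum_comm]
    convert hfin using 3 with j
    split_ifs <;> simp [green]
  simpa using ge_of_tendsto' (ha0.const_add (C * green p i 0)) hle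

end Network

end Mott

namespace Mott

/-! ### Estimates on the jump rates -/

section Rates

open scoped ENNReal

/-- The standing assumptions on the parameters: `0 < λ < 1`, the function `u` is symmetric and
bounded by `C`, and `d` is a positive lower bound for the interpoint distances. -/
structure Admissible (lam : ℝ) (u : ℝ → ℝ → ℝ) (d C : ℝ) : Prop where
  lam_pos : 0 < lam
  lam_lt_one : lam < 1
  d_pos : 0 < d
  abs_u_le : ∀ a b, |u a b| ≤ C
  symm : ∀ a b, u a b = u b a

variable {lam d C : ℝ} {u : ℝ → ℝ → ℝ} {ω : Env}

lemma mul_sub_le_pos_sub (hω : ∀ k, d ≤ gap ω k) {i j : ℤ} (hij : i ≤ j) :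
    d * ((j : ℝ) - i) ≤ pos ω j - pos ω i := by
  induction j, hij using Int.leInduction with
  | base => simp
  | succ j hj ih =>
    rw [pos_succ]
    push_cast
    linarith [hω j]

lemma mul_abs_le_abs_pos_sub (hω : ∀ k, d ≤ gap ω k) (i j : ℤ) :
    d * |(j : ℝ) - i| ≤ |pos ω i - pos ω j| := by
  rcases le_total i j with h | h
  · have h1 := mul_sub_le_pos_sub hω h
    have h2 : (0 : ℝ) ≤ j - i := by exact_mod_cast sub_nonneg.2 h
    rw [abs_of_nonneg h2, abs_sub_comm]
    exact h1.trans (le_abs_self _)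
  · have h1 := mul_sub_le_pos_sub hω h
    have h2 : (0 : ℝ) ≤ i - j := by exact_mod_cast sub_nonneg.2 h
    rw [abs_sub_comm, abs_of_nonneg h2]
    exact h1.trans (le_abs_self _)

lemma exp_neg_mul_abs_intCast (a : ℝ) (m : ℤ) :
    Real.exp (-(a * |(m : ℝ)|)) = Real.exp (-a) ^ m.natAbs := by
  rw [← Real.exp_nat_mul, Nat.cast_natAbs, Int.cast_abs]
  congr 1; ring

lemma summable_pow_natAbs {q : ℝ} (h0 : 0 ≤ q) (h1 : q < 1) :
    Summable fun m : ℤ => q ^ m.natAbs := by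
  refine Summable.of_nat_of_neg ?_ ?_ <;>
    simpa using summable_geometric_of_lt_one h0 h1

lemma summable_exp_neg_mul_abs {a : ℝ} (ha : 0 < a) :
    Summable fun m : ℤ => Real.exp (-(a * |(m : ℝ)|)) := by
  simp only [exp_neg_mul_abs_intCast]
  exact summable_pow_natAbs (Real.exp_pos _).le (Real.exp_lt_one_iff.2 (by linarith))

namespace Admissible

lemma rate_le (h : Admissible lam u d C) (ω : Env) (i j : ℤ) :
    rate lam u ω i j ≤ Real.exp C * Real.exp (-((1 - lam) * |pos ω i - pos ω j|)) := by
  unfold rate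
  split_ifs
  · positivity
  · rw [← Real.exp_add]
    refine Real.exp_le_exp.2 ?_
    have h1 := (abs_le.1 (h.abs_u_le (mark ω i) (mark ω j))).1
    have h2 : lam * (pos ω j - pos ω i) ≤ lam * |pos ω i - pos ω j| :=
      mul_le_mul_of_nonneg_left (by rw [abs_sub_comm]; exact le_abs_self _) h.lam_pos.le
    linarith

lemma rate_le_exp (h : Admissible lam u d C) (hω : ∀ k, d ≤ gap ω k) (i j : ℤ) :
    rate lam u ω i j ≤ Real.exp C * Real.exp (-((1 - lam) * d * |(j : ℝ) - i|)) := by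
  refine (h.rate_le ω i j).trans (mul_le_mul_of_nonneg_left (Real.exp_le_exp.2 ?_)
    (Real.exp_pos _).le)
  have := mul_le_mul_of_nonneg_left (mul_abs_le_abs_pos_sub hω i j)
    (sub_nonneg.2 h.lam_lt_one.le)
  linarith

lemma decay_pos (h : Admissible lam u d C) : 0 < (1 - lam) * d :=
  mul_pos (sub_pos.2 h.lam_lt_one) h.d_pos

lemma summable_exp_sub (h : Admissible lam u d C) (i : ℤ) :
    Summable fun j : ℤ => Real.exp (-((1 - lam) * d * |(j : ℝ) - i|)) := by
  have := (Equiv.subRight i).summable_iff.2 (summable_exp_neg_mul_abs h.decay_pos)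
  simpa [Function.comp_def] using this

lemma tsum_exp_sub (i : ℤ) :
    ∑' j : ℤ, Real.exp (-((1 - lam) * d * |(j : ℝ) - i|)) =
      ∑' j : ℤ, Real.exp (-((1 - lam) * d * |(j : ℝ)|)) := by
  rw [← (Equiv.subRight i).tsum_eq fun j : ℤ => Real.exp (-((1 - lam) * d * |(j : ℝ)|))]
  simp

lemma summable_rate (h : Admissible lam u d C) (hω : ∀ k, d ≤ gap ω k) (i : ℤ) :
    Summable (rate lam u ω i) :=
  Summable.of_nonneg_of_le (rate_nonneg lam u ω i) (h.rate_le_exp hω i)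
    ((h.summable_exp_sub i).mul_left _)

lemma rate_le_totalRate (h : Admissible lam u d C) (hω : ∀ k, d ≤ gap ω k) (i j : ℤ) :
    rate lam u ω i j ≤ totalRate lam u ω i :=
  (h.summable_rate hω i).le_tsum j fun k _ => rate_nonneg lam u ω i k

lemma totalRate_pos (h : Admissible lam u d C) (hω : ∀ k, d ≤ gap ω k) (i : ℤ) :
    0 < totalRate lam u ω i := by
  refine lt_of_lt_of_le ?_ (h.rate_le_totalRate hω i (i + 1))
  simp only [rate, left_eq_add, one_ne_zero, if_false]
  positivity

lemma totalRate_le (h : Admissible lam u d C) (hω : ∀ k, d ≤ gap ω k) (i : ℤ) :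
    totalRate lam u ω i ≤
      Real.exp C * ∑' j : ℤ, Real.exp (-((1 - lam) * d * |(j : ℝ)|)) := by
  rw [← tsum_exp_sub i, ← tsum_mul_left]
  exact (h.summable_rate hω i).tsum_le_tsum (h.rate_le_exp hω i)
    ((h.summable_exp_sub i).mul_left _)

lemma jumpProb_nonneg (lam : ℝ) (u : ℝ → ℝ → ℝ) (ω : Env) (i j : ℤ) :
    0 ≤ jumpProb lam u ω i j :=
  div_nonneg (rate_nonneg lam u ω i j) (tsum_nonneg fun k => rate_nonneg lam u ω i k)

/-- The jump probabilities decay exponentially, uniformly in the environment. -/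
lemma jumpProb_le (h : Admissible lam u d C) (hω : ∀ k, d ≤ gap ω k) (i j : ℤ) :
    jumpProb lam u ω i j ≤ Real.exp (2 * C + (1 - lam) * d) *
      Real.exp (-((1 - lam) * d * |(j : ℝ) - i|)) := by
  rcases eq_or_ne i j with rfl | hij
  · simp only [jumpProb, rate, if_true, zero_div]; positivity
  rw [jumpProb, div_le_iff₀ (h.totalRate_pos hω i), ← Real.exp_add]
  have hu := fun a b => abs_le.1 (h.abs_u_le a b)
  have hl1 := h.lam_lt_one
  have hl0 := h.lam_pos
  have hd := h.d_pos
  -- The total rate has no uniform lower bound, as gaps may be long. It is compared with the rate to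
  -- the neighbour in the direction of the jump, so that the first gap is shared and cancels in
  -- part. The remaining `|j - i| - 1` gaps give the decay; the missing one explains `(1 - lam) * d`
  -- in the constant.
  rcases lt_or_gt_of_ne hij with hlt | hlt
  · refine le_trans ?_ (mul_le_mul_of_nonneg_left (h.rate_le_totalRate hω i (i + 1))
      (Real.exp_pos _).le)
    rw [rate, rate, if_neg hij, if_neg (by omega), ← Real.exp_add]
    refine Real.exp_le_exp.2 ?_
    have h1 := mul_sub_le_pos_sub hω (show i + 1 ≤ j by omega)
    have h2 := mul_sub_le_pos_sub hω (show i ≤ i + 1 by omega)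
    have h3 : (i : ℝ) + 1 ≤ j := by exact_mod_cast hlt
    push_cast at h1 h2
    rw [abs_of_nonneg (by linarith : (0 : ℝ) ≤ j - i),
      abs_of_nonpos (by nlinarith : pos ω i - pos ω j ≤ 0),
      abs_of_nonpos (by nlinarith : pos ω i - pos ω (i + 1) ≤ 0)]
    have h4 := mul_le_mul_of_nonneg_left h1 (sub_nonneg.2 hl1.le)
    have h5 := (hu (mark ω i) (mark ω j)).1
    have h6 := (hu (mark ω i) (mark ω (i + 1))).2
    linarith
  · refine le_trans ?_ (mul_le_mul_of_nonneg_left (h.rate_le_totalRate hω i (i - 1))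
      (Real.exp_pos _).le)
    rw [rate, rate, if_neg hij, if_neg (by omega), ← Real.exp_add]
    refine Real.exp_le_exp.2 ?_
    have h1 := mul_sub_le_pos_sub hω (show j ≤ i - 1 by omega)
    have h2 := mul_sub_le_pos_sub hω (show i - 1 ≤ i by omega)
    have h3 : (j : ℝ) + 1 ≤ i := by exact_mod_cast hlt
    push_cast at h1 h2
    have h0 : 0 ≤ d * ((i : ℝ) - 1 - j) := mul_nonneg hd.le (by linarith)
    rw [abs_of_nonpos (by linarith : (j : ℝ) - i ≤ 0),
      abs_of_nonneg (by linarith : 0 ≤ pos ω i - pos ω j),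
      abs_of_nonneg (by linarith : 0 ≤ pos ω i - pos ω (i - 1))]
    have h4 := mul_le_mul_of_nonneg_left h1 (by linarith : 0 ≤ 1 + lam)
    have h7 := mul_le_mul_of_nonneg_right (by linarith : 1 - lam ≤ 1 + lam) h0
    have h5 := (hu (mark ω i) (mark ω j)).1
    have h6 := (hu (mark ω i) (mark ω (i - 1))).2
    linarith

/-- Reversibility of the rates with respect to the weights `e^{2 λ x_i}`. -/
lemma rate_reversible (h : Admissible lam u d C) (ω : Env) (i j : ℤ) :
    Real.exp (2 * lam * pos ω i) * rate lam u ω i j =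
      Real.exp (2 * lam * pos ω j) * rate lam u ω j i := by
  rcases eq_or_ne i j with rfl | hij
  · rfl
  rw [rate, rate, if_neg hij, if_neg hij.symm, ← Real.exp_add, ← Real.exp_add, h.symm (mark ω i),
    abs_sub_comm]
  congr 1; ring

/-- A jump from the negative half-line to the right of `0` is not much more likely than a jump to
`0`. -/
lemma jumpProb_le_mul_jumpProb_zero (h : Admissible lam u d C) (hω : ∀ k, d ≤ gap ω k) {j k : ℤ}
    (hj : j < 0) (hk : 0 ≤ k) :
    jumpProb lam u ω j k ≤
      Real.exp (2 * C) * Real.exp (-((1 - lam) * d * |(k : ℝ)|)) * jumpProb lam u ω j 0 := by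
  rw [jumpProb, jumpProb, ← mul_div_assoc]
  refine div_le_div_of_nonneg_right ?_ (h.totalRate_pos hω j).le
  rw [rate, rate, if_neg (by omega), if_neg (by omega), ← Real.exp_add, ← Real.exp_add]
  refine Real.exp_le_exp.2 ?_
  have h1 := mul_sub_le_pos_sub hω hk
  have h2 := mul_sub_le_pos_sub hω hj.le
  have hk' : (0 : ℝ) ≤ k := by exact_mod_cast hk
  have hj' : (j : ℝ) ≤ 0 := by exact_mod_cast hj.le
  rw [pos_zero] at *
  push_cast at h1 h2
  have h0 := mul_nonneg h.d_pos.le hk'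
  have h3 : 0 ≤ d * (0 - (j : ℝ)) := mul_nonneg h.d_pos.le (by linarith)
  rw [abs_of_nonneg hk', abs_of_nonpos (by linarith : pos ω j - pos ω k ≤ 0),
    abs_of_nonpos (by linarith : pos ω j - 0 ≤ 0)]
  have h4 := mul_le_mul_of_nonneg_left h1 (sub_nonneg.2 h.lam_lt_one.le)
  have h5 := (abs_le.1 (h.abs_u_le (mark ω j) (mark ω k))).1
  have h6 := (abs_le.1 (h.abs_u_le (mark ω j) (mark ω 0))).2
  linarith

/-- Half of the exponential decay in the distance absorbs the linear factor. -/
lemma abs_pos_mul_rate_le (h : Admissible lam u d C) (hω : ∀ k, d ≤ gap ω k) (k : ℤ) :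
    |pos ω k| * rate lam u ω 0 k ≤
      Real.exp C * (2 / (1 - lam)) * Real.exp (-((1 - lam) * d / 2 * |(k : ℝ)|)) := by
  have ha : 0 < 1 - lam := sub_pos.2 h.lam_lt_one
  have h1 := h.rate_le ω 0 k
  have h2 := mul_abs_le_abs_pos_sub hω 0 k
  rw [pos_zero, zero_sub, abs_neg] at h1 h2
  rw [Int.cast_zero, sub_zero] at h2
  set t := |pos ω k|
  have ht : 0 ≤ t := abs_nonneg _
  have h3 : t ≤ 2 / (1 - lam) * Real.exp ((1 - lam) * t / 2) := by
    have := Real.add_one_le_exp ((1 - lam) * t / 2)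
    rw [div_mul_eq_mul_div, le_div_iff₀ ha]
    linarith
  calc t * rate lam u ω 0 k
      ≤ (2 / (1 - lam) * Real.exp ((1 - lam) * t / 2)) *
        (Real.exp C * Real.exp (-((1 - lam) * t))) :=
        mul_le_mul h3 h1 (rate_nonneg _ _ _ _ _) (by positivity)
    _ = Real.exp C * (2 / (1 - lam)) * Real.exp (-((1 - lam) * t / 2)) := by
        rw [show -((1 - lam) * t / 2) = (1 - lam) * t / 2 + -((1 - lam) * t) by ring, Real.exp_add]
        ring
    _ ≤ _ := by
        refine mul_le_mul_of_nonneg_left (Real.exp_le_exp.2 ?_) (by positivity)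
        have := mul_le_mul_of_nonneg_left h2 ha.le
        linarith

end Admissible

/-! ### Bounds on the Green function of the walk -/

/-- The jump probabilities with values in `[0, ∞]`. -/
noncomputable def jumpMat (lam : ℝ) (u : ℝ → ℝ → ℝ) (ω : Env) (i j : ℤ) : ℝ≥0∞ :=
  ENNReal.ofReal (jumpProb lam u ω i j)

/-- The reversible measure `e^{2 λ x_i} ∑_k r_{x_i, x_k}` of the walk. -/
noncomputable def weight (lam : ℝ) (u : ℝ → ℝ → ℝ) (ω : Env) (i : ℤ) : ℝ≥0∞ :=
  ENNReal.ofReal (Real.exp (2 * lam * pos ω i) * totalRate lam u ω i)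

/-- A bound for the resistance of the half-line `[0, ∞)`. -/
noncomputable def resistance (lam d C : ℝ) (ω : Env) : ℝ≥0∞ :=
  ∑' k : ℕ, ENNReal.ofReal (Real.exp (C - 2 * lam * d * k) * Real.exp ((1 - lam) * gap ω k))

lemma jumpMat_shift (k i j : ℤ) :
    jumpMat lam u (shift k ω) i j = jumpMat lam u ω (i + k) (j + k) := by
  unfold jumpMat; rw [jumpProb_shift]

lemma gap_shift (ω : Env) (k j : ℤ) : gap (shift k ω) j = gap ω (j + k) := rfl

namespace Admissible

lemma tsum_jumpMat (h : Admissible lam u d C) (hω : ∀ k, d ≤ gap ω k) (i : ℤ) :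
    ∑' j, jumpMat lam u ω i j = 1 := tsum_jumpProb (h.summable_rate hω i)

lemma weight_ne_top (ω : Env) (i : ℤ) : weight lam u ω i ≠ ⊤ := ENNReal.ofReal_ne_top

lemma weight_ne_zero (h : Admissible lam u d C) (hω : ∀ k, d ≤ gap ω k) (i : ℤ) :
    weight lam u ω i ≠ 0 := by
  have := h.totalRate_pos hω i
  exact (ENNReal.ofReal_pos.2 (by positivity)).ne'

lemma weight_mul_jumpMat (h : Admissible lam u d C) (hω : ∀ k, d ≤ gap ω k) (i j : ℤ) :
    weight lam u ω i * jumpMat lam u ω i j =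
      ENNReal.ofReal (Real.exp (2 * lam * pos ω i) * rate lam u ω i j) := by
  have := h.totalRate_pos hω i
  rw [weight, jumpMat, ← ENNReal.ofReal_mul (by positivity), jumpProb]
  congr 1
  field_simp

lemma weight_reversible (h : Admissible lam u d C) (hω : ∀ k, d ≤ gap ω k) (i j : ℤ) :
    weight lam u ω i * jumpMat lam u ω i j = weight lam u ω j * jumpMat lam u ω j i := by
  rw [h.weight_mul_jumpMat hω, h.weight_mul_jumpMat hω, h.rate_reversible]

/-- The edge from `k` to `k + 1` has conductance `exp (2 λ x_k - (1 - λ) Z_k - u)`. The inequality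
`x_k ≥ d k` turns the drift into geometric decay, and the factor `exp ((1 - λ) Z_k)` is the one with
finite mean. -/
lemma tsum_inv_conductance_le (h : Admissible lam u d C) (hω : ∀ k, d ≤ gap ω k) :
    ∑' k : ℕ, (weight lam u ω ((0 : ℤ) + k) * jumpMat lam u ω ((0 : ℤ) + k) ((0 : ℤ) + k + 1))⁻¹ ≤
      resistance lam d C ω := by
  refine ENNReal.tsum_le_tsum fun k => ?_
  have hr : 0 < rate lam u ω k (k + 1) := by
    rw [rate, if_neg (by omega)]; positivity
  rw [h.weight_mul_jumpMat hω, zero_add, ← ENNReal.ofReal_inv_of_pos (by positivity)]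
  refine ENNReal.ofReal_le_ofReal ?_
  rw [rate, if_neg (by omega), ← Real.exp_add, ← Real.exp_neg, ← Real.exp_add]
  refine Real.exp_le_exp.2 ?_
  have h1 := mul_sub_le_pos_sub hω (show (0 : ℤ) ≤ k by omega)
  have h2 := hω k
  have h3 := h.d_pos
  rw [pos_zero] at h1
  push_cast at h1
  rw [pos_succ, abs_of_nonpos (by linarith)]
  have h5 := (abs_le.1 (h.abs_u_le (mark ω k) (mark ω (k + 1)))).2
  have h4 := mul_le_mul_of_nonneg_left h1 h.lam_pos.le
  linarith

/-- The maximum principle followed by the resistance bound. The weight at the origin is just the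
total rate, since `x_0 = 0`, and the bound does not depend on the starting point. -/
lemma green_zero_le (h : Admissible lam u d C) (hω : ∀ k, d ≤ gap ω k) (i : ℤ) :
    green (jumpMat lam u ω) i 0 ≤
      2 * ENNReal.ofReal (totalRate lam u ω 0) * resistance lam d C ω := by
  refine (green_le_diag (h.tsum_jumpMat hω) i 0).trans
    ((green_diag_le (h.tsum_jumpMat hω) (h.weight_reversible hω) (weight_ne_top ω)
      (h.weight_ne_zero hω) 0).trans ?_)
  have hw : weight lam u ω 0 = ENNReal.ofReal (totalRate lam u ω 0) := by
    simp [weight, pos_zero]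
  rw [hw]
  gcongr
  exact h.tsum_inv_conductance_le hω

lemma weight_le (h : Admissible lam u d C) (hω : ∀ k, d ≤ gap ω k) {j : ℤ} (hj : j < 0) :
    weight lam u ω j ≤ ENNReal.ofReal
      ((Real.exp C * ∑' j : ℤ, Real.exp (-((1 - lam) * d * |(j : ℝ)|))) *
        Real.exp (-(2 * lam * d * |(j : ℝ)|))) := by
  refine ENNReal.ofReal_le_ofReal ?_
  rw [mul_comm]
  refine mul_le_mul (h.totalRate_le hω j) (Real.exp_le_exp.2 ?_) (Real.exp_pos _).le (by positivity)
  have h1 := mul_sub_le_pos_sub hω hj.le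
  have hj' : (j : ℝ) ≤ 0 := by exact_mod_cast hj.le
  rw [pos_zero] at h1
  push_cast at h1
  rw [abs_of_nonpos hj']
  have h4 := mul_le_mul_of_nonneg_left h1 h.lam_pos.le
  linarith

/-- By reversibility and the maximum principle, `G(i,j) = w_j G(j,i) / w_i ≤ w_j G(i,i) / w_i`, and
`w_j` decays geometrically to the left. -/
lemma tsum_green_neg_ne_top (h : Admissible lam u d C) (hω : ∀ k, d ≤ gap ω k) {i : ℤ}
    (hfin : green (jumpMat lam u ω) i i ≠ ⊤) :
    ∑' j, (if j < 0 then green (jumpMat lam u ω) i j else 0) ≠ ⊤ := by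
  set B := Real.exp C * ∑' j : ℤ, Real.exp (-((1 - lam) * d * |(j : ℝ)|))
  have hB : 0 ≤ B := by positivity
  have hle : ∀ j : ℤ, (if j < 0 then green (jumpMat lam u ω) i j else 0) ≤
      (ENNReal.ofReal (B * Real.exp (-(2 * lam * d * |(j : ℝ)|)))) *
        (green (jumpMat lam u ω) i i * (weight lam u ω i)⁻¹) := by
    intro j
    split_ifs with hj
    · have h1 := green_reversible (h.weight_reversible hω) i j
      have h2 : green (jumpMat lam u ω) i j =
          weight lam u ω j * green (jumpMat lam u ω) j i * (weight lam u ω i)⁻¹ := by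
        rw [← h1, mul_comm, ← mul_assoc,
          ENNReal.inv_mul_cancel (h.weight_ne_zero hω i) (weight_ne_top ω i), one_mul]
      rw [h2, mul_assoc]
      exact mul_le_mul' (h.weight_le hω hj) (mul_le_mul_left (green_le_diag (h.tsum_jumpMat hω) j i) _)
    · exact zero_le
  refine ne_top_of_le_ne_top ?_ (ENNReal.tsum_le_tsum hle)
  rw [ENNReal.tsum_mul_right]
  refine ENNReal.mul_ne_top ?_ (ENNReal.mul_ne_top hfin
    (ENNReal.inv_ne_top.2 (h.weight_ne_zero hω i)))
  have := h.lam_pos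
  have := h.d_pos
  exact ((summable_exp_neg_mul_abs (by positivity : 0 < 2 * lam * d)).mul_left B).tsum_ofReal_ne_top

/-- The Green function at `0` of walks started on the negative half-line is bounded from below. -/
lemma one_le_mul_green_zero (h : Admissible lam u d C) (hω : ∀ k, d ≤ gap ω k) {i : ℤ}
    (hi : i < 0) (hfin : green (jumpMat lam u ω) i i ≠ ⊤) :
    1 ≤ ENNReal.ofReal
      (Real.exp (2 * C) * ∑' k : ℤ, Real.exp (-((1 - lam) * d * |(k : ℝ)|))) *
        green (jumpMat lam u ω) i 0 := by
  refine one_le_mul_green (h.tsum_jumpMat hω) hi (h.tsum_green_neg_ne_top hω hfin) fun j hj => ?_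
  have hs := (summable_exp_neg_mul_abs h.decay_pos).mul_left (Real.exp (2 * C))
  rw [← tsum_mul_left, ENNReal.ofReal_tsum_of_nonneg (fun k => by positivity) hs,
    ← ENNReal.tsum_mul_right]
  refine ENNReal.tsum_le_tsum fun k => ?_
  split_ifs with hk
  · exact zero_le
  · rw [jumpMat, jumpMat, ← ENNReal.ofReal_mul (by positivity)]
    exact ENNReal.ofReal_le_ofReal (h.jumpProb_le_mul_jumpProb_zero hω hj (not_lt.1 hk))

end Admissible

end Rates

end Mott

namespace Mott

/-! ### Setwise limits of dominated measures -/

section SetwiseLimit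

open scoped ENNReal Function

variable {α : Type*} [MeasurableSpace α]

/-- A sequence of measures dominated by a finite measure converges setwise to a measure along some
ultrafilter. -/
lemma exists_setwise_limit {μ : Measure α} [IsFiniteMeasure μ] {ν : ℕ → Measure α}
    (hν : ∀ n, ν n ≤ μ) :
    ∃ (F : Ultrafilter ℕ) (Q : Measure α), (F : Filter ℕ) ≤ atTop ∧
      ∀ A, MeasurableSet A → Tendsto (fun n => ν n A) F (𝓝 (Q A)) := by
  set F : Ultrafilter ℕ := Ultrafilter.of atTop
  have hlim : ∀ A : Set α, Tendsto (fun n => ν n A) F (𝓝 ((F.map fun n => ν n A).lim)) :=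
    fun A => (F.map fun n => ν n A).le_nhds_lim
  have hfin : ∀ n A, ν n A ≠ ⊤ := fun n A => ne_top_of_le_ne_top (measure_ne_top μ A) (hν n A)
  refine ⟨F, Measure.ofMeasurable (fun A _ => (F.map fun n => ν n A).lim) ?_ ?_,
    Ultrafilter.of_le _, fun A hA => ?_⟩
  · refine tendsto_nhds_unique (hlim ∅) ?_
    simp
  · intro A hA hdisj
    have hsum : Summable fun i => (μ (A i)).toReal := by
      refine ENNReal.summable_toReal ?_
      rw [← measure_iUnion hdisj hA]
      exact measure_ne_top _ _
    have hle : ∀ i, (F.map fun n => ν n (A i)).lim ≤ μ (A i) := fun i =>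
      le_of_tendsto' (hlim (A i)) fun n => hν n _
    have hlf : ∀ i, (F.map fun n => ν n (A i)).lim ≠ ⊤ := fun i =>
      ne_top_of_le_ne_top (measure_ne_top _ _) (hle i)
    -- Dominated convergence for series, with bound `μ (A i)`, gives countable additivity of the
    -- limit.
    have hT : Tendsto (fun n => ∑' i, (ν n (A i)).toReal) F
        (𝓝 (∑' i, ((F.map fun n => ν n (A i)).lim).toReal)) := by
      refine tendsto_tsum_of_dominated_convergence hsum (fun i => ?_)
        (Eventually.of_forall fun n i => ?_)
      · exact (ENNReal.tendsto_toReal (hlf i)).comp (hlim (A i))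
      · rw [Real.norm_of_nonneg ENNReal.toReal_nonneg]
        exact ENNReal.toReal_mono (measure_ne_top _ _) (hν n _)
    have hT' := ENNReal.tendsto_ofReal hT
    have hsl : Summable fun i => ((F.map fun n => ν n (A i)).lim).toReal :=
      Summable.of_nonneg_of_le (fun _ => ENNReal.toReal_nonneg)
        (fun i => ENNReal.toReal_mono (measure_ne_top _ _) (hle i)) hsum
    rw [ENNReal.ofReal_tsum_of_nonneg (fun _ => ENNReal.toReal_nonneg) hsl] at hT'
    simp only [ENNReal.ofReal_toReal (hlf _)] at hT'
    refine tendsto_nhds_unique (hlim _) (hT'.congr fun n => ?_)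
    rw [measure_iUnion hdisj hA, ← ENNReal.tsum_toReal_eq fun i => hfin n _, ENNReal.ofReal_toReal]
    rw [← measure_iUnion hdisj hA]
    exact hfin n _
  · rw [Measure.ofMeasurable_apply A hA]
    exact hlim A

/-- Setwise convergence passes to integrals of simple functions, which approximate `f` from below.
No continuity of `f` is required. -/
lemma lintegral_le_of_setwise_limit {F : Filter ℕ} [F.NeBot] {Q : Measure α} {ν : ℕ → Measure α}
    (h : ∀ A, MeasurableSet A → Tendsto (fun n => ν n A) F (𝓝 (Q A))) {f : α → ℝ≥0∞}
    (hf : Measurable f) {b : ℕ → ℝ≥0∞} {B : ℝ≥0∞} (hb : Tendsto b F (𝓝 B))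
    (hle : ∀ n, ∫⁻ x, f x ∂ν n ≤ b n) : ∫⁻ x, f x ∂Q ≤ B := by
  rw [lintegral_eq_iSup_eapprox_lintegral hf]
  refine iSup_le fun k => ?_
  have hT : Tendsto (fun n => (SimpleFunc.eapprox f k).lintegral (ν n)) F
      (𝓝 ((SimpleFunc.eapprox f k).lintegral Q)) := by
    refine tendsto_finsetSum _ fun x hx => ?_
    obtain ⟨y, rfl⟩ := SimpleFunc.mem_range.1 hx
    exact ENNReal.Tendsto.const_mul (h _ (SimpleFunc.measurableSet_preimage _ _))
      (Or.inr (SimpleFunc.eapprox_lt_top f k y).ne)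
  exact le_of_tendsto_of_tendsto' hT hb fun n =>
    (lintegral_eapprox_le_lintegral hf k).trans (hle n)

end SetwiseLimit

/-! ### The invariant distribution -/

section Invariant

open scoped ENNReal

lemma shift_shift (k l : ℤ) (ω : Env) : shift k (shift l ω) = shift (k + l) ω := by
  funext j; simp only [shift]; congr 1; ring

lemma shift_zero (ω : Env) : shift 0 ω = ω := by funext j; simp [shift]

variable {P : Measure Env}

lemma measurePreserving_shift (h : MeasurePreserving (shift 1) P P) (k : ℤ) :
    MeasurePreserving (shift k) P P := by
  have hnat : ∀ n : ℕ, P.map (shift n) = P := by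
    intro n
    induction n with
    | zero =>
      have : (shift ((0 : ℕ) : ℤ)) = id := by funext ω; simp [shift_zero]
      rw [this, Measure.map_id]
    | succ n ih =>
      conv_rhs => rw [← ih, ← h.map_eq, Measure.map_map (measurable_shift _) (measurable_shift _)]
      congr 1
      funext ω
      simp [shift_shift]
  refine ⟨measurable_shift k, ?_⟩
  rcases Int.eq_nat_or_neg k with ⟨n, rfl | rfl⟩
  · exact hnat n
  · conv_lhs => rw [← hnat n, Measure.map_map (measurable_shift _) (measurable_shift _)]
    have : shift (-(n : ℤ)) ∘ shift n = id := by
      funext ω; simp [shift_shift, shift_zero]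
    rw [this, Measure.map_id]

lemma ae_forall_shift (h : MeasurePreserving (shift 1) P P) {p : Env → Prop}
    (hp : ∀ᵐ ω ∂P, p ω) : ∀ᵐ ω ∂P, ∀ k, p (shift k ω) :=
  ae_all_iff.2 fun k => (measurePreserving_shift h k).quasiMeasurePreserving.ae hp

lemma ae_le_gap (h : MeasurePreserving (shift 1) P P) {d : ℝ} (hd : ∀ᵐ ω ∂P, d ≤ gap ω 0) :
    ∀ᵐ ω ∂P, ∀ k, d ≤ gap ω k := by
  filter_upwards [ae_forall_shift h hd] with ω hω k
  simpa [gap_shift] using hω k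

@[fun_prop]
lemma measurable_gap (k : ℤ) : Measurable fun ω : Env => gap ω k := by unfold gap; fun_prop

variable {lam d C : ℝ} {u : ℝ → ℝ → ℝ}

lemma measurable_resistance : Measurable (resistance lam d C) :=
  Measurable.tsum fun k => by fun_prop

lemma measurable_jumpMat (lam : ℝ) (hu : Measurable (Function.uncurry u)) (i j : ℤ) :
    Measurable fun ω => jumpMat lam u ω i j :=
  ((measurable_rate lam hu i j).div (measurable_totalRate lam hu i)).ennreal_ofReal

lemma measurable_stepPow (lam : ℝ) (hu : Measurable (Function.uncurry u)) (n : ℕ) (i j : ℤ) :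
    Measurable fun ω => stepPow (jumpMat lam u ω) n i j := by
  induction n generalizing i with
  | zero => exact measurable_const
  | succ n ih => exact Measurable.tsum fun k => (measurable_jumpMat lam hu i k).mul (ih k)

lemma measurable_green (lam : ℝ) (hu : Measurable (Function.uncurry u)) (i j : ℤ) :
    Measurable fun ω => green (jumpMat lam u ω) i j :=
  Measurable.tsum fun n => measurable_stepPow lam hu n i j

lemma green_shift (k i j : ℤ) (ω : Env) :
    green (jumpMat lam u (shift k ω)) i j = green (jumpMat lam u ω) (i + k) (j + k) :=
  green_translate (fun i j => jumpMat_shift k i j) i j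

lemma totalRate_shift (k i : ℤ) (ω : Env) :
    totalRate lam u (shift k ω) i = totalRate lam u ω (i + k) := by
  unfold totalRate
  simp only [rate_shift]
  exact (Equiv.addRight k).tsum_eq fun m => rate lam u ω (i + k) m

namespace Admissible

/-- By stationarity every gap contributes the same exponential moment, multiplied by a term of a
geometric series of ratio `exp (-2 λ d)`. -/
lemma lintegral_resistance_ne_top (h : Admissible lam u d C)
    (hP : MeasurePreserving (shift 1) P P)
    (hexp : Integrable (fun ω => Real.exp ((1 - lam) * gap ω 0)) P) :
    ∫⁻ ω, resistance lam d C ω ∂P ≠ ⊤ := by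
  unfold resistance
  rw [lintegral_tsum fun k => by fun_prop]
  have hk : ∀ k : ℕ, ∫⁻ ω, ENNReal.ofReal (Real.exp (C - 2 * lam * d * k) *
      Real.exp ((1 - lam) * gap ω k)) ∂P =
      ENNReal.ofReal (Real.exp (C - 2 * lam * d * k)) *
        ∫⁻ ω, ENNReal.ofReal (Real.exp ((1 - lam) * gap ω 0)) ∂P := by
    intro k
    simp only [ENNReal.ofReal_mul (Real.exp_pos _).le]
    rw [lintegral_const_mul _ (by fun_prop)]
    congr 1
    have e := (measurePreserving_shift hP k).lintegral_comp
      (f := fun ω => ENNReal.ofReal (Real.exp ((1 - lam) * gap ω 0))) (by fun_prop)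
    simpa [gap_shift] using e
  simp only [hk]
  rw [ENNReal.tsum_mul_right]
  refine ENNReal.mul_ne_top ?_ ?_
  · have hpos : 0 < 2 * lam * d := by
      have := h.lam_pos; have := h.d_pos; positivity
    have : Summable fun k : ℕ => Real.exp (C - 2 * lam * d * k) := by
      have := (summable_geometric_of_lt_one (Real.exp_pos (-(2 * lam * d))).le
        (Real.exp_lt_one_iff.2 (by linarith))).mul_left (Real.exp C)
      refine this.congr fun k => ?_
      rw [← Real.exp_nat_mul, ← Real.exp_add]
      congr 1; ring
    exact this.tsum_ofReal_ne_top
  · have := hexp.lintegral_lt_top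
    exact this.ne

lemma ae_green_ne_top (h : Admissible lam u d C) (hP : MeasurePreserving (shift 1) P P)
    (hd : ∀ᵐ ω ∂P, d ≤ gap ω 0)
    (hexp : Integrable (fun ω => Real.exp ((1 - lam) * gap ω 0)) P) :
    ∀ᵐ ω ∂P, ∀ i, green (jumpMat lam u ω) i i ≠ ⊤ := by
  have h1 := ae_lt_top measurable_resistance (h.lintegral_resistance_ne_top hP hexp)
  filter_upwards [ae_forall_shift hP h1, ae_le_gap hP hd] with ω hω hg i
  have h2 := h.green_zero_le (ω := shift i ω) (fun k => by rw [gap_shift]; exact hg _) 0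
  rw [green_shift, zero_add] at h2
  exact ne_top_of_le_ne_top (ENNReal.mul_ne_top (ENNReal.mul_ne_top (by simp)
    ENNReal.ofReal_ne_top) (hω i).ne) h2

lemma envKernel_apply (h : Admissible lam u d C) (hu : Continuous (Function.uncurry u))
    {ω : Env} (hω : ∀ k, d ≤ gap ω k) {A : Set Env} (hA : MeasurableSet A) :
    envKernel lam u hu ω A = ∑' k, jumpMat lam u ω 0 k * A.indicator 1 (shift k ω) := by
  change ((stepLaw lam u ω 0).map fun k => shift k ω) A = _
  rw [Measure.map_apply measurable_from_top hA, stepLaw, if_pos (h.summable_rate hω 0),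
    Measure.sum_apply _ (MeasurableSet.of_discrete)]
  simp [jumpMat, Set.indicator]
  rfl

lemma lintegral_envKernel (h : Admissible lam u d C) (hu : Continuous (Function.uncurry u))
    {ω : Env} (hω : ∀ k, d ≤ gap ω k) {f : Env → ℝ≥0∞} (hf : Measurable f) :
    ∫⁻ ω', f ω' ∂envKernel lam u hu ω = ∑' k, jumpMat lam u ω 0 k * f (shift k ω) := by
  change ∫⁻ ω', f ω' ∂((stepLaw lam u ω 0).map fun k => shift k ω) = _
  rw [lintegral_map hf measurable_from_top, stepLaw, if_pos (h.summable_rate hω 0),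
    lintegral_sum_measure]
  simp [lintegral_smul_measure, jumpMat]

end Admissible

/-! ### Averaged occupation measures and their limit -/

/-- The density, with respect to the law of the environment, of the averaged occupation measure
of the first `N + 1` sites by the environment viewed from the walker. -/
noncomputable def occupation (lam : ℝ) (u : ℝ → ℝ → ℝ) (N : ℕ) (ω : Env) : ℝ≥0∞ :=
  ((N : ℝ≥0∞) + 1)⁻¹ * ∑ n ∈ Finset.Icc (1 : ℤ) (N + 1), green (jumpMat lam u ω) (-n) 0

lemma measurable_occupation (lam : ℝ) (hu : Measurable (Function.uncurry u)) (N : ℕ) :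
    Measurable (occupation lam u N) :=
  (Finset.measurable_fun_sum _ fun n _ => measurable_green lam hu (-n) 0).const_mul _

lemma inv_mul_sum_Icc_const (N : ℕ) (x : ℝ≥0∞) :
    ((N : ℝ≥0∞) + 1)⁻¹ * ∑ _n ∈ Finset.Icc (1 : ℤ) (N + 1), x = x := by
  rw [Finset.sum_const, Int.card_Icc, nsmul_eq_mul, ← mul_assoc]
  have : ((((N : ℤ) + 1 + 1 - 1).toNat : ℕ) : ℝ≥0∞) = (N : ℝ≥0∞) + 1 := by
    rw [add_sub_cancel_right, show (N : ℤ) + 1 = ((N + 1 : ℕ) : ℤ) by push_cast; rfl,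
      Int.toNat_natCast]
    push_cast; rfl
  rw [this, ENNReal.inv_mul_cancel (by simp) (by simp), one_mul]

/-- Seen from the landing point, a jump from the origin to `k` by a walk started at `-n` is a jump
from `-k` to the origin by a walk started at `-(n + k)`. -/
lemma lintegral_shift_term (hu : Continuous (Function.uncurry u))
    (hP : MeasurePreserving (shift 1) P P) {A : Set Env} (hA : MeasurableSet A) (n k : ℤ) :
    ∫⁻ ω, green (jumpMat lam u ω) (-n) 0 * (jumpMat lam u ω 0 k * A.indicator 1 (shift k ω)) ∂P =
      ∫⁻ ω, green (jumpMat lam u ω) (-(n + k)) (-k) * jumpMat lam u ω (-k) 0 *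
        A.indicator 1 ω ∂P := by
  rw [← (measurePreserving_shift hP (-k)).lintegral_comp]
  · refine lintegral_congr fun ω => ?_
    rw [green_shift, jumpMat_shift, shift_shift]
    simp only [add_neg_cancel, shift_zero, zero_add, mul_assoc]
    rw [neg_add]
  · exact (measurable_green lam hu.measurable _ _).mul
      ((measurable_jumpMat lam hu.measurable _ _).mul
        ((measurable_one.indicator hA).comp (measurable_shift k)))

lemma card_filter_Icc_add_notMem (M k : ℤ) :
    ((Finset.Icc 1 M).filter fun n => n + k ∉ Finset.Icc 1 M).card ≤ k.natAbs := by
  rcases le_total 0 k with hk | hk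
  · refine (Finset.card_le_card (t := Finset.Icc (M - k + 1) M) fun n hn => ?_).trans ?_
    · simp only [Finset.mem_filter, Finset.mem_Icc] at hn ⊢; omega
    · rw [Int.card_Icc]; omega
  · refine (Finset.card_le_card (t := Finset.Icc 1 (-k)) fun n hn => ?_).trans ?_
    · simp only [Finset.mem_filter, Finset.mem_Icc] at hn ⊢; omega
    · rw [Int.card_Icc]; omega

lemma summable_natAbs_mul_exp {a : ℝ} (ha : 0 < a) :
    Summable fun m : ℤ => (m.natAbs : ℝ) * Real.exp (-(a * |(m : ℝ)|)) := by
  refine Summable.of_nonneg_of_le (fun m => by positivity) (fun m => ?_)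
    ((summable_exp_neg_mul_abs (half_pos ha)).mul_left (2 / a))
  rw [Nat.cast_natAbs, Int.cast_abs]
  set t := |(m : ℝ)|
  have h3 : t ≤ 2 / a * Real.exp (a / 2 * t) := by
    have := Real.add_one_le_exp (a / 2 * t)
    rw [div_mul_eq_mul_div, le_div_iff₀ ha]
    linarith
  calc t * Real.exp (-(a * t)) ≤ 2 / a * Real.exp (a / 2 * t) * Real.exp (-(a * t)) :=
        mul_le_mul_of_nonneg_right h3 (Real.exp_pos _).le
    _ = _ := by rw [mul_assoc, ← Real.exp_add]; congr 2; ring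

namespace Admissible

/-- The averaged occupation measures are asymptotically invariant. -/
lemma lintegral_occupation_mul_le (h : Admissible lam u d C)
    (hu : Continuous (Function.uncurry u)) (hP : MeasurePreserving (shift 1) P P)
    (hd : ∀ᵐ ω ∂P, d ≤ gap ω 0) {B : ℝ≥0∞}
    (hB : ∀ i, ∫⁻ ω, green (jumpMat lam u ω) i 0 ∂P ≤ B) {A : Set Env} (hA : MeasurableSet A)
    (N : ℕ) :
    ∫⁻ ω, occupation lam u N ω * envKernel lam u hu ω A ∂P ≤
      ∫⁻ ω in A, occupation lam u N ω ∂P +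
        ((N : ℝ≥0∞) + 1)⁻¹ * (B * ∑' k : ℤ, ENNReal.ofReal
          ((Real.exp (2 * C + (1 - lam) * d)) *
            ((k.natAbs : ℝ) * Real.exp (-((1 - lam) * d * |(k : ℝ)|))))) := by
  classical
  set I := Finset.Icc (1 : ℤ) (N + 1) with hI
  set t : ℤ → ℤ → ℝ≥0∞ := fun n k => ∫⁻ ω, green (jumpMat lam u ω) (-n) 0 *
    (jumpMat lam u ω 0 k * A.indicator 1 (shift k ω)) ∂P with ht
  have hgm := fun i j => measurable_green lam hu.measurable i j
  have hjm := fun i j => measurable_jumpMat lam hu.measurable i j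
  have hAm : ∀ k, Measurable fun ω => A.indicator (1 : Env → ℝ≥0∞) (shift k ω) := fun k =>
    (measurable_one.indicator hA).comp (measurable_shift k)
  have hgap := ae_le_gap hP hd
  have hL : ∫⁻ ω, occupation lam u N ω * envKernel lam u hu ω A ∂P =
      ((N : ℝ≥0∞) + 1)⁻¹ * ∑ n ∈ I, ∑' k, t n k := by
    have e : ∀ n, ∑' k, t n k = ∫⁻ ω, green (jumpMat lam u ω) (-n) 0 *
        ∑' k, jumpMat lam u ω 0 k * A.indicator 1 (shift k ω) ∂P := by
      intro n
      simp only [← ENNReal.tsum_mul_left]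
      exact (lintegral_tsum fun k => ((hgm _ _).mul ((hjm _ _).mul (hAm k))).aemeasurable).symm
    simp only [e]
    have hKm : Measurable fun ω => ∑' k, jumpMat lam u ω 0 k *
        A.indicator (1 : Env → ℝ≥0∞) (shift k ω) :=
      Measurable.tsum fun k => (hjm _ _).mul (hAm k)
    have hm : ∀ n, Measurable fun ω => green (jumpMat lam u ω) (-n) 0 *
        ∑' k, jumpMat lam u ω 0 k * A.indicator (1 : Env → ℝ≥0∞) (shift k ω) := fun n =>
      (hgm _ _).mul hKm
    rw [← lintegral_finsetSum _ fun n _ => hm n,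
      ← lintegral_const_mul _ (Finset.measurable_fun_sum _ fun n _ => hm n)]
    refine lintegral_congr_ae ?_
    filter_upwards [hgap] with ω hω
    rw [h.envKernel_apply hu hω hA, occupation, mul_assoc, Finset.sum_mul]
  have hR : ∫⁻ ω in A, occupation lam u N ω ∂P = ((N : ℝ≥0∞) + 1)⁻¹ *
      ∑ n ∈ I, ∫⁻ ω, green (jumpMat lam u ω) (-n) 0 * A.indicator 1 ω ∂P := by
    have hm : ∀ n, Measurable fun ω => green (jumpMat lam u ω) (-n) 0 *
        A.indicator (1 : Env → ℝ≥0∞) ω := fun n => (hgm _ _).mul (measurable_one.indicator hA)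
    rw [← lintegral_finsetSum _ fun n _ => hm n,
      ← lintegral_const_mul _ (Finset.measurable_fun_sum _ fun n _ => hm n),
      ← lintegral_indicator hA]
    refine lintegral_congr fun ω => ?_
    by_cases hω : ω ∈ A <;> simp [hω, occupation, hI]
  rw [hL, hR, ← mul_add]
  refine mul_le_mul_right ?_ _
  rw [← Summable.tsum_finsetSum fun _ _ => ENNReal.summable]
  -- A jump by `k` carries level `n` to level `n + k`. If that level is still in the window, the
  -- term is compared with the occupation there; otherwise it is an error, and at most `|k|` levels
  -- are concerned.
  have hsplit : ∀ k, ∑ n ∈ I, t n k =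
      ∑ n ∈ I with n + k ∈ I, t n k + ∑ n ∈ I with n + k ∉ I, t n k := fun k =>
    (Finset.sum_filter_add_sum_filter_not I _ _).symm
  simp only [hsplit]
  rw [ENNReal.tsum_add]
  refine add_le_add ?_ ?_
  · have h1 : ∀ k, ∑ n ∈ I with n + k ∈ I, t n k ≤ ∑ a ∈ I, ∫⁻ ω,
        green (jumpMat lam u ω) (-a) (-k) * jumpMat lam u ω (-k) 0 * A.indicator 1 ω ∂P := by
      intro k
      simp only [ht, lintegral_shift_term hu hP hA]
      rw [← Finset.sum_image (f := fun a => ∫⁻ ω, green (jumpMat lam u ω) (-a) (-k) *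
        jumpMat lam u ω (-k) 0 * A.indicator 1 ω ∂P) (g := fun n => n + k)
        (fun a _ b _ hab => by simpa using hab)]
      refine Finset.sum_le_sum_of_subset fun a ha => ?_
      obtain ⟨n, hn, rfl⟩ := Finset.mem_image.1 ha
      exact (Finset.mem_filter.1 hn).2
    refine (ENNReal.tsum_le_tsum h1).trans ?_
    rw [Summable.tsum_finsetSum fun _ _ => ENNReal.summable]
    refine Finset.sum_le_sum fun a _ => ?_
    have hm : ∀ k, Measurable fun ω => green (jumpMat lam u ω) (-a) (-k) *
        jumpMat lam u ω (-k) 0 * A.indicator (1 : Env → ℝ≥0∞) ω := fun k =>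
      ((hgm _ _).mul (hjm _ _)).mul (measurable_one.indicator hA)
    rw [← lintegral_tsum fun k => (hm k).aemeasurable]
    refine lintegral_mono fun ω => ?_
    simp only
    rw [ENNReal.tsum_mul_right]
    -- Summing over all jumps into a fixed level gives `G p ≤ G`, one copy of the Green function.
    refine mul_le_mul_left ?_ _
    refine le_trans (le_of_eq ?_) (tsum_green_mul_le (-a) 0)
    exact (Equiv.neg ℤ).tsum_eq fun k => green (jumpMat lam u ω) (-a) k * jumpMat lam u ω k 0
  · rw [← ENNReal.tsum_mul_left]
    refine ENNReal.tsum_le_tsum fun k => ?_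
    have h2 : ∀ n, t n k ≤ B * ENNReal.ofReal (Real.exp (2 * C + (1 - lam) * d) *
        Real.exp (-((1 - lam) * d * |(k : ℝ)|))) := by
      intro n
      rw [ht]
      refine le_trans (lintegral_mono_ae (g := fun ω => green (jumpMat lam u ω) (-n) 0 *
        ENNReal.ofReal (Real.exp (2 * C + (1 - lam) * d) *
        Real.exp (-((1 - lam) * d * |(k : ℝ)|)))) ?_) ?_
      · filter_upwards [hgap] with ω hω
        refine mul_le_mul_right ?_ _
        refine (mul_le_of_le_one_right'
          (by by_cases hz : shift k ω ∈ A <;> simp [hz])).trans ?_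
        have := h.jumpProb_le hω 0 k
        rw [Int.cast_zero, sub_zero] at this
        exact ENNReal.ofReal_le_ofReal this
      · rw [lintegral_mul_const _ (hgm _ _)]
        exact mul_le_mul_left (hB _) _
    refine (Finset.sum_le_sum fun n _ => h2 n).trans ?_
    rw [Finset.sum_const, nsmul_eq_mul, mul_left_comm]
    refine mul_le_mul_right ?_ _
    rw [mul_left_comm (Real.exp _), ENNReal.ofReal_mul (Nat.cast_nonneg k.natAbs),
      ENNReal.ofReal_natCast]
    refine mul_le_mul_left ?_ _
    exact_mod_cast card_filter_Icc_add_notMem _ k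

/-- The environment viewed from the walker has an invariant distribution which is equivalent to
the law of the environment, with a density that is controlled by the resistance. -/
theorem exists_invariant [IsProbabilityMeasure P] (h : Admissible lam u d C)
    (hu : Continuous (Function.uncurry u))
    (hP : MeasurePreserving (shift 1) P P) (hd : ∀ᵐ ω ∂P, d ≤ gap ω 0)
    (hexp : Integrable (fun ω => Real.exp ((1 - lam) * gap ω 0)) P) :
    ∃ Q : Measure Env, IsProbabilityMeasure Q ∧ Q.bind (envKernel lam u hu) = Q ∧ P ≪ Q ∧
      ∃ c : ℝ≥0∞, c ≠ ⊤ ∧ Q ≤ c • P.withDensity fun ω =>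
        ENNReal.ofReal (totalRate lam u ω 0) * resistance lam d C ω := by
  set K := envKernel lam u hu
  have hgap := ae_le_gap hP hd
  set T := Real.exp C * ∑' j : ℤ, Real.exp (-((1 - lam) * d * |(j : ℝ)|)) with hT
  set f : Env → ℝ≥0∞ := fun ω => ENNReal.ofReal (totalRate lam u ω 0) * resistance lam d C ω
    with hf
  have hfm : Measurable f :=
    (measurable_totalRate lam hu.measurable 0).ennreal_ofReal.mul measurable_resistance
  have hR := h.lintegral_resistance_ne_top hP hexp
  have hffin : ∫⁻ ω, 2 * f ω ∂P ≠ ⊤ := by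
    refine ne_top_of_le_ne_top (b := ∫⁻ ω, 2 * ENNReal.ofReal T * resistance lam d C ω ∂P) ?_
      (lintegral_mono_ae ?_)
    · rw [lintegral_const_mul _ measurable_resistance]
      exact ENNReal.mul_ne_top (ENNReal.mul_ne_top (by simp) ENNReal.ofReal_ne_top) hR
    · filter_upwards [hgap] with ω hω
      rw [hf, ← mul_assoc]
      gcongr
      exact h.totalRate_le hω 0
  have hgle : ∀ᵐ ω ∂P, ∀ i, green (jumpMat lam u ω) i 0 ≤ 2 * f ω := by
    filter_upwards [hgap] with ω hω i
    rw [hf, ← mul_assoc]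
    exact h.green_zero_le hω i
  have hole : ∀ N, ∀ᵐ ω ∂P, occupation lam u N ω ≤ 2 * f ω := by
    intro N
    filter_upwards [hgle] with ω hω
    rw [← inv_mul_sum_Icc_const N (2 * f ω)]
    exact mul_le_mul_right (Finset.sum_le_sum fun n _ => hω _) _
  set c₀ := ENNReal.ofReal
    (Real.exp (2 * C) * ∑' k : ℤ, Real.exp (-((1 - lam) * d * |(k : ℝ)|))) with hc₀
  -- The lower bound on the Green function survives the averages and the limit, and yields `P ≪ Q`.
  have hlow : ∀ N, ∀ᵐ ω ∂P, 1 ≤ c₀ * occupation lam u N ω := by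
    intro N
    filter_upwards [hgap, h.ae_green_ne_top hP hd hexp] with ω hω hfin
    rw [occupation, mul_left_comm, Finset.mul_sum]
    nth_rewrite 1 [← inv_mul_sum_Icc_const N 1]
    refine mul_le_mul_right (Finset.sum_le_sum fun n hn => ?_) _
    exact h.one_le_mul_green_zero hω (by have := (Finset.mem_Icc.1 hn).1; omega) (hfin _)
  set μ := P.withDensity fun ω => 2 * f ω with hμ
  have hμfin : IsFiniteMeasure μ := isFiniteMeasure_withDensity hffin
  set ν : ℕ → Measure Env := fun N => P.withDensity (occupation lam u N) with hν
  have hνμ : ∀ N, ν N ≤ μ := fun N => withDensity_mono (hole N)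
  obtain ⟨F, Q, hF, hQ⟩ := exists_setwise_limit hνμ
  have hQμ : Q ≤ μ := Measure.le_iff.2 fun A hA => le_of_tendsto' (hQ A hA) fun N => hνμ N A
  have hQfin : IsFiniteMeasure Q := ⟨lt_of_le_of_lt (hQμ _) (measure_lt_top μ _)⟩
  have hPQ : ∀ A, MeasurableSet A → P A ≤ c₀ * Q A := by
    intro A hA
    refine ge_of_tendsto' (ENNReal.Tendsto.const_mul (hQ A hA) (Or.inr ENNReal.ofReal_ne_top))
      fun N => ?_
    rw [hν, withDensity_apply _ hA,
      ← lintegral_const_mul _ (measurable_occupation lam hu.measurable N), ← setLIntegral_one]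
    exact lintegral_mono_ae (ae_restrict_of_ae (hlow N))
  have hQ0 : Q Set.univ ≠ 0 := fun h0 => by
    have := hPQ Set.univ MeasurableSet.univ
    rw [h0, mul_zero, measure_univ] at this
    exact absurd this (by simp)
  set D := (∫⁻ ω, 2 * f ω ∂P) * ∑' k : ℤ, ENNReal.ofReal
    ((Real.exp (2 * C + (1 - lam) * d)) *
      ((k.natAbs : ℝ) * Real.exp (-((1 - lam) * d * |(k : ℝ)|)))) with hD
  have hDfin : D ≠ ⊤ := ENNReal.mul_ne_top hffin
    ((summable_natAbs_mul_exp h.decay_pos).mul_left _).tsum_ofReal_ne_top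
  -- The boundary error is a fixed finite constant over `N + 1`, so only an inequality between
  -- measures remains; `hinv` upgrades it to equality by comparing total masses.
  have hbind : Q.bind K ≤ Q := by
    refine Measure.le_iff.2 fun A hA => ?_
    rw [Measure.bind_apply hA K.aemeasurable]
    have hlim : Tendsto (fun N : ℕ => ν N A + ((N : ℝ≥0∞) + 1)⁻¹ * D) F (𝓝 (Q A + 0 * D)) := by
      refine (hQ A hA).add (ENNReal.Tendsto.mul_const ?_ (Or.inr hDfin))
      have h1 : Tendsto (fun N : ℕ => ((N : ℝ≥0∞) + 1)⁻¹) atTop (𝓝 0) := by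
        have := (tendsto_add_atTop_iff_nat 1).2 ENNReal.tendsto_inv_nat_nhds_zero
        simpa using this
      exact h1.mono_left hF
    rw [zero_mul, add_zero] at hlim
    refine lintegral_le_of_setwise_limit hQ (K.measurable_coe hA) hlim fun N => ?_
    rw [hν, lintegral_withDensity_eq_lintegral_mul _ (measurable_occupation lam hu.measurable N)
      (K.measurable_coe hA), withDensity_apply _ hA]
    exact h.lintegral_occupation_mul_le hu hP hd
      (fun i => lintegral_mono_ae (hgle.mono fun ω hω => hω i)) hA N
  have hinv : Q.bind K = Q := by
    have : IsFiniteMeasure (Q.bind K) := ⟨lt_of_le_of_lt (hbind _) (measure_lt_top Q _)⟩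
    refine Measure.eq_of_le_of_measure_univ_eq hbind ?_
    rw [Measure.bind_apply MeasurableSet.univ K.aemeasurable]
    simp
  have hinvtop : (Q Set.univ)⁻¹ ≠ ⊤ := ENNReal.inv_ne_top.2 hQ0
  refine ⟨(Q Set.univ)⁻¹ • Q, ⟨?_⟩, ?_, ?_, (Q Set.univ)⁻¹ * 2,
    ENNReal.mul_ne_top hinvtop (by simp), ?_⟩
  · rw [Measure.smul_apply, smul_eq_mul, ENNReal.inv_mul_cancel hQ0 (measure_ne_top _ _)]
  · rw [Measure.comp_smul, hinv]
  · refine Measure.AbsolutelyContinuous.mk fun A hA h0 => ?_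
    rw [Measure.smul_apply, smul_eq_mul, mul_eq_zero, ENNReal.inv_eq_zero] at h0
    have h1 : Q A = 0 := h0.resolve_left (measure_ne_top _ _)
    have := hPQ A hA
    rwa [h1, mul_zero, nonpos_iff_eq_zero] at this
  · refine Measure.le_iff.2 fun A hA => ?_
    rw [Measure.smul_apply, Measure.smul_apply, smul_eq_mul, smul_eq_mul, mul_assoc]
    refine mul_le_mul_right ((hQμ A).trans (le_of_eq ?_)) _
    rw [hμ, withDensity_apply _ hA, withDensity_apply _ hA, lintegral_const_mul _ hfm]

end Admissible

end Invariant

end Mott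

namespace Mott

/-! ### Inversion of the clock process -/

section Clock

/-- If the jump times grow linearly and the positions at the jump times have a linear growth rate,
then so does the position as a function of time. -/
lemma tendsto_clock_inversion {T X : ℕ → ℝ} (hmono : Monotone T) (h0 : T 0 = 0) {m v : ℝ}
    (hm : 0 < m) (hT : Tendsto (fun n : ℕ => T n / n) atTop (𝓝 m))
    (hX : Tendsto (fun n : ℕ => X n / n) atTop (𝓝 v)) :
    Tendsto (fun t : ℝ => X (sSup {n : ℕ | T n ≤ t}) / t) atTop (𝓝 (v / m)) := by
  set N : ℝ → ℕ := fun t => sSup {n : ℕ | T n ≤ t} with hN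
  have hTtop : Tendsto T atTop atTop := by
    have := hT.pos_mul_atTop hm tendsto_natCast_atTop_atTop
    refine this.congr' ?_
    filter_upwards [eventually_gt_atTop 0] with n hn
    have : (n : ℝ) ≠ 0 := by exact_mod_cast hn.ne'
    field_simp
  have hbdd : ∀ t, BddAbove {n : ℕ | T n ≤ t} := fun t => by
    obtain ⟨b, hb⟩ := (hTtop.eventually_gt_atTop t).exists
    exact ⟨b, fun n hn => le_of_not_gt fun h => absurd (hmono h.le) (not_le.2 (hn.trans_lt hb))⟩
  -- The set of jumps before `t` contains `0` and is bounded, so its supremum is attained and is not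
  -- the default value.
  have hmem : ∀ t, 0 ≤ t → T (N t) ≤ t := fun t ht =>
    Nat.sSup_mem ⟨0, by simpa [h0] using ht⟩ (hbdd t)
  have hlt : ∀ t, t < T (N t + 1) := fun t => by
    by_contra hcon
    have : N t + 1 ≤ N t := le_csSup (hbdd t) (not_lt.1 hcon)
    omega
  have hNtop : Tendsto N atTop atTop := by
    refine tendsto_atTop.2 fun b => ?_
    filter_upwards [eventually_ge_atTop (T b)] with t ht
    exact le_csSup (hbdd t) ht
  have hlow : Tendsto (fun t => T (N t) / N t) atTop (𝓝 m) := hT.comp hNtop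
  have hup : Tendsto (fun t => T (N t + 1) / N t) atTop (𝓝 m) := by
    have h1 : Tendsto (fun n : ℕ => T (n + 1) / ((n + 1 : ℕ) : ℝ) * (((n + 1 : ℕ) : ℝ) / n)) atTop
        (𝓝 (m * 1)) := by
      refine ((tendsto_add_atTop_iff_nat 1).2 hT).mul ?_
      have : Tendsto (fun n : ℕ => 1 + 1 / (n : ℝ)) atTop (𝓝 (1 + 0)) :=
        tendsto_const_nhds.add tendsto_one_div_atTop_nhds_zero_nat
      rw [add_zero] at this
      refine this.congr' ?_
      filter_upwards [eventually_gt_atTop 0] with n hn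
      have : (n : ℝ) ≠ 0 := by exact_mod_cast hn.ne'
      push_cast; field_simp
    rw [mul_one] at h1
    refine (h1.comp hNtop).congr fun t => ?_
    have : ((N t + 1 : ℕ) : ℝ) ≠ 0 := by positivity
    simp only [Function.comp]
    field_simp
  have hNt : Tendsto (fun t => t / N t) atTop (𝓝 m) := by
    refine tendsto_of_tendsto_of_tendsto_of_le_of_le' hlow hup ?_ ?_
    · filter_upwards [eventually_ge_atTop 0] with t ht
      exact div_le_div_of_nonneg_right (hmem t ht) (Nat.cast_nonneg _)
    · exact Eventually.of_forall fun t =>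
        div_le_div_of_nonneg_right (hlt t).le (Nat.cast_nonneg _)
  refine ((hX.comp hNtop).div hNt hm.ne').congr' ?_
  filter_upwards [hNtop.eventually_gt_atTop 0] with t ht
  have : (N t : ℝ) ≠ 0 := by exact_mod_cast ht.ne'
  simp only [Function.comp, Pi.div_apply]
  rw [div_div_div_cancel_right₀ this]

end Clock

/-! ### The mean of the exponential distribution -/

section Exponential

instance : IsProbabilityMeasure (expMeasure 1) := isProbabilityMeasure_expMeasure one_pos

/-- The mean of the exponential law becomes the Gamma integral at `2`. -/
lemma exponentialPDFReal_one_mul (x : ℝ) :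
    exponentialPDFReal 1 x * x =
      (Set.Ioi (0 : ℝ)).indicator (fun x => Real.exp (-x) * x ^ ((2 : ℝ) - 1)) x := by
  rcases lt_trichotomy 0 x with h | rfl | h
  · rw [Set.indicator_of_mem (Set.mem_Ioi.2 h)]
    norm_num [exponentialPDFReal, gammaPDFReal, h.le]
  · simp
  · rw [Set.indicator_of_notMem (by simpa using h.le)]
    simp [exponentialPDFReal, gammaPDFReal, not_le.2 h]

lemma expMeasure_one_eq : expMeasure 1 =
    volume.withDensity fun x => ENNReal.ofReal (exponentialPDFReal 1 x) := rfl

lemma integrable_id_expMeasure : Integrable (fun x : ℝ => x) (expMeasure 1) := by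
  rw [expMeasure_one_eq, integrable_withDensity_iff_integrable_smul'
    (measurable_exponentialPDFReal 1).ennreal_ofReal (Eventually.of_forall fun _ => by simp)]
  simp only [ENNReal.toReal_ofReal (exponentialPDFReal_nonneg one_pos _), smul_eq_mul,
    exponentialPDFReal_one_mul]
  exact (Real.GammaIntegral_convergent (by norm_num)).integrable_indicator measurableSet_Ioi

lemma integral_id_expMeasure : ∫ x, x ∂expMeasure 1 = 1 := by
  rw [expMeasure_one_eq, integral_withDensity_eq_integral_toReal_smul
    (measurable_exponentialPDFReal 1).ennreal_ofReal (Eventually.of_forall fun _ => by simp)]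
  simp only [ENNReal.toReal_ofReal (exponentialPDFReal_nonneg one_pos _), smul_eq_mul,
    exponentialPDFReal_one_mul]
  rw [integral_indicator measurableSet_Ioi, ← Real.Gamma_eq_integral (by norm_num),
    Real.Gamma_two]

lemma ae_nonneg_expMeasure : ∀ᵐ x ∂expMeasure 1, 0 ≤ x := by
  rw [expMeasure_one_eq, ae_withDensity_iff (measurable_exponentialPDFReal 1).ennreal_ofReal]
  refine Eventually.of_forall fun x hx => ?_
  by_contra h
  refine hx ?_
  simp [exponentialPDFReal, gammaPDFReal, h]

end Exponential

/-! ### The size of a jump as a function of the environments before and after the jump -/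

section JumpSize

open scoped ENNReal Classical

/-- The displacement `x_k` of the walker when the environment jumps from `ω` to `τ_{x_k} ω`. -/
noncomputable def jumpSize (z : Env × Env) : ℝ :=
  (∑' k, if z.2 = shift k z.1 then ENNReal.ofReal (pos z.1 k) else 0).toReal -
    (∑' k, if z.2 = shift k z.1 then ENNReal.ofReal (-pos z.1 k) else 0).toReal

lemma measurableSet_eq_shift (k : ℤ) : MeasurableSet {z : Env × Env | z.2 = shift k z.1} := by
  have : {z : Env × Env | z.2 = shift k z.1} = ⋂ j, {z | z.2 j = shift k z.1 j} := by
    ext z; simp [funext_iff]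
  rw [this]
  refine MeasurableSet.iInter fun j => ?_
  unfold shift
  exact measurableSet_eq_fun (by fun_prop) (by fun_prop)

lemma measurable_jumpSize : Measurable jumpSize := by
  refine Measurable.sub ?_ ?_ <;> refine (Measurable.tsum fun k => ?_).ennreal_toReal
  · exact Measurable.ite (measurableSet_eq_shift k)
      ((measurable_pos k).comp measurable_fst).ennreal_ofReal measurable_const
  · exact Measurable.ite (measurableSet_eq_shift k)
      ((measurable_pos k).comp measurable_fst).neg.ennreal_ofReal measurable_const

lemma shift_injective {ω : Env} (hω : ∀ l : ℤ, l ≠ 0 → ω ≠ shift l ω) :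
    Function.Injective fun k => shift k ω := by
  intro k l hkl
  by_contra hne
  refine hω (l - k) (sub_ne_zero.2 (Ne.symm hne)) ?_
  have := congrArg (shift (-k)) hkl
  simp only [shift_shift, neg_add_cancel, shift_zero] at this
  rwa [neg_add_eq_sub] at this

/-- Aperiodicity leaves exactly one term in each sum. Hence the environment chain determines the
displacements, and the position of the walk is an additive functional of that chain. -/
lemma jumpSize_shift {ω : Env} (hω : ∀ l : ℤ, l ≠ 0 → ω ≠ shift l ω) (k l : ℤ) :
    jumpSize (shift k ω, shift l ω) = pos ω l - pos ω k := by
  have hiff : ∀ j, shift l ω = shift j (shift k ω) ↔ j = l - k := fun j => by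
    rw [shift_shift, (shift_injective hω).eq_iff]; omega
  have hp : pos (shift k ω) (l - k) = pos ω l - pos ω k := by rw [pos_shift, sub_add_cancel]
  simp only [jumpSize, hiff, tsum_ite_eq, hp]
  rcases le_total 0 (pos ω l - pos ω k) with h | h
  · rw [ENNReal.toReal_ofReal h, ENNReal.ofReal_of_nonpos (neg_nonpos.2 h)]; simp
  · rw [ENNReal.toReal_ofReal (neg_nonneg.2 h), ENNReal.ofReal_of_nonpos h]; simp

end JumpSize

/-! ### Integrability of the drift and of the holding times -/

section Drift

open scoped ENNReal

variable {lam d C : ℝ} {u : ℝ → ℝ → ℝ} {ω : Env} {P : Measure Env}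

namespace Admissible

lemma summable_abs_pos_mul_rate (h : Admissible lam u d C) (hω : ∀ k, d ≤ gap ω k) :
    Summable fun k => |pos ω k| * rate lam u ω 0 k :=
  Summable.of_nonneg_of_le (fun _ => mul_nonneg (abs_nonneg _) (rate_nonneg _ _ _ _ _))
    (h.abs_pos_mul_rate_le hω)
    ((summable_exp_neg_mul_abs (half_pos h.decay_pos)).mul_left _)

lemma summable_pos_mul_jumpProb (h : Admissible lam u d C) (hω : ∀ k, d ≤ gap ω k) :
    Summable fun k => pos ω k * jumpProb lam u ω 0 k := by
  refine Summable.of_norm (((h.summable_abs_pos_mul_rate hω).div_const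
    (totalRate lam u ω 0)).congr fun k => ?_)
  rw [norm_mul, Real.norm_eq_abs, Real.norm_of_nonneg (jumpProb_nonneg _ _ _ _ _), jumpProb,
    mul_div_assoc]

/-- The factor in front is the one in the density bound for `Q`. It turns jump probabilities back
into rates, whose first moment is bounded uniformly in the environment. -/
lemma tsum_jumpMat_mul_abs_pos_le (h : Admissible lam u d C) (hω : ∀ k, d ≤ gap ω k) :
    ENNReal.ofReal (totalRate lam u ω 0) * ∑' k, jumpMat lam u ω 0 k * ENNReal.ofReal |pos ω k| ≤
      ENNReal.ofReal (Real.exp C * (2 / (1 - lam)) *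
        ∑' k : ℤ, Real.exp (-((1 - lam) * d / 2 * |(k : ℝ)|))) := by
  have hT := h.totalRate_pos hω 0
  have hs := (summable_exp_neg_mul_abs (half_pos h.decay_pos)).mul_left
    (Real.exp C * (2 / (1 - lam)))
  have := sub_pos.2 h.lam_lt_one
  rw [← ENNReal.tsum_mul_left, ← tsum_mul_left,
    ENNReal.ofReal_tsum_of_nonneg (fun k => by positivity) hs]
  refine ENNReal.tsum_le_tsum fun k => ?_
  rw [jumpMat, ← ENNReal.ofReal_mul (jumpProb_nonneg _ _ _ _ _), ← ENNReal.ofReal_mul hT.le]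
  refine ENNReal.ofReal_le_ofReal (le_trans (le_of_eq ?_) (h.abs_pos_mul_rate_le hω k))
  rw [jumpProb]
  field_simp

/-- Functions whose product with the total rate is bounded are integrable with respect to measures
with a density controlled by the resistance. -/
lemma lintegral_ne_top_of_totalRate_mul_le (h : Admissible lam u d C)
    (hu : Measurable (Function.uncurry u)) (hP : MeasurePreserving (shift 1) P P)
    (hexp : Integrable (fun ω => Real.exp ((1 - lam) * gap ω 0)) P) {Q : Measure Env} {c : ℝ≥0∞}
    (hc : c ≠ ⊤) (hQ : Q ≤ c • P.withDensity fun ω =>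
      ENNReal.ofReal (totalRate lam u ω 0) * resistance lam d C ω) {f : Env → ℝ≥0∞}
    (hf : Measurable f) {B : ℝ≥0∞} (hB : B ≠ ⊤)
    (hfB : ∀ᵐ ω ∂P, ENNReal.ofReal (totalRate lam u ω 0) * f ω ≤ B) : ∫⁻ ω, f ω ∂Q ≠ ⊤ := by
  refine ne_top_of_le_ne_top (b := c * (B * ∫⁻ ω, resistance lam d C ω ∂P)) ?_
    ((lintegral_mono' hQ le_rfl).trans ?_)
  · exact ENNReal.mul_ne_top hc
      (ENNReal.mul_ne_top hB (h.lintegral_resistance_ne_top hP hexp))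
  · have hm : Measurable fun ω => ENNReal.ofReal (totalRate lam u ω 0) * resistance lam d C ω :=
      (measurable_totalRate lam hu 0).ennreal_ofReal.mul measurable_resistance
    rw [lintegral_smul_measure, smul_eq_mul, lintegral_withDensity_eq_lintegral_mul _ hm hf,
      ← lintegral_const_mul _ measurable_resistance]
    refine mul_le_mul_right (lintegral_mono_ae ?_) _
    filter_upwards [hfB] with ω hω
    simp only [Pi.mul_apply]
    rw [mul_right_comm]
    exact mul_le_mul_left hω _

lemma integrable_one_div_totalRate (h : Admissible lam u d C)
    (hu : Measurable (Function.uncurry u)) (hP : MeasurePreserving (shift 1) P P)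
    (hgap : ∀ᵐ ω ∂P, ∀ k, d ≤ gap ω k)
    (hexp : Integrable (fun ω => Real.exp ((1 - lam) * gap ω 0)) P) {Q : Measure Env} {c : ℝ≥0∞}
    (hc : c ≠ ⊤) (hQ : Q ≤ c • P.withDensity fun ω =>
      ENNReal.ofReal (totalRate lam u ω 0) * resistance lam d C ω) :
    Integrable (fun ω => 1 / totalRate lam u ω 0) Q := by
  have hm : Measurable fun ω => 1 / totalRate lam u ω 0 :=
    measurable_const.div (measurable_totalRate lam hu 0)
  refine ⟨hm.aestronglyMeasurable, ?_⟩
  refine (h.lintegral_ne_top_of_totalRate_mul_le hu hP hexp hc hQ hm.enorm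
    ENNReal.one_ne_top ?_).lt_top
  filter_upwards [hgap] with ω hω
  have hT := h.totalRate_pos hω 0
  rw [Real.enorm_of_nonneg (by positivity), ← ENNReal.ofReal_mul hT.le, mul_one_div_cancel hT.ne']
  simp

end Admissible

end Drift

end Mott

namespace Mott

section Velocity

open scoped ENNReal

variable {lam d C : ℝ} {u : ℝ → ℝ → ℝ} {ω : Env} {P : Measure Env}

/-! ### Ergodicity of the environment viewed from the walker -/

namespace Admissible

lemma stepLaw_eq (h : Admissible lam u d C) (hω : ∀ k, d ≤ gap ω k) (i : ℤ) :
    stepLaw lam u ω i = Measure.sum fun j => jumpMat lam u ω i j • Measure.dirac j := by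
  rw [stepLaw, if_pos (h.summable_rate hω i)]; rfl

/-- Moving along a fixed environment is compatible with the environment viewed from the walker. -/
lemma envKernel_shift (h : Admissible lam u d C) (hu : Continuous (Function.uncurry u))
    (hω : ∀ k, d ≤ gap ω k) (i : ℤ) :
    envKernel lam u hu (shift i ω) = (stepLaw lam u ω i).map fun j => shift j ω := by
  ext A hA
  rw [h.envKernel_apply hu (fun k => by rw [gap_shift]; exact hω _) hA,
    Measure.map_apply measurable_from_top hA, h.stepLaw_eq hω,
    Measure.sum_apply _ MeasurableSet.of_discrete,
    ← (Equiv.addRight i).tsum_eq fun j => (jumpMat lam u ω i j • Measure.dirac j) _]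
  refine tsum_congr fun k => ?_
  rw [jumpMat_shift, shift_shift, zero_add]
  simp [Set.indicator]
  rfl

/-- Functions preserved by one step of the environment viewed from the walker are constant. -/
lemma ae_const_of_envKernel (h : Admissible lam u d C) (hu : Continuous (Function.uncurry u))
    (hP : Ergodic (shift 1) P) (hgap : ∀ᵐ ω ∂P, ∀ k, d ≤ gap ω k) {Q : Measure Env}
    [SFinite Q] (hPQ : P ≪ Q) (hQP : Q ≪ P) (f : Env → ℝ≥0∞) (hf : Measurable f)
    (hff : ∀ᵐ z ∂(Q.compProd (envKernel lam u hu)), f z.2 = f z.1) :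
    ∃ c, f =ᵐ[Q] fun _ => c := by
  -- The jump to the right neighbour has positive probability, so it cannot lead into the null event
  -- where `f` changes.
  have h1 : ∀ᵐ ω ∂P, f (shift 1 ω) = f ω := by
    filter_upwards [hPQ.ae_le (Measure.ae_ae_of_ae_compProd hff), hgap] with ω hω hg
    have hm : MeasurableSet {ω' | f ω' ≠ f ω} :=
      (measurableSet_eq_fun hf measurable_const).compl
    have h0 : envKernel lam u hu ω {ω' | f ω' ≠ f ω} = 0 := hω
    rw [h.envKernel_apply hu hg hm, ENNReal.tsum_eq_zero] at h0
    by_contra hne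
    have := h0 1
    rw [Set.indicator_of_mem (Set.mem_ofPred_eq ▸ hne), Pi.one_apply, mul_one, jumpMat,
      ENNReal.ofReal_eq_zero] at this
    refine absurd this (not_le.2 (div_pos ?_ (h.totalRate_pos hg 0)))
    rw [rate, if_neg zero_ne_one]
    exact Real.exp_pos _
  obtain ⟨c, hc⟩ := hP.quasiErgodic.ae_eq_const_of_ae_eq_comp₀ hf.nullMeasurable h1
  exact ⟨c, hQP.ae_le hc⟩

/-! ### The mean displacement -/

lemma lintegral_stepLaw (h : Admissible lam u d C) (hω : ∀ k, d ≤ gap ω k) (i : ℤ)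
    (f : ℤ → ℝ≥0∞) : ∫⁻ j, f j ∂stepLaw lam u ω i = ∑' j, jumpMat lam u ω i j * f j := by
  rw [h.stepLaw_eq hω, lintegral_sum_measure]
  simp

lemma integral_jumpSize (h : Admissible lam u d C) (hu : Continuous (Function.uncurry u))
    (hω : ∀ k, d ≤ gap ω k) (hper : ∀ l : ℤ, l ≠ 0 → ω ≠ shift l ω) :
    ∫ ω', jumpSize (ω, ω') ∂envKernel lam u hu ω = drift lam u ω := by
  have hmeas : Measurable fun ω' => jumpSize (ω, ω') := measurable_jumpSize.comp (by fun_prop)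
  have hj : ∀ k, jumpSize (ω, shift k ω) = pos ω k := fun k => by
    have := jumpSize_shift hper 0 k
    rwa [shift_zero, pos_zero, sub_zero] at this
  change ∫ ω', jumpSize (ω, ω') ∂((stepLaw lam u ω 0).map fun k => shift k ω) = _
  rw [integral_map measurable_from_top.aemeasurable hmeas.aestronglyMeasurable]
  simp only [hj]
  have hint : Integrable (fun k => pos ω k) (stepLaw lam u ω 0) := by
    refine ⟨measurable_from_top.aestronglyMeasurable, ?_⟩
    have hT := h.totalRate_pos hω 0
    have hle := h.tsum_jumpMat_mul_abs_pos_le hω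
    rw [HasFiniteIntegral, h.lintegral_stepLaw hω, lt_top_iff_ne_top]
    intro htop
    simp only [Real.enorm_eq_ofReal_abs] at htop
    rw [htop, ENNReal.mul_top (by simpa using hT)] at hle
    exact absurd hle (by simp)
  rw [integral_countable hint, drift]
  refine tsum_congr fun k => ?_
  have : stepLaw lam u ω 0 {k} = jumpMat lam u ω 0 k := by
    rw [← lintegral_indicator_one (MeasurableSet.of_discrete), h.lintegral_stepLaw hω,
      tsum_eq_single k fun j hj => by simp [hj]]
    simp
  rw [Measure.real, this, jumpMat, ENNReal.toReal_ofReal (jumpProb_nonneg _ _ _ _ _), smul_eq_mul,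
    mul_comm]

lemma integrable_jumpSize (h : Admissible lam u d C) (hu : Continuous (Function.uncurry u))
    (hP : MeasurePreserving (shift 1) P P) (hgap : ∀ᵐ ω ∂P, ∀ k, d ≤ gap ω k)
    (hper : ∀ᵐ ω ∂P, ∀ l : ℤ, l ≠ 0 → ω ≠ shift l ω)
    (hexp : Integrable (fun ω => Real.exp ((1 - lam) * gap ω 0)) P) {Q : Measure Env} [SFinite Q]
    {c : ℝ≥0∞} (hc : c ≠ ⊤) (hQ : Q ≤ c • P.withDensity fun ω =>
      ENNReal.ofReal (totalRate lam u ω 0) * resistance lam d C ω) :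
    Integrable jumpSize (Q.compProd (envKernel lam u hu)) := by
  refine ⟨measurable_jumpSize.aestronglyMeasurable, ?_⟩
  rw [HasFiniteIntegral, Measure.lintegral_compProd measurable_jumpSize.enorm]
  refine (h.lintegral_ne_top_of_totalRate_mul_le hu.measurable hP hexp hc hQ
    measurable_jumpSize.enorm.lintegral_kernel_prod_right' ENNReal.ofReal_ne_top
    (B := ENNReal.ofReal (Real.exp C * (2 / (1 - lam)) *
        ∑' k : ℤ, Real.exp (-((1 - lam) * d / 2 * |(k : ℝ)|)))) ?_).lt_top
  filter_upwards [hgap, hper] with ω hω hp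
  have hmeas : Measurable fun ω' => ‖jumpSize (ω, ω')‖ₑ :=
    measurable_jumpSize.enorm.comp (by fun_prop : Measurable fun ω' : Env => (ω, ω'))
  rw [h.lintegral_envKernel hu hω hmeas]
  refine le_trans (le_of_eq ?_) (h.tsum_jumpMat_mul_abs_pos_le hω)
  congr 2
  funext k
  have := jumpSize_shift hp 0 k
  rw [shift_zero, pos_zero, sub_zero] at this
  rw [this, Real.enorm_eq_ofReal_abs]

end Admissible

/-! ### Ergodic averages along the chain with independent exponential clocks -/

lemma timeShift_iterate {S : Type*} (k : ℕ) (w : ℕ → S) (n : ℕ) :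
    timeShift^[k] w n = w (n + k) := by
  induction k generalizing w with
  | zero => rfl
  | succ k ih => rw [Function.iterate_succ_apply, ih, timeShift]; congr 1

/-- The transition kernel of the environment viewed from the walker together with independent
exponential clocks. -/
noncomputable abbrev clockKernel (lam : ℝ) (u : ℝ → ℝ → ℝ) (hu : Continuous (Function.uncurry u)) :
    Kernel (Env × ℝ) (Env × ℝ) :=
  (envKernel lam u hu).parallelComp (Kernel.const ℝ (expMeasure 1))

/-- The ergodic averages of the displacements and of the holding times. -/
def AveragesTo (lam : ℝ) (u : ℝ → ℝ → ℝ) (v m : ℝ) (w : ℕ → Env × ℝ) : Prop :=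
  Tendsto (fun n : ℕ => (∑ k ∈ Finset.range n, jumpSize ((w k).1, (w (k + 1)).1)) / n) atTop
      (𝓝 v) ∧
    Tendsto (fun n : ℕ => (∑ k ∈ Finset.range n, (w k).2 / totalRate lam u (w k).1 0) / n) atTop
      (𝓝 m)

lemma measurable_holdingTime (hu : Measurable (Function.uncurry u)) :
    Measurable fun z : Env × ℝ => z.2 / totalRate lam u z.1 0 :=
  measurable_snd.div ((measurable_totalRate lam hu 0).comp measurable_fst)

lemma measurableSet_averagesTo (hu : Measurable (Function.uncurry u)) (v m : ℝ) :
    MeasurableSet {w | AveragesTo lam u v m w} := by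
  refine MeasurableSet.inter ?_ ?_
  · refine measurableSet_tendsto _ fun n => Measurable.div_const
      (Finset.measurable_fun_sum _ fun k _ => ?_) _
    exact measurable_jumpSize.comp (by fun_prop)
  · refine measurableSet_tendsto _ fun n => Measurable.div_const
      (Finset.measurable_fun_sum _ fun k _ => ?_) _
    exact (measurable_holdingTime hu).comp (measurable_pi_apply k)

/-- Birkhoff's theorem for the stationary environment chain with exponential clocks. -/
lemma ae_averagesTo (hu : Continuous (Function.uncurry u)) {Q : Measure Env}
    [IsProbabilityMeasure Q]
    (herg : Ergodic timeShift (chainLaw (Q.prod (expMeasure 1)) (clockKernel lam u hu)))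
    (hjump : Integrable jumpSize (Q.compProd (envKernel lam u hu)))
    (hhold : Integrable (fun ω => 1 / totalRate lam u ω 0) Q) :
    ∀ᵐ w ∂chainLaw (Q.prod (expMeasure 1)) (clockKernel lam u hu),
      AveragesTo lam u (∫ z, jumpSize z ∂(Q.compProd (envKernel lam u hu)))
        (∫ ω, 1 / totalRate lam u ω 0 ∂Q) w := by
  set ρ := chainLaw (Q.prod (expMeasure 1)) (clockKernel lam u hu) with hρ
  have hchain : IsChain ρ (Q.prod (expMeasure 1)) (clockKernel lam u hu) := isChain_chainLaw _ _
  have hpair : ρ.map (fun w => ((w 0).1, (w 1).1)) = Q.compProd (envKernel lam u hu) := by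
    -- Forgetting the clocks leaves the environment chain.
    have h1 := hchain.map (η := envKernel lam u hu) measurable_fst fun x => by
      rw [Kernel.parallelComp_apply, Kernel.const_apply, Measure.map_fst_prod, measure_univ,
        one_smul]
    rw [Measure.map_fst_prod, measure_univ, one_smul] at h1
    have hm : Measurable fun (w : ℕ → Env × ℝ) n => (w n).1 := by fun_prop
    have := Measure.isFiniteMeasure_map ρ fun (w : ℕ → Env × ℝ) n => (w n).1
    rw [← h1.map_pair, Measure.map_map (by fun_prop) hm]
    rfl
  have hmp : Measurable fun w : ℕ → Env × ℝ => ((w 0).1, (w 1).1) := by fun_prop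
  have hm1 : Measurable fun w : ℕ → Env × ℝ => jumpSize ((w 0).1, (w 1).1) :=
    measurable_jumpSize.comp hmp
  have hm2 : Measurable fun w : ℕ → Env × ℝ => (w 0).2 / totalRate lam u (w 0).1 0 :=
    (measurable_holdingTime hu.measurable).comp (measurable_pi_apply 0)
  have e1 : ∫ w, jumpSize ((w 0).1, (w 1).1) ∂ρ =
      ∫ z, jumpSize z ∂(Q.compProd (envKernel lam u hu)) := by
    rw [← hpair, integral_map hmp.aemeasurable measurable_jumpSize.aestronglyMeasurable]
  have i1 : Integrable (fun w => jumpSize ((w 0).1, (w 1).1)) ρ := by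
    rw [← hpair] at hjump
    exact hjump.comp_measurable hmp
  have hprod : (fun z : Env × ℝ => z.2 / totalRate lam u z.1 0) =
      fun z => 1 / totalRate lam u z.1 0 * z.2 := by
    funext z; rw [one_div_mul_eq_div]
  -- The clock is independent of the environment and has mean one, so the expected holding time is
  -- the mean of the inverse total rate.
  have e2 : ∫ w, (w 0).2 / totalRate lam u (w 0).1 0 ∂ρ = ∫ ω, 1 / totalRate lam u ω 0 ∂Q := by
    have := integral_prod_mul (μ := Q) (ν := expMeasure 1) (fun ω => 1 / totalRate lam u ω 0)
      fun x => x
    rw [integral_id_expMeasure, mul_one, ← hprod, ← hchain.initial,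
      integral_map (measurable_pi_apply 0).aemeasurable
        (measurable_holdingTime hu.measurable).aestronglyMeasurable] at this
    exact this
  have i2 : Integrable (fun w => (w 0).2 / totalRate lam u (w 0).1 0) ρ := by
    have := hhold.mul_prod integrable_id_expMeasure
    rw [← hprod, ← hchain.initial] at this
    exact this.comp_measurable (measurable_pi_apply 0)
  filter_upwards [ae_tendsto_average herg hm1 i1, ae_tendsto_average herg hm2 i2] with w h1 h2
  rw [e1] at h1
  rw [e2] at h2
  simp only [timeShift_iterate, zero_add, add_comm 1] at h1 h2
  exact ⟨h1, h2⟩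

/-- Properties of the stationary chain hold for the chain in almost every initial environment. -/
lemma ae_ae_chainLaw_dirac (hu : Continuous (Function.uncurry u)) {Q : Measure Env}
    [SFinite Q] {G : Set (ℕ → Env × ℝ)} (hG : MeasurableSet G)
    (h : ∀ᵐ w ∂chainLaw (Q.prod (expMeasure 1)) (clockKernel lam u hu), w ∈ G) :
    ∀ᵐ ω ∂Q, ∀ᵐ w ∂chainLaw ((Measure.dirac ω).prod (expMeasure 1)) (clockKernel lam u hu),
      w ∈ G := by
  rw [chainLaw_eq_bind] at h
  filter_upwards [Measure.ae_ae_of_ae_prod (Measure.ae_ae_of_ae_comp h)] with ω hω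
  rw [chainLaw_eq_bind, ae_iff]
  change (Measure.bind _ _) Gᶜ = 0
  rw [Measure.bind_apply hG.compl (Kernel.aemeasurable _), Measure.dirac_prod,
    lintegral_map (Kernel.measurable_coe _ hG.compl) (by fun_prop)]
  exact lintegral_eq_zero_of_ae_eq_zero hω

namespace Admissible

/-- The environment viewed from the walker with its clocks, in terms of the walk. -/
lemma map_ctLaw (h : Admissible lam u d C) (hu : Continuous (Function.uncurry u))
    (hω : ∀ k, d ≤ gap ω k) :
    (ctLaw lam u ω).map (fun w n => (shift (w.1 n) ω, w.2 n)) =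
      chainLaw ((Measure.dirac ω).prod (expMeasure 1)) (clockKernel lam u hu) := by
  have h1 := (isChain_chainLaw (walkKernel lam u ω) (Measure.dirac 0)).prod
    (isChain_infinitePi (expMeasure 1))
  have hs : Measurable fun k : ℤ => shift k ω := measurable_from_top
  have hφ : Measurable (Prod.map (fun k : ℤ => shift k ω) (id : ℝ → ℝ)) := hs.prodMap measurable_id
  have h2 := h1.map (η := clockKernel lam u hu) hφ fun x => by
    rw [Kernel.parallelComp_apply, Kernel.parallelComp_apply, Kernel.const_apply,
      Kernel.const_apply, ← Measure.map_prod_map _ _ hs measurable_id, Measure.map_id]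
    congr 1
    exact h.envKernel_shift hu hω x.1
  rw [← Measure.map_prod_map _ _ hs measurable_id, Measure.map_id, Measure.map_dirac' hs,
    shift_zero, Measure.map_map (by fun_prop) (by fun_prop)] at h2
  have := h2.eq_chainLaw
  rw [← this]
  rfl

/-- The laws of large numbers for the positions and the jump times in a fixed environment. -/
lemma ae_ctLaw_tendsto (h : Admissible lam u d C) (hu : Continuous (Function.uncurry u))
    (hω : ∀ k, d ≤ gap ω k) (hper : ∀ l : ℤ, l ≠ 0 → ω ≠ shift l ω) {v m : ℝ}
    (hav : ∀ᵐ w ∂chainLaw ((Measure.dirac ω).prod (expMeasure 1)) (clockKernel lam u hu),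
      AveragesTo lam u v m w) :
    ∀ᵐ w ∂ctLaw lam u ω, Tendsto (fun n : ℕ => pos ω (w.1 n) / n) atTop (𝓝 v) ∧
      Tendsto (fun n : ℕ => jumpTime lam u ω w n / n) atTop (𝓝 m) := by
  have hs : Measurable fun k : ℤ => shift k ω := measurable_from_top
  have hm : Measurable fun (w : (ℕ → ℤ) × (ℕ → ℝ)) n => (shift (w.1 n) ω, w.2 n) := by
    refine measurable_pi_lambda _ fun n => (hs.comp (by fun_prop)).prodMk (by fun_prop)
  rw [← h.map_ctLaw hu hω] at hav
  have h0 : ∀ᵐ w ∂ctLaw lam u ω, w.1 0 = 0 := by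
    have h1 : ∀ᵐ y ∂walkLaw lam u ω, y 0 = 0 := by
      refine ae_of_ae_map (f := fun y : ℕ → ℤ => y 0)
        (measurable_pi_apply 0).aemeasurable (p := fun k : ℤ => k = 0) ?_
      rw [walkLaw, (isChain_chainLaw (walkKernel lam u ω) (Measure.dirac 0)).initial]
      simp
    exact Measure.quasiMeasurePreserving_fst.ae h1
  filter_upwards [ae_of_ae_map hm.aemeasurable hav, h0] with w hw hw0
  -- The displacements telescope from label `0`, and the total rate at the origin of a shifted
  -- environment is the total rate at the visited site.
  refine ⟨hw.1.congr fun n => ?_, hw.2.congr fun n => ?_⟩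
  · simp only [jumpSize_shift hper]
    rw [Finset.sum_range_sub fun k => pos ω (w.1 k), hw0, pos_zero, sub_zero]
  · simp only [totalRate_shift, zero_add]
    rfl

/-- Almost surely nonnegative clocks make the jump times monotone, which clock inversion requires
besides the two limits. -/
lemma ae_ctLaw_tendsto_ctWalk (h : Admissible lam u d C) (hω : ∀ k, d ≤ gap ω k) {v m : ℝ}
    (hm : 0 < m)
    (hav : ∀ᵐ w ∂ctLaw lam u ω, Tendsto (fun n : ℕ => pos ω (w.1 n) / n) atTop (𝓝 v) ∧
      Tendsto (fun n : ℕ => jumpTime lam u ω w n / n) atTop (𝓝 m)) :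
    ∀ᵐ w ∂ctLaw lam u ω, Tendsto (fun t : ℝ => ctWalk lam u ω w t / t) atTop (𝓝 (v / m)) := by
  have hnn : ∀ᵐ w ∂ctLaw lam u ω, ∀ k, 0 ≤ w.2 k := by
    have h1 : ∀ᵐ e ∂Measure.infinitePi fun _ : ℕ => expMeasure 1, ∀ k, 0 ≤ e k := by
      refine ae_all_iff.2 fun k => ?_
      refine ae_of_ae_map (f := fun e : ℕ → ℝ => e k)
        (measurable_pi_apply k).aemeasurable (p := fun x : ℝ => 0 ≤ x) ?_
      rw [Measure.infinitePi_map_eval]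
      exact ae_nonneg_expMeasure
    have : SFinite (walkLaw lam u ω) := by unfold walkLaw; infer_instance
    exact Measure.quasiMeasurePreserving_snd.ae h1
  filter_upwards [hav, hnn] with w hw he
  refine tendsto_clock_inversion (X := fun n => pos ω (w.1 n)) (monotone_nat_of_le_succ fun n => ?_)
    (by simp [jumpTime]) hm hw.2 hw.1
  rw [jumpTime, jumpTime, Finset.sum_range_succ]
  exact le_add_of_nonneg_right (div_nonneg (he n) (h.totalRate_pos hω _).le)

end Admissible

end Velocity

end Mott

/-! ### The velocities -/

theorem theorem2
    (P : Measure Mott.Env) [IsProbabilityMeasure P]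
    -- the sequence of distances and marks is stationary and ergodic
    (hA1 : Ergodic (Mott.shift 1) P)
    -- the distance has finite mean
    (hA2 : Integrable (fun ω => Mott.gap ω 0) P)
    -- the environment is almost surely aperiodic
    (hA3 : ∀ l : ℤ, l ≠ 0 → P {ω | ω = Mott.shift l ω} = 0)
    -- the distance is bounded below by a positive constant
    (hA4 : ∃ d : ℝ, 0 < d ∧ ∀ᵐ ω ∂P, d ≤ Mott.gap ω 0)
    (u : ℝ → ℝ → ℝ) (hu : Continuous (Function.uncurry u))
    (hu_bdd : ∃ C : ℝ, ∀ a b, |u a b| ≤ C)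
    (hu_symm : ∀ a b, u a b = u b a)
    (lam : ℝ) (hlam : lam ∈ Set.Ioo (0 : ℝ) 1)
    (hexp : Integrable (fun ω => Real.exp ((1 - lam) * Mott.gap ω 0)) P) :
    ∃ Q : Measure Mott.Env,
      Mott.IsInvariantErgodic (Mott.envKernel lam u hu) Q ∧ Q ≪ P ∧ P ≪ Q ∧
      ∃ vY vX : ℝ,
        Mott.IsVelocityY P lam u vY ∧ Mott.IsVelocityX P lam u vX ∧
        (∀ᵐ ω ∂Q, Summable fun i => Mott.pos ω i * Mott.jumpProb lam u ω 0 i) ∧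
        Integrable (Mott.drift lam u) Q ∧
        vY = ∫ ω, Mott.drift lam u ω ∂Q ∧
        (∀ᵐ ω ∂Q, Summable (Mott.rate lam u ω 0)) ∧
        Integrable (fun ω => 1 / Mott.totalRate lam u ω 0) Q ∧
        0 < ∫ ω, 1 / Mott.totalRate lam u ω 0 ∂Q ∧
        vX = vY / ∫ ω, 1 / Mott.totalRate lam u ω 0 ∂Q := by
  obtain ⟨d, hd, hgap0⟩ := hA4
  obtain ⟨C, hC⟩ := hu_bdd
  have h : Mott.Admissible lam u d C := ⟨hlam.1, hlam.2, hd, hC, hu_symm⟩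
  have hP := hA1.toMeasurePreserving
  have hgap := Mott.ae_le_gap hP hgap0
  have hper : ∀ᵐ ω ∂P, ∀ l : ℤ, l ≠ 0 → ω ≠ Mott.shift l ω := by
    refine ae_all_iff.2 fun l => ?_
    rcases eq_or_ne l 0 with rfl | hl
    · exact Eventually.of_forall fun ω h0 => absurd rfl h0
    · filter_upwards [measure_eq_zero_iff_ae_notMem.1 (hA3 l hl)] with ω hω _
      exact hω
  obtain ⟨Q, hQprob, hinv, hPQ, c, hc, hQle⟩ := h.exists_invariant hu hP hgap0 hexp
  have hQP : Q ≪ P := (Measure.absolutelyContinuous_of_le hQle).trans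
    ((Measure.smul_absolutelyContinuous).trans (withDensity_absolutelyContinuous _ _))
  have hconst := h.ae_const_of_envKernel hu hA1 hgap hPQ hQP
  have hjump := h.integrable_jumpSize hu hP hgap hper hexp hc hQle
  have hhold := h.integrable_one_div_totalRate hu.measurable hP hgap hexp hc hQle
  have hinner : ∀ᵐ ω ∂Q, ∫ ω', Mott.jumpSize (ω, ω') ∂Mott.envKernel lam u hu ω =
      Mott.drift lam u ω := by
    filter_upwards [hQP.ae_le hgap, hQP.ae_le hper] with ω hω hp
    exact h.integral_jumpSize hu hω hp
  have hdrift : Integrable (Mott.drift lam u) Q := by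
    have : Integrable (fun ω => ∫ ω', Mott.jumpSize (ω, ω') ∂Mott.envKernel lam u hu ω) Q :=
      hjump.integral_compProd
    exact this.congr hinner
  have hv : ∫ z, Mott.jumpSize z ∂(Q.compProd (Mott.envKernel lam u hu)) =
      ∫ ω, Mott.drift lam u ω ∂Q := by
    rw [Measure.integral_compProd hjump, integral_congr_ae hinner]
  have hpos : 0 < ∫ ω, 1 / Mott.totalRate lam u ω 0 ∂Q := by
    have hp : ∀ᵐ ω ∂Q, 0 < 1 / Mott.totalRate lam u ω 0 := by
      filter_upwards [hQP.ae_le hgap] with ω hω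
      exact one_div_pos.2 (h.totalRate_pos hω 0)
    refine (integral_pos_iff_support_of_nonneg_ae (hp.mono fun ω => le_of_lt) hhold).2 ?_
    have hsupp : (Function.support fun ω => 1 / Mott.totalRate lam u ω 0) ∈ ae Q :=
      hp.mono fun ω hω => hω.ne'
    rw [measure_congr (eventuallyEq_univ.2 hsupp), measure_univ]
    exact one_pos
  have herg := Mott.ergodic_timeShift_chainLaw (Mott.clockKernel lam u hu)
    (Mott.bind_parallelComp_const _ (expMeasure 1) hinv)
    (Mott.ae_const_of_parallelComp_const _ (expMeasure 1) hinv hconst)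
  -- The ergodic theorem holds for `Q`-almost every initial environment; `P ≪ Q` makes this a
  -- statement about `P`.
  have hav := hPQ.ae_le (Mott.ae_ae_chainLaw_dirac hu
    (Mott.measurableSet_averagesTo hu.measurable _ _) (Mott.ae_averagesTo hu herg hjump hhold))
  rw [hv] at hav
  have hlim : ∀ᵐ ω ∂P, ∀ᵐ w ∂Mott.ctLaw lam u ω,
      Tendsto (fun n : ℕ => Mott.pos ω (w.1 n) / n) atTop (𝓝 (∫ ω, Mott.drift lam u ω ∂Q)) ∧
      Tendsto (fun n : ℕ => Mott.jumpTime lam u ω w n / n) atTop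
        (𝓝 (∫ ω, 1 / Mott.totalRate lam u ω 0 ∂Q)) := by
    filter_upwards [hgap, hper, hav] with ω hω hp hw
    exact h.ae_ctLaw_tendsto hu hω hp hw
  refine ⟨Q, ⟨hQprob, hinv, Mott.ergodic_timeShift_chainLaw _ hinv hconst⟩, hQP, hPQ,
    ∫ ω, Mott.drift lam u ω ∂Q, _, ?_, ?_, ?_, hdrift, rfl, ?_, hhold, hpos, rfl⟩
  · filter_upwards [hlim] with ω hω
    -- The limit of the positions does not involve the clocks, so for almost every path one good
    -- clock sequence is enough.
    exact (Measure.ae_ae_of_ae_prod hω).mono fun y hy => hy.exists.choose_spec.1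
  · filter_upwards [hgap, hlim] with ω hω hw
    exact h.ae_ctLaw_tendsto_ctWalk hω hpos hw
  · filter_upwards [hQP.ae_le hgap] with ω hω
    exact h.summable_pos_mul_jumpProb hω
  · filter_upwards [hQP.ae_le hgap] with ω hω
    exact h.summable_rate hω 0
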